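/- **Theorem (counterexample to local and weak local monomialization).** Conventions. Let $k$ be a field. An $n$-dimensional function field over $k$ is a finitely generated field extension of $k$ of transcendence degree $n$. An algebraic local ring of a function field $F/k$ is a local subring $R\subset F$ containing $k$, with quotient field $F$, that is a localization at a prime ideal of a finitely generated $k$-algebra. A local ring $S$ dominates a local ring $R\subset S$ if $m_S\cap R=m_R$; a valuation dominates $R$ if its valuation ring does. An inclusion $R\to S$ is *monomial* if $R$ and $S$ are regular local rings of the same dimension $d$ and there are regular systems of parameters $x_1,\dots,x_d$ of $R$ and $y_1,\dots,y_d$ of $S$, units $\delta_1,\dots,\delta_d$ of $S$ and a $d\times d$ matrix $(a_{ij})$ of natural numbers with nonzero determinant such that $x_i=\delta_i\prod_{j=1}^d y_j^{a_{ij}}$ for $1\le i\le d$. Let $k$ be a field of characteristic $p>0$ with at least $3$ elements, and let $n\ge 2$. Then there exist a finite separable extension $K^*/K$ of $n$-dimensional function fields over $k$, a valuation $\nu^*$ of $K^*$ that is trivial on $k$, with restriction $\nu$ to $K$, and regular algebraic local rings $A$ of $K$ and $B$ of $K^*$, such that $B$ dominates $A$, $\nu^*$ dominates $B$, and there do not exist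 regular algebraic local rings $A'$ of $K$ and $B'$ of $K^*$ such that $\nu^*$ dominates $B'$, $B'$ dominates $A'$, $A'$ dominates $A$, $B'$ dominates $B$ and $A'\to B'$ is monomial. Explicitly, the example can be chosen as follows: $K^*=k(t_1,\dots,t_{n-2},x,y)$ is the rational function field in $n$ variables, $K=k(t_1,\dots,t_{n-2},u,v)$ with $u=x^p(1+y)$ and $v=y^p+x$, $A=k[t_1,\dots,t_{n-2},u,v]_{(u,v)}$, $B=k[t_1,\dots,t_{n-2},x,y]_{(x,y)}$, and $\nu^*$ takes values in $\mathbb Q$ with $\nu^*(x)=1$ and value groups $\Gamma_{\nu^*}=\Gamma_\nu=\frac1{p^\infty}\mathbb Z=\{a/p^m : a\in\mathbb Z,\ m\in\mathbb N\}$. -/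

import Mathlib

universe u

/-- `F` is an `n`-dimensional algebraic function field over `k`: a finitely generated field
extension of `k` of transcendence degree `n`. -/
structure IsAlgFunctionField (k F : Type u) [Field k] [Field F] [Algebra k F] (n : ℕ) : Prop where
  fg : (⊤ : IntermediateField k F).FG
  trdeg_eq : Algebra.trdeg k F = n

/-- The local subring `R` of the field `F` is an algebraic local ring of `F` over `k`: its quotient
field is `F`, it contains (the image of) `k`, and it is essentially of finite type over `k`. -/
structure IsAlgebraicLocalRing (k : Type u) {F : Type u} [Field k] [Field F] [Algebra k F]
    (R : LocalSubring F) : Prop where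
  isFractionRing : IsFractionRing R.toSubring F
  essFiniteType : ∃ S : Subalgebra k F, S.toSubring = R.toSubring ∧ Algebra.EssFiniteType k S

/-- The valuation ring `{f | 0 ≤ ν f}` of an additive valuation on a field, as a local subring. -/
noncomputable def valuationLocalRing {F : Type u} [Field F] (ν : AddValuation F (WithTop ℚ)) :
    LocalSubring F :=
  (AddValuation.toValuation ν).valuationSubring.toLocalSubring

theorem mem_valuationLocalRing {F : Type u} [Field F] (ν : AddValuation F (WithTop ℚ)) (f : F) :
    f ∈ (valuationLocalRing ν).toSubring ↔ 0 ≤ ν f := Iff.rfl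

/-- The set of finite values `ν f`, `f ≠ 0`, that is, the value group of `ν` inside `ℚ`. -/
def valueSet {F : Type u} [Field F] (ν : AddValuation F (WithTop ℚ)) : Set ℚ :=
  {q | ∃ f : F, f ≠ 0 ∧ ν f = (q : WithTop ℚ)}

/-- `(1/p^∞)ℤ`: the rational numbers `a / p ^ m` with `a` an integer and `m` a natural number. -/
def onePPowInfty (p : ℕ) : Set ℚ :=
  {q | ∃ (a : ℤ) (m : ℕ), q = a / (p : ℚ) ^ m}

/-- For local rings `A` of a field `K` and `B` of an extension field `L`: `B` dominates `A`, that is,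
`A ⊆ B` and `m_B ∩ A = m_A`. (Mathlib's order on `LocalSubring L` is the domination order.) -/
def Dominates {K L : Type u} [Field K] [Field L] [Algebra K L]
    (B : LocalSubring L) (A : LocalSubring K) : Prop :=
  A.map (algebraMap K L) ≤ B

/-- The extension `A → B` of local rings, of `K` and of an extension field `L` respectively, is
monomial: both are regular local rings of the same dimension `n`, and there are regular systems of
parameters `x₁, …, xₙ` of `A` and `y₁, …, yₙ` of `B`, units `δ₁, …, δₙ` of `B` and a matrix of natural
numbers with nonzero determinant such that `xᵢ = δᵢ ∏ⱼ yⱼ ^ aᵢⱼ` for all `i`. -/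
def IsMonomialExtension {K L : Type u} [Field K] [Field L] [Algebra K L]
    (A : LocalSubring K) (B : LocalSubring L) : Prop :=
  IsRegularLocalRing A.toSubring ∧ IsRegularLocalRing B.toSubring ∧
  ∃ n : ℕ, ringKrullDim A.toSubring = n ∧ ringKrullDim B.toSubring = n ∧
  ∃ (x : Fin n → A.toSubring) (y : Fin n → B.toSubring) (δ : Fin n → (B.toSubring)ˣ)
    (a : Matrix (Fin n) (Fin n) ℕ),
    Ideal.span (Set.range x) = IsLocalRing.maximalIdeal A.toSubring ∧
    Ideal.span (Set.range y) = IsLocalRing.maximalIdeal B.toSubring ∧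
    (a.map (fun m : ℕ => (m : ℤ))).det ≠ 0 ∧
    ∀ i, algebraMap K L (x i) = (((δ i : B.toSubring) * ∏ j, y j ^ a i j : B.toSubring) : L)

/-- `R = k[S]_{(I)}` inside the field `F`: the ideal of the `k`-algebra `k[S] ⊆ F` generated by the
elements of `I` (assumed to lie in `k[S]`) is prime, and `R` is the localization of `k[S]` there. -/
def IsLocalizationOfAdjoin (k : Type u) {F : Type u} [Field k] [Field F] [Algebra k F]
    (S I : Set F) (R : LocalSubring F) : Prop :=
  ∃ h : (Ideal.span
      {c : (Algebra.adjoin k S).toSubring | (c : F) ∈ I}).IsPrime,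
    R = @LocalSubring.ofPrime F _ (Algebra.adjoin k S).toSubring
      (Ideal.span {c : (Algebra.adjoin k S).toSubring | (c : F) ∈ I}) h

section

/-! ### Two-dimensional regular local rings and Abhyankar's factorization step. -/

section LocalAlgebra
open IsLocalRing

/-! Put κ = k(t₁, …, t_{n-2}). The rings A and B contain κ, hence so do all local rings above them,
and the problem becomes one about local rings of dimension two in κ(u, v) ⊂ κ(x, y).

The maps u = x^p (1 + y), v = y^p + x are an instance of the shape u = γ x^p, v = τ y^p + σ x, with
units γ, τ, σ such that γ has a nonzero linear term γ₁ y (`IsStableForm`). This shape survives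
blowing up on both sides (`IsStableForm.exists_blowup`). Substituting x = y^p (Y + c) gives v = γ'
y^p with γ' = τ + σ (Y + c), whose linear term in Y is nonzero because σ is a unit. In
characteristic p, subtracting the right constant β gives u / v^p - β = τ' Y^p + σ' y, and σ' is a
unit because γ₁ ≠ 0. The constant c must avoid 0 and one further value, hence the three elements of
the field. Iteration yields two coordinate sequences `z` and `w`, starting with x, y and with u, v,
every pair (z i, z (i + 1)) being in stable form over (w i, w (i + 1)).

Along `z` every nonzero element of the field eventually becomes a power of a coordinate times a unit
(`IsBlowupSeq.exists_eq_zpow_mul`). This defines a valuation with ν (z i) = 1 / p^i, and ν (w i) = p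
/ p^i, so both value groups are (1/p^∞)ℤ. By Abhyankar's factorization
(`surjective_algebraMap_or_dvd_of_birational`) the only regular local rings above the first one
along ν are κ[z i / z (i+1)^l, z (i+1)] localized at the origin, with l < p
(`IsBlowupSeq.exists_eq_locRing`); likewise for `w`.

So A' belongs to some (w N, w (N+1), j) and B' to some (z M, z (M+1), l), and
`not_isMonomialPair_locRing` compares positions. If A' lies beyond the level of B', it contains w M
/ w (M+1), which is not in B', so B' does not dominate A'. If N < M, then parameters f, g of A' are
multiplicatively dependent in B', or else one of them acquires a prime factor of the form unit ·
Y^(p-l) + unit · X that cannot be part of suitable parameters. In the remaining case N = M, j = 0,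
monomiality of f, g forces an expression cγ + dσ^p into the ideal (X, Y²)
(`IsParamPair.mem_span_of_isMonomialPair`). Modulo this ideal c, d and σ^p are constants, so the
linear term of γ in Y cannot cancel. -/

theorem exists_eq_mul_pow_unit_of_maximalIdeal_eq_span {R : Type*} [CommRing R] [IsLocalRing R] [IsNoetherianRing R]
    {y : R} (hm : maximalIdeal R = Ideal.span {y}) {f : R} (hf : f ≠ 0) :
    ∃ s w, IsUnit w ∧ f = w * y ^ s := by
  have h1 : ∃ s, ¬ y ^ s ∣ f := by
    by_contra! h
    apply hf
    have : f ∈ (⨅ i : ℕ, maximalIdeal R ^ i) := by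
      rw [Ideal.mem_iInf]
      intro i
      rw [hm, Ideal.span_singleton_pow, Ideal.mem_span_singleton]
      exact h i
    rwa [Ideal.iInf_pow_eq_bot_of_isLocalRing _ (maximalIdeal.isMaximal R).ne_top,
      Ideal.mem_bot] at this
  classical
  obtain ⟨s, hs⟩ : ∃ s, Nat.find h1 = s + 1 := by
    refine Nat.exists_eq_succ_of_ne_zero fun h => ?_
    have := Nat.find_spec h1
    rw [h] at this
    simp at this
  have h2 := Nat.find_min h1 (m := s) (by omega)
  have h3 := Nat.find_spec h1
  rw [hs] at h3
  push Not at h2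
  obtain ⟨w, rfl⟩ := h2
  refine ⟨s, w, ?_, mul_comm _ _⟩
  by_contra hw
  have : w ∈ maximalIdeal R := hw
  rw [hm, Ideal.mem_span_singleton] at this
  exact h3 (by rw [pow_succ]; exact mul_dvd_mul_left _ this)

/-- Modulo x the maximal ideal is generated by y, so a nonzero residue is a unit times a power of y.
This normal form replaces Weierstrass preparation in what follows. -/
theorem mem_span_or_exists_eq_add_unit_mul_pow {R : Type*} [CommRing R] [IsLocalRing R]
    [IsNoetherianRing R] {x y : R} (hm : maximalIdeal R = Ideal.span {x, y}) (f : R) :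
    x ∣ f ∨ ∃ r w s, IsUnit w ∧ f = x * r + w * y ^ s := by
  by_cases hxf : x ∣ f
  · exact Or.inl hxf
  refine Or.inr ?_
  have hx : x ∈ maximalIdeal R := hm ▸ Ideal.subset_span (by simp)
  let q := Ideal.Quotient.mk (Ideal.span {x})
  have hq : Function.Surjective q := Ideal.Quotient.mk_surjective
  have hI : Ideal.span {x} ≠ ⊤ := by
    intro h
    rw [Ideal.span_singleton_eq_top] at h
    exact hx h
  have : Nontrivial (R ⧸ Ideal.span {x}) := Ideal.Quotient.nontrivial_iff.mpr hI
  have : IsLocalRing (R ⧸ Ideal.span {x}) := IsLocalRing.of_surjective' q hq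
  have hloc : IsLocalHom q := IsLocalHom.of_surjective q hq
  have hm' : maximalIdeal (R ⧸ Ideal.span {x}) = Ideal.span {q y} := by
    have := IsLocalRing.map_maximalIdeal_of_surjective q hq
    rw [← this, hm, Ideal.map_span, Set.image_pair]
    have : q x = 0 := Ideal.Quotient.eq_zero_iff_mem.mpr (Ideal.mem_span_singleton_self x)
    rw [this, Ideal.span_insert_zero]
  have hf : q f ≠ 0 := by
    intro h
    exact hxf (Ideal.mem_span_singleton.mp (Ideal.Quotient.eq_zero_iff_mem.mp h))
  obtain ⟨s, w, hw, h⟩ := exists_eq_mul_pow_unit_of_maximalIdeal_eq_span hm' hf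
  obtain ⟨w, rfl⟩ := hq w
  have hw' : IsUnit w := (isUnit_map_iff q w).mp hw
  have : q (f - w * y ^ s) = 0 := by rw [map_sub, h]; simp
  rw [Ideal.Quotient.eq_zero_iff_mem, Ideal.mem_span_singleton] at this
  obtain ⟨r, hr⟩ := this
  exact ⟨r, w, s, hw', by linear_combination hr⟩

/-- When x is not in P, take f₀ in P whose residue modulo x has the least order in y. It generates P
modulo x, and since P is prime P = (f₀) + xP, so Nakayama gives P = (f₀). If all of P vanishes
modulo x, then f₀ = 0 does the same. -/
theorem Ideal.IsPrime.exists_eq_span_singleton {R : Type*} [CommRing R] [IsDomain R] [IsLocalRing R]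
    [IsNoetherianRing R] {x y : R} (hm : maximalIdeal R = Ideal.span {x, y}) (hx : Prime x)
    {P : Ideal R} (hP : P.IsPrime) (hPm : P ≠ maximalIdeal R) : ∃ f, P = Ideal.span {f} := by
  have hPle := IsLocalRing.le_maximalIdeal hP.ne_top
  by_cases hxP : x ∈ P
  · refine ⟨x, le_antisymm (fun f hf => ?_) (by simpa [Ideal.span_le] using hxP)⟩
    rw [Ideal.mem_span_singleton]
    rcases mem_span_or_exists_eq_add_unit_mul_pow hm f with h | ⟨r, w, s, hw, rfl⟩
    · exact h
    · exfalso
      have h1 : w * y ^ s ∈ P := by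
        rw [P.add_mem_iff_right (P.mul_mem_right _ hxP)] at hf
        exact hf
      rcases hP.mem_or_mem h1 with h2 | h2
      · exact hP.ne_top (Ideal.eq_top_of_isUnit_mem _ h2 hw)
      · have h3 := hP.mem_of_pow_mem _ h2
        apply hPm
        refine le_antisymm hPle ?_
        rw [hm, Ideal.span_le]
        rintro _ (rfl | rfl) <;> assumption
  · have key : ∀ f0, f0 ∈ P → (∀ f ∈ P, ∃ r, f - r * f0 ∈ Ideal.span {x}) → P = Ideal.span {f0} := by
      intro f0 h0 h
      refine le_antisymm ?_ (by simpa [Ideal.span_le] using h0)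
      apply Submodule.le_of_le_smul_of_le_jacobson_bot (I := Ideal.span {x}) (IsNoetherian.noetherian P)
      · rw [IsLocalRing.jacobson_eq_maximalIdeal _ bot_ne_top, hm]
        exact Ideal.span_mono (by simp)
      · intro f hf
        obtain ⟨r, hr⟩ := h f hf
        obtain ⟨q, hq⟩ := Ideal.mem_span_singleton.mp hr
        have : q ∈ P := by
          have : x * q ∈ P := by
            rw [← hq]; exact P.sub_mem hf (P.mul_mem_left _ h0)
          exact (hP.mem_or_mem this).resolve_left hxP
        have h5 : f = r * f0 + x * q := by linear_combination hq
        rw [h5]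
        refine Submodule.add_mem_sup (Ideal.mul_mem_left _ _ (Ideal.mem_span_singleton_self _)) ?_
        exact Submodule.smul_mem_smul (Ideal.mem_span_singleton_self _) this
    by_cases hS : ∃ s, ∃ f ∈ P, ∃ r w, IsUnit w ∧ f = x * r + w * y ^ s
    · classical
      obtain ⟨f0, h0, r0, w0, hw0, e0⟩ := Nat.find_spec hS
      refine ⟨f0, key f0 h0 fun f hf => ?_⟩
      rcases mem_span_or_exists_eq_add_unit_mul_pow hm f with h | ⟨r, w, s, hw, e⟩
      · exact ⟨0, by simpa [Ideal.mem_span_singleton] using h⟩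
      · have hs := Nat.find_min' hS ⟨f, hf, r, w, hw, e⟩
        obtain ⟨d, rfl⟩ := Nat.exists_eq_add_of_le hs
        obtain ⟨w0, rfl⟩ := hw0
        refine ⟨w * ↑w0⁻¹ * y ^ d, ?_⟩
        rw [Ideal.mem_span_singleton]
        refine ⟨r - w * ↑w0⁻¹ * y ^ d * r0, ?_⟩
        have : (w0 : R) * ↑w0⁻¹ = 1 := by simp
        rw [e, e0, pow_add]
        linear_combination (- w * y ^ d * y ^ (Nat.find hS)) * this
    · push Not at hS
      refine ⟨0, key 0 P.zero_mem fun f hf => ⟨0, ?_⟩⟩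
      rcases mem_span_or_exists_eq_add_unit_mul_pow hm f with h | ⟨r, w, s, hw, e⟩
      · simpa [Ideal.mem_span_singleton] using h
      · exact absurd e (hS s f hf r w hw)

theorem uniqueFactorizationMonoid_of_maximalIdeal_eq_span_pair {R : Type*} [CommRing R] [IsDomain R] [IsLocalRing R]
    [IsNoetherianRing R] {x y : R} (hm : maximalIdeal R = Ideal.span {x, y}) (hx : Prime x) :
    UniqueFactorizationMonoid R := by
  rw [UniqueFactorizationMonoid.iff_exists_prime_mem_of_isPrime]
  intro P hP hPr
  by_cases hPm : P = maximalIdeal R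
  · exact ⟨x, by rw [hPm, hm]; exact Ideal.subset_span (by simp), hx⟩
  · obtain ⟨f, rfl⟩ := hPr.exists_eq_span_singleton hm hx hPm
    refine ⟨f, Ideal.mem_span_singleton_self f, ?_⟩
    rwa [Ideal.span_singleton_prime] at hPr
    rintro rfl
    simp at hP

/-- A prime containing a and b that is not maximal would be principal, and its generator a common
factor. So the radical of (a, b) contains the maximal ideal. -/
theorem exists_maximalIdeal_pow_le_span_pair_of_isRelPrime {R : Type*} [CommRing R] [IsDomain R] [IsLocalRing R]
    [IsNoetherianRing R] {x y : R} (hm : maximalIdeal R = Ideal.span {x, y}) (hx : Prime x)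
    {a b : R} (h : IsRelPrime a b) : ∃ s, maximalIdeal R ^ s ≤ Ideal.span {a, b} := by
  have h1 : maximalIdeal R ≤ (Ideal.span {a, b}).radical := by
    rw [Ideal.radical_eq_sInf]
    refine le_sInf ?_
    rintro P ⟨hab, hP⟩
    by_contra hPm
    have haP : a ∈ P := hab (Ideal.subset_span (by simp))
    have hbP : b ∈ P := hab (Ideal.subset_span (by simp))
    obtain ⟨f, rfl⟩ := hP.exists_eq_span_singleton hm hx (fun h => hPm h.ge)
    rw [Ideal.mem_span_singleton] at haP hbP
    exact hP.ne_top (Ideal.span_singleton_eq_top.mpr (h haP hbP))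
  obtain ⟨n, hn⟩ := (Ideal.span {a, b}).exists_radical_pow_le_of_fg
    (IsNoetherian.noetherian _)
  exact ⟨n, (Ideal.pow_right_mono h1 n).trans hn⟩

/-- A minimal prime P over x has height at most one, hence omits y. In the normal form x r + w y^s
an element of P can therefore only be a multiple of x. -/
theorem prime_of_ringKrullDim_eq_two {R : Type*} [CommRing R] [IsDomain R] [IsLocalRing R]
    [IsNoetherianRing R] {x y : R} (hm : maximalIdeal R = Ideal.span {x, y})
    (hd : ringKrullDim R = 2) : Prime x := by
  have hxm : x ∈ maximalIdeal R := hm ▸ Ideal.subset_span (by simp)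
  have hI : Ideal.span {x} ≠ ⊤ := by
    intro h
    rw [Ideal.span_singleton_eq_top] at h
    exact hxm h
  have hht : (maximalIdeal R).height = 2 := by
    have := IsLocalRing.maximalIdeal_height_eq_ringKrullDim (R := R)
    rw [hd] at this
    exact WithBot.coe_injective this
  have hx0 : x ≠ 0 := by
    rintro rfl
    rw [Ideal.span_insert_zero] at hm
    have := Ideal.height_le_one_of_isPrincipal_of_mem_minimalPrimes (Ideal.span {y}) (maximalIdeal R) (by
      rw [← hm]; rw [Ideal.minimalPrimes_eq_subsingleton_self]; rfl)
    rw [hht] at this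
    exact absurd this (by decide)
  obtain ⟨P, hP⟩ := Ideal.nonempty_minimalPrimes hI
  have hPr : P.IsPrime := hP.1.1
  have hxP : x ∈ P := hP.1.2 (Ideal.mem_span_singleton_self x)
  have hPle := IsLocalRing.le_maximalIdeal hPr.ne_top
  have hht1 := Ideal.height_le_one_of_isPrincipal_of_mem_minimalPrimes (Ideal.span {x}) P hP
  have hyP : y ∉ P := by
    intro hy
    have : P = maximalIdeal R := by
      refine le_antisymm hPle ?_
      rw [hm, Ideal.span_le]
      rintro _ (rfl | rfl) <;> assumption
    rw [this, hht] at hht1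
    exact absurd hht1 (by decide)
  have : P = Ideal.span {x} := by
    refine le_antisymm (fun f hf => ?_) (by simpa [Ideal.span_le] using hxP)
    rw [Ideal.mem_span_singleton]
    rcases mem_span_or_exists_eq_add_unit_mul_pow hm f with h | ⟨r, w, s, hw, rfl⟩
    · exact h
    · exfalso
      have h1 : w * y ^ s ∈ P := by
        rw [P.add_mem_iff_right (P.mul_mem_right _ hxP)] at hf
        exact hf
      rcases hPr.mem_or_mem h1 with h2 | h2
      · exact hPr.ne_top (Ideal.eq_top_of_isUnit_mem _ h2 hw)
      · exact hyP (hPr.mem_of_pow_mem _ h2)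
  rw [this] at hPr
  rwa [Ideal.span_singleton_prime hx0] at hPr

theorem ringKrullDim_eq_two_of_prime {R : Type*} [CommRing R] [IsDomain R] [IsLocalRing R]
    [IsNoetherianRing R] {x y : R} (hm : maximalIdeal R = Ideal.span {x, y}) (hx : Prime x)
    (hxy : ¬ x ∣ y) : ringKrullDim R = 2 := by
  have h1 : (Ideal.span {x}).IsPrime := (Ideal.span_singleton_prime hx.ne_zero).mpr hx
  have h2 : (⊥ : Ideal R) < Ideal.span {x} := by
    rw [bot_lt_iff_ne_bot]; simpa using hx.ne_zero
  have h3 : Ideal.span {x} < maximalIdeal R := by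
    rw [hm]
    refine lt_of_le_of_ne (Ideal.span_mono (by simp)) fun h => hxy ?_
    rw [← Ideal.mem_span_singleton, h]
    exact Ideal.subset_span (by simp)
  have h4 := Ideal.height_add_one_le_of_lt_of_isPrime h2
  have h5 := Ideal.height_add_one_le_of_lt_of_isPrime h3
  have h6 : (2 : ℕ∞) ≤ (maximalIdeal R).height := by
    refine le_trans ?_ h5
    calc (2 : ℕ∞) = 0 + 1 + 1 := by norm_num
      _ ≤ _ := by gcongr; exact le_trans (by gcongr; exact zero_le) h4
  have h7 := ringKrullDim_le_spanFinrank_maximalIdeal (R := R)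
  have h8 : (maximalIdeal R).spanFinrank ≤ 2 := by
    rw [hm]
    exact (Submodule.spanFinrank_span_le_ncard_of_finite (by simp)).trans
      ((Set.ncard_insert_le x {y}).trans (by simp))
  refine le_antisymm (h7.trans (by exact_mod_cast h8)) ?_
  rw [← IsLocalRing.maximalIdeal_height_eq_ringKrullDim]
  exact WithBot.coe_le_coe.mpr h6

theorem isRegularLocalRing_of_prime {R : Type*} [CommRing R] [IsDomain R] [IsLocalRing R]
    [IsNoetherianRing R] {x y : R} (hm : maximalIdeal R = Ideal.span {x, y}) (hx : Prime x)
    (hxy : ¬ x ∣ y) : IsRegularLocalRing R := by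
  apply IsRegularLocalRing.of_spanFinrank_maximalIdeal_le
  rw [ringKrullDim_eq_two_of_prime hm hx hxy, hm]
  exact_mod_cast (Submodule.spanFinrank_span_le_ncard_of_finite (by simp)).trans
      ((Set.ncard_insert_le x {y}).trans (by simp))


open Polynomial

theorem exists_algebraMap_eq_pow_mul_aeval_div {R F : Type*} [CommRing R] [Field F] [Algebra R F] {a b : R}
    (hb : algebraMap R F b ≠ 0) (n : ℕ) (P : R[X]) (hP : P.natDegree ≤ n) :
    algebraMap R F (∑ i ∈ Finset.range (n + 1), P.coeff i * (a ^ i * b ^ (n - i))) =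
      algebraMap R F b ^ n * aeval (algebraMap R F a / algebraMap R F b) P := by
  rw [aeval_eq_sum_range' (Nat.lt_succ_of_le hP), Finset.mul_sum, map_sum]
  refine Finset.sum_congr rfl fun i hi => ?_
  have : i ≤ n := Nat.lt_succ_iff.mp (Finset.mem_range.mp hi)
  obtain ⟨d, rfl⟩ := Nat.exists_eq_add_of_le this
  rw [Algebra.smul_def, map_mul, map_mul, map_pow, map_pow, div_pow, Nat.add_sub_cancel_left, pow_add]
  field_simp

/-- The residue of a/b is transcendental when a and b are coprime nonunits. Indeed b divides the
leading coefficient of a relation; subtracting a multiple of bX - a, whose coefficients lie in the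
maximal ideal, lowers the degree. -/
theorem map_residue_eq_zero_of_aeval_div_eq_zero {R F : Type*} [CommRing R] [IsDomain R]
    [IsLocalRing R] [UniqueFactorizationMonoid R] [Field F] [Algebra R F] [FaithfulSMul R F]
    {a b : R} (hb0 : b ≠ 0) (hab : IsRelPrime a b) (ha : a ∈ maximalIdeal R)
    (hb : b ∈ maximalIdeal R) (P : R[X])
    (hP : aeval (algebraMap R F a / algebraMap R F b) P = 0) : P.map (residue R) = 0 := by
  have hbF : algebraMap R F b ≠ 0 := by simpa using hb0
  have hinj := FaithfulSMul.algebraMap_injective R F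
  obtain ⟨n, hn⟩ : ∃ n, P.natDegree ≤ n := ⟨_, le_rfl⟩
  induction n generalizing P with
  | zero =>
    rw [eq_C_of_natDegree_le_zero hn, aeval_C] at hP
    have := hinj (hP.trans (map_zero _).symm)
    rw [eq_C_of_natDegree_le_zero hn, this]
    simp
  | succ n ih =>
    have h1 := exists_algebraMap_eq_pow_mul_aeval_div (a := a) hbF (n + 1) P hn
    rw [hP, mul_zero] at h1
    have h2 := hinj (h1.trans (map_zero _).symm)
    rw [Finset.sum_range_succ] at h2
    have h3 : b ∣ P.coeff (n + 1) * a ^ (n + 1) := by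
      have : b ∣ ∑ i ∈ Finset.range (n + 1), P.coeff i * (a ^ i * b ^ (n + 1 - i)) := by
        refine Finset.dvd_sum fun i hi => ?_
        have : n + 1 - i ≠ 0 := by have := Finset.mem_range.mp hi; omega
        exact Dvd.dvd.mul_left (Dvd.dvd.mul_left (dvd_pow_self b this) _) _
      rw [Nat.sub_self, pow_zero, mul_one] at h2
      rw [← dvd_add_right this, h2]
      exact dvd_zero b
    have h4 : b ∣ P.coeff (n + 1) := (hab.pow_left (m := n + 1)).symm.dvd_of_dvd_mul_right h3
    obtain ⟨h, hh⟩ := h4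
    have h5 := ih (P - C h * X ^ n * (C b * X - C a)) (by
      rw [map_sub, hP]
      simp only [map_mul, map_sub, aeval_C, aeval_X, map_pow]
      field_simp
      simp) (by
      rw [natDegree_le_iff_coeff_eq_zero]
      intro N hN
      have e : C h * X ^ n * (C b * X - C a) = C (h * b) * X ^ (n + 1) - C (h * a) * X ^ n := by
        simp only [map_mul]; ring
      rw [e, coeff_sub, coeff_sub, coeff_C_mul_X_pow, coeff_C_mul_X_pow]
      rcases Nat.lt_or_eq_of_le (Nat.succ_le_of_lt hN) with h6 | h6
      · rw [coeff_eq_zero_of_natDegree_lt (hn.trans_lt h6), if_neg (by omega), if_neg (by omega)]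
        simp
      · subst h6
        rw [if_pos rfl, if_neg (by omega)]
        simp [hh, mul_comm])
    have ha' : residue R a = 0 := (residue_eq_zero_iff a).mpr ha
    have hb' : residue R b = 0 := (residue_eq_zero_iff b).mpr hb
    simpa [ha', hb'] using h5

/-- If a has order i for the maximal ideal, it is a form of degree i in u, v, and some coefficient
is a unit because a is not in the next power. Dividing by v^i leaves a polynomial in u/v. -/
theorem exists_eq_pow_mul_aeval_primitive {R F : Type*} [CommRing R] [IsDomain R]
    [IsLocalRing R] [IsNoetherianRing R] [Field F] [Algebra R F] [FaithfulSMul R F]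
    {u v : R} (hm : maximalIdeal R = Ideal.span {u, v}) (hv0 : v ≠ 0) {a : R} (ha : a ≠ 0) :
    ∃ (i : ℕ) (P : R[X]), (∃ j, IsUnit (P.coeff j)) ∧
      algebraMap R F a = algebraMap R F v ^ i * aeval (algebraMap R F u / algebraMap R F v) P := by
  have hvF : algebraMap R F v ≠ 0 := by simpa using hv0
  have hinj := FaithfulSMul.algebraMap_injective R F
  have key : ∀ i, ∀ a ∈ maximalIdeal R ^ i, ∃ P : R[X], P.natDegree ≤ i ∧
      algebraMap R F a = algebraMap R F v ^ i * aeval (algebraMap R F u / algebraMap R F v) P := by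
    intro i
    induction i with
    | zero => exact fun a _ => ⟨C a, by simp, by simp⟩
    | succ i ih =>
      intro a ha
      rw [pow_succ] at ha
      refine Submodule.mul_induction_on ha ?_ ?_
      · intro m hmm n hn
        obtain ⟨P, hP, e⟩ := ih m hmm
        rw [hm, Ideal.mem_span_pair] at hn
        obtain ⟨r, s, rfl⟩ := hn
        refine ⟨P * (C r * X + C s), ?_, ?_⟩
        · exact natDegree_mul_le_of_le hP natDegree_linear_le
        · simp only [map_mul, map_add, e, aeval_C, aeval_X]
          field_simp
          ring
      · rintro x y ⟨P, hP, e⟩ ⟨Q, hQ, e'⟩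
        exact ⟨P + Q, natDegree_add_le_of_degree_le hP hQ, by rw [map_add, map_add, e, e', mul_add]⟩
  have h1 : ∃ s, a ∉ maximalIdeal R ^ s := by
    by_contra! h
    apply ha
    have : a ∈ (⨅ i : ℕ, maximalIdeal R ^ i) := by
      rw [Ideal.mem_iInf]
      exact h
    rwa [Ideal.iInf_pow_eq_bot_of_isLocalRing _ (maximalIdeal.isMaximal R).ne_top,
      Ideal.mem_bot] at this
  classical
  obtain ⟨s, hs⟩ : ∃ s, Nat.find h1 = s + 1 := by
    refine Nat.exists_eq_succ_of_ne_zero fun h => ?_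
    have := Nat.find_spec h1
    rw [h] at this
    simp at this
  have h2 := Nat.find_min h1 (m := s) (by omega)
  have h3 := Nat.find_spec h1
  rw [hs] at h3
  push Not at h2
  obtain ⟨P, hP, e⟩ := key s a h2
  refine ⟨s, P, ?_, e⟩
  by_contra! hunit
  apply h3
  rw [← exists_algebraMap_eq_pow_mul_aeval_div hvF s P hP] at e
  rw [hinj e]
  refine Ideal.sum_mem _ fun i hi => ?_
  rw [pow_succ']
  refine Ideal.mul_mem_mul (hunit i) ?_
  have h4 : s = i + (s - i) := by have := Finset.mem_range.mp hi; omega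
  have hu : u ∈ maximalIdeal R := hm ▸ Ideal.subset_span (by simp)
  have hv : v ∈ maximalIdeal R := hm ▸ Ideal.subset_span (by simp)
  rw [show maximalIdeal R ^ s = maximalIdeal R ^ i * maximalIdeal R ^ (s - i) by
    rw [← pow_add, ← h4]]
  exact Ideal.mul_mem_mul (Ideal.pow_mem_pow hu i) (Ideal.pow_mem_pow hv _)

/-- Abhyankar's factorization step: a factorial local ring which birationally dominates a regular
local ring of dimension two with parameters `u, v` and differs from it contains `u / v` or `v / u`. -/
theorem surjective_algebraMap_or_dvd_of_birational {R R' F : Type*} [CommRing R] [IsDomain R] [IsLocalRing R]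
    [IsNoetherianRing R] [CommRing R'] [IsDomain R'] [IsLocalRing R'] [UniqueFactorizationMonoid R']
    [Field F] [Algebra R R'] [Algebra R F] [Algebra R' F] [IsScalarTower R R' F]
    [IsFractionRing R F] [FaithfulSMul R' F] [IsLocalHom (algebraMap R R')] {u v : R}
    (hm : maximalIdeal R = Ideal.span {u, v}) (hu : Prime u) (hv0 : v ≠ 0) :
    Function.Surjective (algebraMap R R') ∨ algebraMap R R' u ∣ algebraMap R R' v ∨
      algebraMap R R' v ∣ algebraMap R R' u := by
  have hF := FaithfulSMul.algebraMap_injective R' F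
  have hRF := IsFractionRing.injective R F
  have hinj : Function.Injective (algebraMap R R') := by
    intro a b h
    apply hRF
    rw [IsScalarTower.algebraMap_apply R R' F, h, ← IsScalarTower.algebraMap_apply]
  have hvR' : algebraMap R R' v ≠ 0 := by
    rw [Ne, map_eq_zero_iff _ hinj]; exact hv0
  obtain ⟨u', v', g, hrel, hu', hv'⟩ := UniqueFactorizationMonoid.exists_reduced_factors'
    (algebraMap R R' u) (algebraMap R R' v) hvR'
  by_cases hu1 : IsUnit u'
  · refine Or.inr (Or.inl ?_)
    rw [← hu', ← hv']
    exact mul_dvd_mul_left _ hu1.dvd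
  by_cases hv1 : IsUnit v'
  · refine Or.inr (Or.inr ?_)
    rw [← hu', ← hv']
    exact mul_dvd_mul_left _ hv1.dvd
  refine Or.inl ?_
  have hv'0 : v' ≠ 0 := by rintro rfl; simp [← hv'] at hvR'
  have hg0 : g ≠ 0 := by rintro rfl; simp [← hv'] at hvR'
  have hvF : algebraMap R F v ≠ 0 := by
    rw [Ne, map_eq_zero_iff _ hRF]; exact hv0
  have htt : algebraMap R F u / algebraMap R F v = algebraMap R' F u' / algebraMap R' F v' := by
    have h1 : algebraMap R' F g ≠ 0 := by rw [Ne, map_eq_zero_iff _ hF]; exact hg0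
    have h2 : algebraMap R' F v' ≠ 0 := by rw [Ne, map_eq_zero_iff _ hF]; exact hv'0
    rw [IsScalarTower.algebraMap_apply R R' F, IsScalarTower.algebraMap_apply R R' F, ← hu', ← hv',
      map_mul, map_mul]
    field_simp
  set t := algebraMap R F u / algebraMap R F v with ht
  -- With neither u' nor v' a unit, t = u/v is a quotient of coprime nonunits, so its residue is
  -- transcendental.
  have hK : ∀ P : R'[X], aeval t P = 0 → P.map (residue R') = 0 := fun P hP =>
    map_residue_eq_zero_of_aeval_div_eq_zero hv'0 hrel hu1 hv1 P (htt ▸ hP)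
  have hprim : ∀ P : R[X], (∃ j, IsUnit (P.coeff j)) →
      (P.map (algebraMap R R')).map (residue R') ≠ 0 := by
    rintro P ⟨j, hj⟩ h
    have := congrArg (fun Q => coeff Q j) h
    simp only [coeff_map, coeff_zero] at this
    rw [residue_eq_zero_iff] at this
    exact this (hj.map _)
  have hrep : ∀ a : R', a ≠ 0 → ∃ (i j : ℕ) (P Q : R[X]), (∃ j, IsUnit (P.coeff j)) ∧
      (∃ j, IsUnit (Q.coeff j)) ∧ algebraMap R' F a * (algebraMap R F v ^ j * aeval t Q) =
        algebraMap R F v ^ i * aeval t P := by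
    intro a ha
    obtain ⟨n, d, hd, e⟩ := IsFractionRing.div_surjective (A := R) (algebraMap R' F a)
    have hd0 : d ≠ 0 := nonZeroDivisors.ne_zero hd
    have hdF : algebraMap R F d ≠ 0 := by rw [Ne, map_eq_zero_iff _ hRF]; exact hd0
    have hn0 : n ≠ 0 := by
      rintro rfl
      rw [map_zero, zero_div] at e
      exact ha ((map_eq_zero_iff _ hF).mp e.symm)
    obtain ⟨i, P, hP, e1⟩ := exists_eq_pow_mul_aeval_primitive (F := F) hm hv0 hn0
    obtain ⟨j, Q, hQ, e2⟩ := exists_eq_pow_mul_aeval_primitive (F := F) hm hv0 hd0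
    refine ⟨i, j, P, Q, hP, hQ, ?_⟩
    rw [← e1, ← e2, ← e]
    field_simp
  have hlift : ∀ P : R[X], aeval t (P.map (algebraMap R R')) = aeval t P := fun P => by
    rw [aeval_map_algebraMap]
  -- Nonunits of R' carry a positive power of v: otherwise reducing modulo the maximal ideal would
  -- kill the side containing a but not the primitive P.
  have hpos : ∀ a : R', a ≠ 0 → a ∈ maximalIdeal R' → ∃ (e : ℕ) (P Q : R[X]),
      (∃ j, IsUnit (P.coeff j)) ∧ (∃ j, IsUnit (Q.coeff j)) ∧ algebraMap R' F a * aeval t Q =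
        algebraMap R F v ^ (e + 1) * aeval t P := by
    intro a ha0 ha
    obtain ⟨i, j, P, Q, hP, hQ, e⟩ := hrep a ha0
    by_cases hij : i ≤ j
    · exfalso
      obtain ⟨d, rfl⟩ := Nat.exists_eq_add_of_le hij
      have h1 : aeval t (C (a * algebraMap R R' v ^ d) * Q.map (algebraMap R R') -
          P.map (algebraMap R R')) = 0 := by
        rw [map_sub, map_mul, aeval_C, hlift, hlift, map_mul, map_pow,
          ← IsScalarTower.algebraMap_apply]
        have h2 := pow_ne_zero i hvF
        apply mul_left_cancel₀ h2
        rw [mul_zero, mul_sub, ← e, pow_add]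
        ring
      have h2 := hK _ h1
      apply hprim P hP
      have h3 : residue R' a = 0 := (residue_eq_zero_iff a).mpr ha
      simpa [h3] using h2
    · obtain ⟨d, rfl⟩ := Nat.exists_eq_add_of_lt (not_le.mp hij)
      refine ⟨d, P, Q, hP, hQ, ?_⟩
      apply mul_left_cancel₀ (pow_ne_zero j hvF)
      linear_combination e
  -- If g were a nonunit, v = g v' would carry at least two powers of v, one from each factor.
  have hg1 : IsUnit g := by
    by_contra hg
    obtain ⟨e, A, B, hA, hB, e1⟩ := hpos v' hv'0 hv1
    obtain ⟨f, P, Q, hP, hQ, e2⟩ := hpos g hg0 hg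
    have e3 : algebraMap R F v = algebraMap R' F g * algebraMap R' F v' := by
      rw [IsScalarTower.algebraMap_apply R R' F, ← hv', map_mul]
    have h1 : aeval t (B.map (algebraMap R R') * Q.map (algebraMap R R') -
        C (algebraMap R R' v ^ (e + f + 1)) *
          (A.map (algebraMap R R') * P.map (algebraMap R R'))) = 0 := by
      rw [map_sub, map_mul, map_mul, map_mul, aeval_C, hlift, hlift, hlift, hlift, map_pow,
        ← IsScalarTower.algebraMap_apply]
      apply mul_left_cancel₀ hvF
      rw [mul_zero, mul_sub]
      nth_rewrite 1 [e3]
      have : algebraMap R' F g * algebraMap R' F v' * ((aeval t) B * (aeval t) Q) =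
        (algebraMap R' F v' * aeval t B) * (algebraMap R' F g * aeval t Q) := by ring
      rw [this, e1, e2]
      ring
    have h2 := hK _ h1
    have hv2 : residue R' (algebraMap R R' v) = 0 := by
      rw [residue_eq_zero_iff, ← hv']
      exact Ideal.mul_mem_left _ _ hv1
    rw [Polynomial.map_sub, Polynomial.map_mul, Polynomial.map_mul, map_C, map_pow, hv2,
      zero_pow (by omega), map_zero, zero_mul, sub_zero, mul_eq_zero] at h2
    rcases h2 with h2 | h2
    · exact hprim B hB h2
    · exact hprim Q hQ h2
  have hrel' : IsRelPrime (algebraMap R R' u) (algebraMap R R' v) := by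
    rw [← hu', ← hv']
    exact (isRelPrime_mul_unit_left hg1).mpr hrel
  have := uniqueFactorizationMonoid_of_maximalIdeal_eq_span_pair hm hu
  intro f
  obtain ⟨n, d, hd, e⟩ := IsFractionRing.div_surjective (A := R) (algebraMap R' F f)
  have hd0 : d ≠ 0 := nonZeroDivisors.ne_zero hd
  obtain ⟨n', d', c, hnd, hn', hd'⟩ := UniqueFactorizationMonoid.exists_reduced_factors' n d hd0
  have hc0 : c ≠ 0 := by rintro rfl; simp at hd'; exact hd0 hd'.symm
  have hd'0 : d' ≠ 0 := by rintro rfl; simp at hd'; exact hd0 hd'.symm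
  have hd'F : algebraMap R F d' ≠ 0 := by rw [Ne, map_eq_zero_iff _ hRF]; exact hd'0
  have e1 : algebraMap R R' n' = f * algebraMap R R' d' := by
    apply hF
    rw [map_mul, ← e, ← hn', ← hd', ← IsScalarTower.algebraMap_apply,
      ← IsScalarTower.algebraMap_apply, map_mul, map_mul]
    have hcF : algebraMap R F c ≠ 0 := by rw [Ne, map_eq_zero_iff _ hRF]; exact hc0
    field_simp
  -- In R' the denominator d' divides n', hence divides a power of u and a power of v. These are
  -- coprime in R' now that g is a unit.
  have hd'u : IsUnit d' := by
    obtain ⟨s, hs⟩ := exists_maximalIdeal_pow_le_span_pair_of_isRelPrime hm hu hnd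
    have h1 : ∀ x ∈ maximalIdeal R, algebraMap R R' d' ∣ algebraMap R R' x ^ s := by
      intro x hx
      obtain ⟨r, q, h⟩ := Ideal.mem_span_pair.mp (hs (Ideal.pow_mem_pow hx s))
      rw [← map_pow, ← h, map_add, map_mul, map_mul, e1]
      exact dvd_add (Dvd.dvd.mul_left (dvd_mul_left _ _) _) (dvd_mul_left _ _)
    have hur : IsUnit (algebraMap R R' d') :=
      (hrel'.pow_left (m := s) |>.pow_right (n := s))
        (h1 u (hm ▸ Ideal.subset_span (by simp))) (h1 v (hm ▸ Ideal.subset_span (by simp)))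
    exact (isUnit_map_iff _ _).mp hur
  obtain ⟨w, rfl⟩ := hd'u
  refine ⟨n' * ↑w⁻¹, ?_⟩
  rw [map_mul, e1, mul_assoc, ← map_mul, Units.mul_inv, map_one, mul_one]

end LocalAlgebra

end

section

/-! ### Krull dimension is at most transcendence degree. -/

section TranscendenceDegree

/-- A relation for z over the subalgebra generated by x can be divided by powers of z until its
constant coefficient is nonzero. Applying f, which kills z, turns that coefficient into a relation
among the images of x. -/
theorem AlgebraicIndependent.option_of_map_eq_zero {ι κ A B : Type*} [Field κ] [CommRing A] [IsDomain A]
    [CommRing B] [Algebra κ A] [Algebra κ B] (f : A →ₐ[κ] B) {x : ι → A}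
    (hx : AlgebraicIndependent κ (f ∘ x)) {z : A} (hz : z ≠ 0) (hfz : f z = 0) :
    AlgebraicIndependent κ (fun o : Option ι => o.elim z x) := by
  have hx' := AlgebraicIndependent.of_comp f hx
  rw [hx'.option_iff_transcendental]
  intro halg
  obtain ⟨q, hq0, hq⟩ := halg.exists_nonzero_coeff_and_aeval_eq_zero (mem_nonZeroDivisors_of_ne_zero hz)
  apply hq0
  have h1 : f (q.coeff 0 : Algebra.adjoin κ (Set.range x)) = 0 := by
    rw [← Polynomial.divX_mul_X_add q] at hq
    simp only [map_add, map_mul, Polynomial.aeval_X, Polynomial.aeval_C] at hq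
    have := congrArg f hq
    rw [map_add, map_mul, hfz, mul_zero, zero_add, map_zero] at this
    exact this
  obtain ⟨P, hP⟩ : ∃ P : MvPolynomial ι κ, MvPolynomial.aeval x P = (q.coeff 0 : A) := by
    have := (Algebra.adjoin_range_eq_range_aeval κ x).le (q.coeff 0).2
    exact this
  rw [← hP] at h1
  have h2 : P = 0 := hx (by rw [map_zero, ← h1, MvPolynomial.comp_aeval_apply]; rfl)
  ext
  rw [← hP, h2, map_zero]
  rfl

theorem exists_algebraicIndependent_of_ideal_chain {κ D : Type*} [Field κ] [CommRing D] [Algebra κ D] (n : ℕ)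
    (p : ℕ → Ideal D) (hp : ∀ i ≤ n, (p i).IsPrime) (hlt : ∀ i < n, p i < p (i + 1)) :
    ∃ x : Fin n → D, AlgebraicIndependent κ (fun i => Ideal.Quotient.mk (p 0) (x i)) := by
  induction n generalizing p with
  | zero =>
    have := hp 0 le_rfl
    have : Nontrivial (D ⧸ p 0) := Ideal.Quotient.nontrivial_iff.mpr this.ne_top
    exact ⟨Fin.elim0, algebraicIndependent_empty_type⟩
  | succ n ih =>
    obtain ⟨x, hx⟩ := ih (fun i => p (i + 1)) (fun i hi => hp _ (by omega)) (fun i hi => hlt _ (by omega))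
    have h0 := hp 0 (by omega)
    obtain ⟨hle, hne⟩ := Set.ssubset_iff_of_subset (hlt 0 (by omega)).le |>.mp (hlt 0 (by omega))
    have := AlgebraicIndependent.option_of_map_eq_zero
      (Ideal.Quotient.factorₐ κ (hlt 0 (by omega)).le) (x := fun i => Ideal.Quotient.mk (p 0) (x i))
      hx (z := Ideal.Quotient.mk (p 0) hle)
      (by rw [Ne, Ideal.Quotient.eq_zero_iff_mem]; exact hne.2)
      (Ideal.Quotient.eq_zero_iff_mem.mpr hne.1)
    refine ⟨fun i => (finSuccEquiv n i).elim hle x, ?_⟩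
    rw [← algebraicIndependent_equiv (finSuccEquiv n)] at this
    convert this using 1
    rotate_left
    · rfl
    ext i
    dsimp only [Function.comp]
    cases finSuccEquiv n i <;> rfl

theorem natCast_le_trdeg_of_le_ringKrullDim {κ D : Type*} [Field κ] [CommRing D] [IsDomain D] [Algebra κ D]
    {n : ℕ} (h : n ≤ ringKrullDim D) : (n : Cardinal) ≤ Algebra.trdeg κ D := by
  rw [ringKrullDim, Order.le_krullDim_iff] at h
  obtain ⟨l, rfl⟩ := h
  obtain ⟨x, hx⟩ := exists_algebraicIndependent_of_ideal_chain (κ := κ) l.length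
    (fun i => if h : i < l.length + 1 then (l ⟨i, h⟩).asIdeal else ⊤)
    (fun i hi => by rw [dif_pos (by omega)]; exact (l _).isPrime)
    (fun i hi => by
      rw [dif_pos (by omega), dif_pos (by omega)]
      exact l.strictMono (Fin.mk_lt_mk.mpr (Nat.lt_succ_self i)))
  have h2 : AlgebraicIndependent κ x := AlgebraicIndependent.of_comp
    (Ideal.Quotient.mkₐ κ _) hx
  have := h2.lift_cardinalMk_le_trdeg
  simpa using this

end TranscendenceDegree

/-! ### The local ring at the origin of the coordinate plane, inside a field. -/

section Coordinates

variable {κ F : Type*} [Field κ] [Field F] [Algebra κ F]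

open MvPolynomial

/-- The value of a polynomial in two variables at `(x, y)`. -/
noncomputable abbrev evalPair (κ : Type*) {F : Type*} [Field κ] [Field F] [Algebra κ F] (x y : F) :
    MvPolynomial (Fin 2) κ →ₐ[κ] F := aeval ![x, y]

theorem evalPair_X_zero (x y : F) : evalPair κ x y (X 0) = x := by simp
theorem evalPair_X_one (x y : F) : evalPair κ x y (X 1) = y := by simp

/-- The ring `κ[x, y]` localized at the origin, inside the field `F`. -/
def locRing (κ : Type*) {F : Type*} [Field κ] [Field F] [Algebra κ F] (x y : F) : Subring F where
  -- The value of Q has to be required nonzero separately, as x and y may be algebraically dependent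
  -- here.
  carrier := {f | ∃ P Q : MvPolynomial (Fin 2) κ, constantCoeff Q ≠ 0 ∧ evalPair κ x y Q ≠ 0 ∧
    f = evalPair κ x y P / evalPair κ x y Q}
  mul_mem' := by
    rintro _ _ ⟨P, Q, h1, h2, rfl⟩ ⟨P', Q', h1', h2', rfl⟩
    exact ⟨P * P', Q * Q', by simp [h1, h1'], by rw [map_mul]; exact mul_ne_zero h2 h2',
      by rw [map_mul, map_mul]; field_simp⟩
  add_mem' := by
    rintro _ _ ⟨P, Q, h1, h2, rfl⟩ ⟨P', Q', h1', h2', rfl⟩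
    exact ⟨P * Q' + Q * P', Q * Q', by simp [h1, h1'], by rw [map_mul]; exact mul_ne_zero h2 h2',
      by rw [map_add, map_mul, map_mul, map_mul]; field_simp⟩
  one_mem' := ⟨1, 1, by simp, by simp, by simp⟩
  zero_mem' := ⟨0, 1, by simp, by simp, by simp⟩
  neg_mem' := by
    rintro _ ⟨P, Q, h1, h2, rfl⟩
    exact ⟨-P, Q, h1, h2, by rw [map_neg, neg_div]⟩

theorem evalPair_mem_locRing (x y : F) (P : MvPolynomial (Fin 2) κ) : evalPair κ x y P ∈ locRing κ x y :=
  ⟨P, 1, by simp, by simp, by simp⟩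

theorem left_mem_locRing (x y : F) : x ∈ locRing κ x y := by
  simpa using evalPair_mem_locRing (κ := κ) x y (X 0)

theorem right_mem_locRing (x y : F) : y ∈ locRing κ x y := by
  simpa using evalPair_mem_locRing (κ := κ) x y (X 1)

theorem algebraMap_mem_locRing (x y : F) (c : κ) : algebraMap κ F c ∈ locRing κ x y := by
  simpa using evalPair_mem_locRing (κ := κ) x y (C c)

theorem MvPolynomial.exists_eq_C_add_X_mul_add_X_mul (P : MvPolynomial (Fin 2) κ) :
    ∃ P0 P1, P = C (constantCoeff P) + X 0 * P0 + X 1 * P1 := by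
  induction P using MvPolynomial.induction_on with
  | C a => exact ⟨0, 0, by simp⟩
  | add p q hp hq =>
    obtain ⟨p0, p1, hp⟩ := hp
    obtain ⟨q0, q1, hq⟩ := hq
    exact ⟨p0 + q0, p1 + q1, by rw [map_add, map_add]; linear_combination hp + hq⟩
  | mul_X p i hp =>
    fin_cases i
    · exact ⟨p, 0, by simp [mul_comm]⟩
    · exact ⟨0, p, by simp [mul_comm]⟩

/-- Elements of `κ[x, y]` localized at the origin which are invertible there. -/
def IsUnitAt (κ : Type*) {F : Type*} [Field κ] [Field F] [Algebra κ F] (x y f : F) : Prop :=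
  ∃ P Q : MvPolynomial (Fin 2) κ, constantCoeff P ≠ 0 ∧ constantCoeff Q ≠ 0 ∧
    evalPair κ x y P ≠ 0 ∧ evalPair κ x y Q ≠ 0 ∧ f = evalPair κ x y P / evalPair κ x y Q

namespace IsUnitAt

variable {x y f g : F}

theorem mem (h : IsUnitAt κ x y f) : f ∈ locRing κ x y := by
  obtain ⟨P, Q, -, h1, -, h2, rfl⟩ := h
  exact ⟨P, Q, h1, h2, rfl⟩

theorem ne_zero (h : IsUnitAt κ x y f) : f ≠ 0 := by
  obtain ⟨P, Q, -, -, h1, h2, rfl⟩ := h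
  exact div_ne_zero h1 h2

theorem inv (h : IsUnitAt κ x y f) : IsUnitAt κ x y f⁻¹ := by
  obtain ⟨P, Q, h1, h2, h3, h4, rfl⟩ := h
  exact ⟨Q, P, h2, h1, h4, h3, by rw [inv_div]⟩

theorem mul (hf : IsUnitAt κ x y f) (hg : IsUnitAt κ x y g) : IsUnitAt κ x y (f * g) := by
  obtain ⟨P, Q, h1, h2, h3, h4, rfl⟩ := hf
  obtain ⟨P', Q', h1', h2', h3', h4', rfl⟩ := hg
  exact ⟨P * P', Q * Q', by simp [h1, h1'], by simp [h2, h2'], by rw [map_mul]; exact mul_ne_zero h3 h3',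
    by rw [map_mul]; exact mul_ne_zero h4 h4', by rw [map_mul, map_mul]; field_simp⟩

theorem of_algebraMap {c : κ} (hc : c ≠ 0) : IsUnitAt κ x y (algebraMap κ F c) :=
  ⟨C c, 1, by simpa, by simp, by simpa, by simp, by simp⟩

theorem one : IsUnitAt κ x y (1 : F) := by simpa using of_algebraMap (F := F) (x := x) (y := y) (one_ne_zero (α := κ))

theorem pow (hf : IsUnitAt κ x y f) (n : ℕ) : IsUnitAt κ x y (f ^ n) := by
  induction n with
  | zero => simpa using one
  | succ n ih => rw [pow_succ]; exact ih.mul hf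

theorem zpow (hf : IsUnitAt κ x y f) (n : ℤ) : IsUnitAt κ x y (f ^ n) := by
  cases n with
  | ofNat n => simpa using hf.pow n
  | negSucc n => rw [zpow_negSucc]; exact (hf.pow _).inv

end IsUnitAt

theorem exists_eq_add_mul_add_mul_of_mem_locRing {x y f : F} (hf : f ∈ locRing κ x y) :
    ∃ c : κ, ∃ r ∈ locRing κ x y, ∃ s ∈ locRing κ x y, f = algebraMap κ F c + x * r + y * s := by
  obtain ⟨P, Q, h1, h2, rfl⟩ := hf
  let c := constantCoeff P / constantCoeff Q
  obtain ⟨P0, P1, hP⟩ := MvPolynomial.exists_eq_C_add_X_mul_add_X_mul (P - C c * Q)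
  have h3 : constantCoeff (P - C c * Q) = 0 := by simp [c, h1]
  rw [h3, map_zero, zero_add] at hP
  refine ⟨c, _, ⟨P0, Q, h1, h2, rfl⟩, _, ⟨P1, Q, h1, h2, rfl⟩, ?_⟩
  have h4 := congrArg (evalPair κ x y) hP
  rw [map_sub, map_add, map_mul, map_mul, map_mul, evalPair_X_zero, evalPair_X_one, algHom_C] at h4
  field_simp
  linear_combination h4

theorem isUnitAt_of_eq {x y f : F} (hxy : AlgebraicIndependent κ ![x, y]) {c : κ} (hc : c ≠ 0) {r s : F}
    (hr : r ∈ locRing κ x y) (hs : s ∈ locRing κ x y) (hf : f = algebraMap κ F c + x * r + y * s) :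
    IsUnitAt κ x y f := by
  obtain ⟨R, Q, h1, h2, rfl⟩ := hr
  obtain ⟨S, Q', h1', h2', rfl⟩ := hs
  let P := C c * (Q * Q') + X 0 * (R * Q') + X 1 * (S * Q)
  have hP : constantCoeff P ≠ 0 := by simp [P, hc, h1, h1']
  have hP0 : P ≠ 0 := by rintro h; simp [h] at hP
  have hPe : evalPair κ x y P ≠ 0 := fun h => hP0 (hxy (by rw [map_zero]; exact h))
  refine ⟨P, Q * Q', hP, by simp [h1, h1'], hPe,
    by rw [map_mul]; exact mul_ne_zero h2 h2', ?_⟩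
  simp only [P, map_add, map_mul, evalPair_X_zero, evalPair_X_one, algHom_C, hf]
  field_simp

theorem IsUnitAt.ne_zero_of_eq {x y f : F} (hxy : AlgebraicIndependent κ ![x, y]) (h : IsUnitAt κ x y f)
    {c : κ} {r s : F} (hr : r ∈ locRing κ x y) (hs : s ∈ locRing κ x y)
    (hf : f = algebraMap κ F c + x * r + y * s) : c ≠ 0 := by
  rintro rfl
  obtain ⟨P, Q, h1, h2, h3, h4, rfl⟩ := h
  obtain ⟨R, Q', h1', h2', rfl⟩ := hr
  obtain ⟨S, Q'', h1'', h2'', rfl⟩ := hs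
  have : evalPair κ x y (P * Q' * Q'') = evalPair κ x y (Q * (X 0 * (R * Q'') + X 1 * (S * Q'))) := by
    rw [map_zero, zero_add] at hf
    simp only [map_add, map_mul, evalPair_X_zero, evalPair_X_one]
    field_simp at hf
    linear_combination hf
  have := congrArg constantCoeff (hxy this)
  simp [h1, h1', h1''] at this

theorem IsUnitAt.exists_eq {x y f : F} (hxy : AlgebraicIndependent κ ![x, y]) (h : IsUnitAt κ x y f) :
    ∃ c : κ, c ≠ 0 ∧ ∃ r ∈ locRing κ x y, ∃ s ∈ locRing κ x y,
      f = algebraMap κ F c + x * r + y * s := by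
  obtain ⟨c, r, hr, s, hs, e⟩ := exists_eq_add_mul_add_mul_of_mem_locRing h.mem
  exact ⟨c, h.ne_zero_of_eq hxy hr hs e, r, hr, s, hs, e⟩

theorem locRing_le {x y : F} {S : Subring F} (hκ : ∀ c, algebraMap κ F c ∈ S) (hx : x ∈ S) (hy : y ∈ S)
    (hinv : ∀ c : κ, c ≠ 0 → ∀ r ∈ S, ∀ s ∈ S, (algebraMap κ F c + x * r + y * s)⁻¹ ∈ S) :
    locRing κ x y ≤ S := by
  have h : ∀ P : MvPolynomial (Fin 2) κ, evalPair κ x y P ∈ S := by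
    intro P
    induction P using MvPolynomial.induction_on with
    | C a => rw [algHom_C]; exact hκ a
    | add p q hp hq => rw [map_add]; exact S.add_mem hp hq
    | mul_X p i hp =>
      rw [map_mul]
      refine S.mul_mem hp ?_
      fin_cases i <;> simpa
  rintro _ ⟨P, Q, h1, h2, rfl⟩
  rw [div_eq_mul_inv]
  refine S.mul_mem (h P) ?_
  obtain ⟨P0, P1, hP⟩ := MvPolynomial.exists_eq_C_add_X_mul_add_X_mul Q
  rw [hP]
  simp only [map_add, map_mul, evalPair_X_zero, evalPair_X_one, algHom_C]
  exact hinv _ h1 _ (h _) _ (h _)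

theorem locRing_le_locRing {x y x' y' : F} (hxy : AlgebraicIndependent κ ![x', y'])
    {a b a' b' : F} (ha : a ∈ locRing κ x' y') (hb : b ∈ locRing κ x' y') (ha' : a' ∈ locRing κ x' y')
    (hb' : b' ∈ locRing κ x' y') (hx : x = x' * a + y' * b) (hy : y = x' * a' + y' * b') :
    locRing κ x y ≤ locRing κ x' y' := by
  have hX := left_mem_locRing (κ := κ) x' y'
  have hY := right_mem_locRing (κ := κ) x' y'
  refine locRing_le (algebraMap_mem_locRing _ _) ?_ ?_ fun c hc r hr s hs => ?_
  · rw [hx]; exact add_mem (mul_mem hX ha) (mul_mem hY hb)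
  · rw [hy]; exact add_mem (mul_mem hX ha') (mul_mem hY hb')
  · refine (isUnitAt_of_eq hxy hc (r := a * r + a' * s) (s := b * r + b' * s)
      (add_mem (mul_mem ha hr) (mul_mem ha' hs)) (add_mem (mul_mem hb hr) (mul_mem hb' hs)) ?_).inv.mem
    rw [hx, hy]; ring

end Coordinates

end

/-! ### Regular parameters in dimension two. -/

section

open IsLocalRing

/-- `x` and `y` are parameters of a two-dimensional regular local ring. -/
structure IsParamPair {R : Type*} [CommRing R] [IsLocalRing R] (x y : R) : Prop where
  maximalIdeal_eq : maximalIdeal R = Ideal.span {x, y}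
  prime_left : Prime x
  prime_right : Prime y
  not_dvd : ¬ x ∣ y

theorem Prime.dvd_of_not_unit_dvd {R : Type*} [CommRing R] [IsDomain R] {x y : R} (hx : Prime x)
    (hy : ¬ IsUnit y) (h : y ∣ x) : x ∣ y := by
  obtain ⟨q, rfl⟩ := h
  exact (hx.irreducible.isUnit_or_isUnit rfl).resolve_left hy |>.mul_right_dvd.mpr dvd_rfl

namespace IsParamPair

variable {R : Type*} [CommRing R] [IsLocalRing R] {x y : R}

theorem not_dvd' [IsDomain R] (h : IsParamPair x y) : ¬ y ∣ x := fun hd =>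
  h.not_dvd (h.prime_left.dvd_of_not_unit_dvd h.prime_right.not_isUnit hd)

theorem symm [IsDomain R] (h : IsParamPair x y) : IsParamPair y x :=
  ⟨by rw [h.maximalIdeal_eq, Set.pair_comm], h.prime_right, h.prime_left, h.not_dvd'⟩

theorem of_ringKrullDim [IsDomain R] [IsNoetherianRing R] (hm : maximalIdeal R = Ideal.span {x, y})
    (hd : ringKrullDim R = 2) : IsParamPair x y := by
  have hx := prime_of_ringKrullDim_eq_two hm hd
  have hm' : maximalIdeal R = Ideal.span {y, x} := by rw [hm, Set.pair_comm]
  refine ⟨hm, hx, prime_of_ringKrullDim_eq_two hm' hd, fun hxy => ?_⟩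
  have h1 : maximalIdeal R = Ideal.span {x} := by
    rw [hm]
    apply le_antisymm
    · rw [Ideal.span_le]
      rintro _ (rfl | rfl)
      · exact Ideal.mem_span_singleton_self _
      · exact Ideal.mem_span_singleton.mpr hxy
    · exact Ideal.span_mono (by simp)
  have h2 := (ringKrullDim_le_spanFinrank_maximalIdeal (R := R))
  rw [hd, h1] at h2
  have h3 : (Ideal.span {x}).spanFinrank ≤ 1 :=
    (Submodule.spanFinrank_span_le_ncard_of_finite (Set.finite_singleton x)).trans (by simp)
  have h4 : (2 : WithBot ℕ∞) ≤ ((1 : ℕ) : WithBot ℕ∞) := h2.trans (by exact_mod_cast h3)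
  exact absurd h4 (by decide)

theorem ringKrullDim_eq [IsDomain R] [IsNoetherianRing R] (h : IsParamPair x y) : ringKrullDim R = 2 :=
  ringKrullDim_eq_two_of_prime h.maximalIdeal_eq h.prime_left h.not_dvd

theorem of_span_eq [IsDomain R] [IsNoetherianRing R] (h : IsParamPair x y) {x' y' : R}
    (hm : maximalIdeal R = Ideal.span {x', y'}) : IsParamPair x' y' :=
  of_ringKrullDim hm h.ringKrullDim_eq

end IsParamPair

/-! ### Regularity of the local ring at the origin. -/

section LocRing

variable {κ F : Type*} [Field κ] [Field F] [Algebra κ F] {x y : F}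

open MvPolynomial

theorem locRing_isUnit_iff (f : locRing κ x y) :
    IsUnit f ↔ (f : F) ≠ 0 ∧ (f : F)⁻¹ ∈ locRing κ x y := by
  constructor
  · rintro ⟨w, rfl⟩
    have h : ((w : locRing κ x y) : F) * ((w⁻¹ : (locRing κ x y)ˣ) : locRing κ x y) = 1 := by
      rw [← Subring.coe_mul]; simp
    refine ⟨left_ne_zero_of_mul_eq_one h, ?_⟩
    rw [← eq_inv_of_mul_eq_one_right h]
    exact Subtype.property _
  · rintro ⟨h0, h⟩
    exact IsUnit.of_mul_eq_one ⟨_, h⟩ (Subtype.ext (mul_inv_cancel₀ h0))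

theorem isUnitAt_iff (hxy : AlgebraicIndependent κ ![x, y]) (f : F) :
    IsUnitAt κ x y f ↔ f ≠ 0 ∧ f ∈ locRing κ x y ∧ f⁻¹ ∈ locRing κ x y := by
  constructor
  · exact fun h => ⟨h.ne_zero, h.mem, h.inv.mem⟩
  · rintro ⟨h0, h1, h2⟩
    obtain ⟨P, Q, hQ, hQ', e⟩ := h1
    obtain ⟨P', S, hS, hS', e'⟩ := h2
    have h3 : evalPair κ x y P ≠ 0 := by rintro h; simp [h] at e; exact h0 e
    refine ⟨P, Q, ?_, hQ, h3, hQ', e⟩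
    have : evalPair κ x y (Q * S) = evalPair κ x y (P * P') := by
      rw [e] at e'
      rw [map_mul, map_mul]
      field_simp at e'
      linear_combination e'
    have := congrArg constantCoeff (hxy this)
    rw [map_mul, map_mul] at this
    exact left_ne_zero_of_mul (this ▸ mul_ne_zero hQ hS)

theorem locRing_isUnit_iff_isUnitAt (hxy : AlgebraicIndependent κ ![x, y]) (f : locRing κ x y) :
    IsUnit f ↔ IsUnitAt κ x y (f : F) := by
  rw [locRing_isUnit_iff, isUnitAt_iff hxy]
  simp

/-- The coordinates as elements of the local ring. -/
def locRing.left (κ : Type*) {F : Type*} [Field κ] [Field F] [Algebra κ F] (x y : F) : locRing κ x y :=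
  ⟨x, left_mem_locRing x y⟩

/-- The coordinates as elements of the local ring. -/
def locRing.right (κ : Type*) {F : Type*} [Field κ] [Field F] [Algebra κ F] (x y : F) : locRing κ x y :=
  ⟨y, right_mem_locRing x y⟩

theorem not_isUnit_iff_mem_span (hxy : AlgebraicIndependent κ ![x, y]) (f : locRing κ x y) :
    ¬ IsUnit f ↔ f ∈ Ideal.span {locRing.left κ x y, locRing.right κ x y} := by
  rw [locRing_isUnit_iff_isUnitAt hxy, Ideal.mem_span_pair]
  constructor
  · intro h
    obtain ⟨c, r, hr, s, hs, e⟩ := exists_eq_add_mul_add_mul_of_mem_locRing f.2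
    have hc : c = 0 := by
      by_contra hc
      exact h (isUnitAt_of_eq hxy hc hr hs e)
    refine ⟨⟨r, hr⟩, ⟨s, hs⟩, Subtype.ext ?_⟩
    rw [e, hc, map_zero]
    simp only [locRing.left, locRing.right, Subring.coe_add, Subring.coe_mul]
    ring
  · rintro ⟨r, s, rfl⟩ h
    refine h.ne_zero_of_eq hxy (c := 0) r.2 s.2 ?_ rfl
    rw [map_zero]
    simp only [locRing.left, locRing.right, Subring.coe_add, Subring.coe_mul]
    ring

theorem isLocalRing_locRing (hxy : AlgebraicIndependent κ ![x, y]) : IsLocalRing (locRing κ x y) := by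
  refine IsLocalRing.of_nonunits_add fun a b ha hb => ?_
  rw [mem_nonunits_iff, not_isUnit_iff_mem_span hxy] at *
  exact Ideal.add_mem _ ha hb

theorem isNoetherianRing_locRing (hxy : AlgebraicIndependent κ ![x, y]) :
    IsNoetherianRing (locRing κ x y) := by
  let f : MvPolynomial (Fin 2) κ →+* locRing κ x y :=
    (evalPair κ x y).toRingHom.codRestrict (locRing κ x y) (evalPair_mem_locRing x y)
  let := f.toAlgebra
  let M : Submonoid (MvPolynomial (Fin 2) κ) :=
    (nonZeroDivisors κ).comap (constantCoeff (σ := Fin 2) (R := κ))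
  have hM : ∀ P, P ∈ M ↔ constantCoeff P ≠ 0 := fun P => by
    rw [Submonoid.mem_comap, mem_nonZeroDivisors_iff_ne_zero]
  have hne : ∀ P, constantCoeff P ≠ 0 → evalPair κ x y P ≠ 0 := fun P hP h => by
    have : P = 0 := hxy (by rw [map_zero]; exact h)
    simp [this] at hP
  have : IsLocalization M (locRing κ x y) := by
    rw [isLocalization_iff]
    refine ⟨?_, ?_, ?_⟩
    · rintro ⟨P, hP⟩
      rw [hM] at hP
      rw [locRing_isUnit_iff]
      exact ⟨hne P hP, 1, P, hP, hne P hP, by rw [map_one, one_div]; rfl⟩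
    · rintro ⟨_, P, Q, h1, h2, rfl⟩
      refine ⟨⟨P, Q, (hM Q).mpr h1⟩, Subtype.ext ?_⟩
      exact div_mul_cancel₀ _ h2
    · intro P Q h
      refine ⟨1, ?_⟩
      rw [hxy (congrArg Subtype.val h)]
  exact IsLocalization.isNoetherianRing M _ inferInstance

theorem prime_of_evalPair_X (hxy : AlgebraicIndependent κ ![x, y]) (i : Fin 2) (z : locRing κ x y)
    (hz : (z : F) = evalPair κ x y (X i)) : Prime z := by
  have hz0 : (z : F) ≠ 0 := by
    rw [hz]; intro h
    exact X_ne_zero i (hxy (by rw [map_zero]; exact h))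
  have hcc : ∀ Q : MvPolynomial (Fin 2) κ, constantCoeff Q ≠ 0 → ¬ X i ∣ Q := by
    rintro _ hQ ⟨q, rfl⟩
    simp at hQ
  refine ⟨fun h => hz0 (by rw [h]; rfl), ?_, ?_⟩
  · rw [not_isUnit_iff_mem_span hxy, Ideal.mem_span_pair]
    fin_cases i
    · exact ⟨1, 0, Subtype.ext (by simp [hz, locRing.left])⟩
    · exact ⟨0, 1, Subtype.ext (by simp [hz, locRing.right])⟩
  · rintro ⟨_, P, Q, h1, h2, rfl⟩ ⟨_, P', Q', h1', h2', rfl⟩ ⟨⟨_, R, S, h3, h4, rfl⟩, h⟩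
    have h := congrArg Subtype.val h
    simp only [Subring.coe_mul] at h
    have h5 : evalPair κ x y (P * P' * S) = evalPair κ x y (X i * (R * Q * Q')) := by
      simp only [map_mul]
      rw [← hz]
      field_simp at h
      linear_combination h
    have h6 : X i ∣ P * P' * S := ⟨_, hxy h5⟩
    have key : ∀ P Q : MvPolynomial (Fin 2) κ, (hQ : constantCoeff Q ≠ 0) →
        (hQ' : evalPair κ x y Q ≠ 0) → X i ∣ P →
        z ∣ ⟨evalPair κ x y P / evalPair κ x y Q, P, Q, hQ, hQ', rfl⟩ := by
      rintro _ Q hQ hQ' ⟨P, rfl⟩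
      refine ⟨⟨_, P, Q, hQ, hQ', rfl⟩, Subtype.ext ?_⟩
      simp only [Subring.coe_mul, map_mul, hz, mul_div_assoc]
    rcases (X_prime (i := i)).dvd_or_dvd h6 with h7 | h7
    · rcases (X_prime (i := i)).dvd_or_dvd h7 with h8 | h8
      · exact Or.inl (key P Q h1 h2 h8)
      · exact Or.inr (key P' Q' h1' h2' h8)
    · exact absurd h7 (hcc S h3)

theorem isParamPair_locRing (hxy : AlgebraicIndependent κ ![x, y]) [IsLocalRing (locRing κ x y)] :
    IsParamPair (locRing.left κ x y) (locRing.right κ x y) := by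
  refine ⟨?_, prime_of_evalPair_X hxy 0 _ (by simp [locRing.left]),
    prime_of_evalPair_X hxy 1 _ (by simp [locRing.right]), ?_⟩
  · ext f
    rw [mem_maximalIdeal, mem_nonunits_iff, not_isUnit_iff_mem_span hxy]
  · rintro ⟨⟨_, P, Q, h1, h2, rfl⟩, h⟩
    have h := congrArg Subtype.val h
    simp only [Subring.coe_mul, locRing.left, locRing.right] at h
    have h5 : evalPair κ x y (X 1 * Q) = evalPair κ x y (X 0 * P) := by
      simp only [map_mul, evalPair_X_zero, evalPair_X_one]
      field_simp at h
      linear_combination h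
    have h6 : X 0 ∣ X 1 * Q := ⟨P, hxy h5⟩
    rcases (X_prime (i := 0)).dvd_or_dvd h6 with h7 | ⟨q, rfl⟩
    · rw [X_dvd_X] at h7; exact absurd h7 (by decide)
    · simp at h1

theorem isRegularLocalRing_locRing (hxy : AlgebraicIndependent κ ![x, y]) :
    IsRegularLocalRing (locRing κ x y) := by
  have := isLocalRing_locRing hxy
  have := isNoetherianRing_locRing hxy
  have h := isParamPair_locRing hxy
  exact isRegularLocalRing_of_prime h.maximalIdeal_eq h.prime_left h.not_dvd

end LocRing

/-! ### Coordinates of a rational function field in two variables. -/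

section Coord

/-- `(x, y)` are algebraically independent generators of the field `F` over `κ`. -/
structure IsCoord (κ : Type*) {F : Type*} [Field κ] [Field F] [Algebra κ F] (x y : F) : Prop where
  indep : AlgebraicIndependent κ ![x, y]
  gen : IntermediateField.adjoin κ {x, y} = ⊤

variable {κ F : Type*} [Field κ] [Field F] [Algebra κ F] {x y x' y' : F}

theorem isAlgebraic_adjoin_of_adjoin_eq_top {ι : Type*} (s : ι → F)
    (h : IntermediateField.adjoin κ (Set.range s) = ⊤) :
    Algebra.IsAlgebraic (Algebra.adjoin κ (Set.range s)) F := by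
  refine ⟨fun f => ?_⟩
  obtain ⟨P, Q, e⟩ := (IntermediateField.mem_adjoin_range_iff κ s f).mp (h ▸ IntermediateField.mem_top)
  have hmem : ∀ P : MvPolynomial ι κ, MvPolynomial.aeval s P ∈ Algebra.adjoin κ (Set.range s) := by
    intro P
    rw [Algebra.adjoin_range_eq_range_aeval]
    exact ⟨P, rfl⟩
  by_cases hQ : MvPolynomial.aeval s Q = 0
  · rw [hQ, div_zero] at e
    rw [e]
    exact isAlgebraic_zero
  · have hQ' : (⟨_, hmem Q⟩ : Algebra.adjoin κ (Set.range s)) ≠ 0 := fun h => hQ (congrArg Subtype.val h)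
    refine ⟨Polynomial.C ⟨_, hmem Q⟩ * Polynomial.X - Polynomial.C ⟨_, hmem P⟩, ?_, ?_⟩
    · intro h
      have := congrArg (fun q => Polynomial.coeff q 1) h
      simp only [Polynomial.coeff_sub, Polynomial.coeff_C_mul, Polynomial.coeff_X_one,
        Polynomial.coeff_C_succ, mul_one, sub_zero, Polynomial.coeff_zero] at this
      exact hQ' this
    · rw [map_sub, map_mul, Polynomial.aeval_X, Polynomial.aeval_C, Polynomial.aeval_C, e]
      change MvPolynomial.aeval s Q * _ - MvPolynomial.aeval s P = 0
      rw [mul_div_cancel₀ _ hQ, sub_self]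

theorem Matrix.range_pair {α : Type*} (x y : α) : Set.range ![x, y] = {x, y} := by
  simp [Matrix.range_cons, Matrix.range_empty, Set.pair_comm]

theorem IsCoord.trdeg_eq (h : IsCoord κ x y) : Algebra.trdeg κ F = 2 := by
  have h1 := h.gen
  rw [← Matrix.range_pair] at h1
  have := isAlgebraic_adjoin_of_adjoin_eq_top _ h1
  have h2 := (h.indep.isTranscendenceBasis_iff_isAlgebraic).mpr this
  have h3 := h2.lift_cardinalMk_eq_trdeg
  simpa using h3.symm

/-- Two generators of a field of transcendence degree two form a transcendence basis, so only
generation has to be checked after a change of coordinates. -/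
theorem IsCoord.of_mem_adjoin (h : IsCoord κ x y) (hx : x ∈ IntermediateField.adjoin κ {x', y'})
    (hy : y ∈ IntermediateField.adjoin κ {x', y'}) : IsCoord κ x' y' := by
  have hgen : IntermediateField.adjoin κ {x', y'} = ⊤ := by
    rw [eq_top_iff, ← h.gen, IntermediateField.adjoin_le_iff]
    rintro _ (rfl | rfl) <;> assumption
  refine ⟨?_, hgen⟩
  rw [← Matrix.range_pair] at hgen
  have := isAlgebraic_adjoin_of_adjoin_eq_top _ hgen
  refine (Algebra.IsAlgebraic.isTranscendenceBasis_of_lift_le_trdeg_of_finite κ _ ?_).1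
  rw [h.trdeg_eq]
  simp

theorem IsCoord.ne_zero_left (h : IsCoord κ x y) : x ≠ 0 := by simpa using h.indep.ne_zero 0
theorem IsCoord.ne_zero_right (h : IsCoord κ x y) : y ≠ 0 := by simpa using h.indep.ne_zero 1

theorem IsCoord.div_left (h : IsCoord κ x y) (l : ℕ) : IsCoord κ (x / y ^ l) y := by
  have hy : y ∈ IntermediateField.adjoin κ {x / y ^ l, y} :=
    IntermediateField.subset_adjoin _ _ (by simp)
  refine h.of_mem_adjoin ?_ hy
  have hx : x / y ^ l ∈ IntermediateField.adjoin κ {x / y ^ l, y} :=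
    IntermediateField.subset_adjoin _ _ (by simp)
  have := mul_mem hx (pow_mem hy l)
  rwa [div_mul_cancel₀ _ (pow_ne_zero _ h.ne_zero_right)] at this

theorem IsCoord.sub_algebraMap (h : IsCoord κ x y) (c : κ) : IsCoord κ y (x - algebraMap κ F c) := by
  refine h.of_mem_adjoin ?_ (IntermediateField.subset_adjoin _ _ (by simp))
  have := add_mem (IntermediateField.subset_adjoin κ {y, x - algebraMap κ F c}
    (show x - algebraMap κ F c ∈ _ by simp)) (IntermediateField.algebraMap_mem _ c)
  rwa [sub_add_cancel] at this

theorem IsCoord.isFractionRing (h : IsCoord κ x y) : IsFractionRing (locRing κ x y) F := by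
  apply IsFractionRing.of_field
  intro f
  obtain ⟨P, Q, e⟩ := (IntermediateField.mem_adjoin_range_iff κ ![x, y] f).mp (by
    rw [Matrix.range_pair, h.gen]; exact IntermediateField.mem_top)
  exact ⟨⟨_, evalPair_mem_locRing x y P⟩, ⟨_, evalPair_mem_locRing x y Q⟩, e⟩

end Coord

end

section

open MvPolynomial

/-! ### The effect of one blowup on a polynomial. -/

section Descent

variable {κ F : Type*} [Field κ] [Field F] [Algebra κ F]

theorem evalPair_eq_sum (x y : F) (P : MvPolynomial (Fin 2) κ) :
    evalPair κ x y P = ∑ m ∈ P.support, algebraMap κ F (coeff m P) * (x ^ m 0 * y ^ m 1) := by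
  conv_lhs => rw [P.as_sum, map_sum]
  refine Finset.sum_congr rfl fun m _ => ?_
  rw [aeval_monomial, Finsupp.prod_fintype _ _ (by simp), Fin.prod_univ_two]
  simp

theorem coeff_single_one_eq (P : MvPolynomial (Fin 2) κ) (k : ℕ) :
    coeff (Finsupp.single 1 k) P = (aeval ![0, Polynomial.X] P : Polynomial κ).coeff k := by
  induction P using MvPolynomial.induction_on' with
  | add p q hp hq => rw [coeff_add, hp, hq, map_add, Polynomial.coeff_add]
  | monomial u a =>
    rw [coeff_monomial, aeval_monomial, Finsupp.prod_fintype _ _ (by simp), Fin.prod_univ_two]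
    have h1 : u = Finsupp.single 1 k ↔ u 0 = 0 ∧ u 1 = k := by
      rw [Finsupp.ext_iff, Fin.forall_fin_two]
      simp
    simp only [h1, Polynomial.algebraMap_eq, Polynomial.coeff_C_mul, Matrix.cons_val_zero,
      Matrix.cons_val_one]
    by_cases h0 : u 0 = 0
    · simp [h0, Polynomial.coeff_X_pow, eq_comm]
    · simp [h0]

/-- Give x weight p and y weight 1, and let w be the least weight in P. After y^w is split off,
setting y = 0 leaves the terms of weight w, which give Q(y1 + c) with deg Q ≤ w/p. The leading
coefficient of this shifted polynomial is the required coefficient of y1^r, with r = deg Q. -/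
theorem exists_evalPair_eq_pow_mul (x y y1 : F) (c : κ) (p : ℕ) (hp : 0 < p)
    (hx : x = y ^ p * (y1 + algebraMap κ F c)) (P : MvPolynomial (Fin 2) κ) (hP : P ≠ 0) :
    ∃ (w r : ℕ) (P' : MvPolynomial (Fin 2) κ), evalPair κ x y P = y ^ w * evalPair κ y y1 P' ∧
      coeff (Finsupp.single 1 r) P' ≠ 0 ∧ r * p ≤ w ∧ ∀ m ∈ P.support, w ≤ p * m 0 + m 1 := by
  obtain ⟨m₀, hm₀, hmin⟩ := P.support.exists_min_image (fun m => p * m 0 + m 1) (support_nonempty.mpr hP)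
  set w := p * m₀ 0 + m₀ 1 with hw
  let P' : MvPolynomial (Fin 2) κ := ∑ m ∈ P.support,
    C (coeff m P) * (X 0 ^ (p * m 0 + m 1 - w) * (X 1 + C c) ^ m 0)
  let Q : Polynomial κ := ∑ m ∈ P.support with p * m 0 + m 1 = w,
    Polynomial.C (coeff m P) * Polynomial.X ^ m 0
  have hPQ : (aeval ![0, Polynomial.X] P' : Polynomial κ) = Polynomial.taylor c Q := by
    simp only [P', Q, map_sum, Finset.sum_filter]
    refine Finset.sum_congr rfl fun m hm => ?_
    have := hmin m hm
    split_ifs with h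
    · simp [h, Polynomial.algebraMap_eq]
    · have h2 : p * m 0 + m 1 - w ≠ 0 := by omega
      simp [h2]
  have hQdeg : Q.natDegree ≤ w / p := by
    refine Polynomial.natDegree_sum_le_of_forall_le _ _ fun m hm => ?_
    refine (Polynomial.natDegree_C_mul_X_pow_le _ _).trans ?_
    rw [Nat.le_div_iff_mul_le hp, mul_comm]
    have := (Finset.mem_filter.mp hm).2
    omega
  have hQ : Q ≠ 0 := by
    intro h
    have h1 : Q.coeff (m₀ 0) = coeff m₀ P := by
      rw [Polynomial.finsetSum_coeff, Finset.sum_eq_single m₀]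
      · simp
      · intro m hm hne
        rw [Polynomial.coeff_C_mul_X_pow, if_neg]
        intro h0
        apply hne
        have := (Finset.mem_filter.mp hm).2
        ext i
        fin_cases i
        · exact h0.symm
        · change m 1 = m₀ 1
          rw [← h0] at this
          omega
      · intro h
        exact (h (Finset.mem_filter.mpr ⟨hm₀, rfl⟩)).elim
    rw [h, Polynomial.coeff_zero] at h1
    exact (mem_support_iff.mp hm₀) h1.symm
  have hT : Polynomial.taylor c Q ≠ 0 := by
    rwa [Ne, Polynomial.taylor_eq_zero]
  refine ⟨w, (Polynomial.taylor c Q).natDegree, P', ?_, ?_, ?_, hmin⟩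
  · simp only [P']
    rw [evalPair_eq_sum, map_sum, Finset.mul_sum]
    refine Finset.sum_congr rfl fun m hm => ?_
    obtain ⟨d, hd⟩ := Nat.exists_eq_add_of_le (hmin m hm)
    change p * m 0 + m 1 = w + d at hd
    rw [hd, Nat.add_sub_cancel_left]
    simp only [map_mul, map_add, map_pow, evalPair_X_zero, evalPair_X_one, algHom_C]
    have : x ^ m 0 * y ^ m 1 = y ^ (p * m 0 + m 1) * (y1 + algebraMap κ F c) ^ m 0 := by
      rw [hx, mul_pow, ← pow_mul, pow_add]; ring
    rw [this, hd]
    ring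
  · rw [coeff_single_one_eq, hPQ, Polynomial.coeff_natDegree, Ne, Polynomial.leadingCoeff_eq_zero]
    exact hT
  · rw [Polynomial.natDegree_taylor]
    exact (Nat.le_div_iff_mul_le hp).mp hQdeg

end Descent

/-! ### Blowup sequences and the valuation they define. -/

/-- A sequence `z` in the field `F` with consecutive terms the coordinates obtained from `z 0, z 1` by
repeated blowing up: `z (i + 2) = z i / z (i + 1) ^ p - c i`. -/
structure IsBlowupSeq {κ F : Type*} [Field κ] [Field F] [Algebra κ F] (p : ℕ) (z : ℕ → F) (c : ℕ → κ) :
    Prop where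
  coord_zero : IsCoord κ (z 0) (z 1)
  ne_zero : ∀ i, c i ≠ 0
  rel : ∀ i, z i = z (i + 1) ^ p * (z (i + 2) + algebraMap κ F (c i))

namespace IsBlowupSeq

variable {κ F : Type*} [Field κ] [Field F] [Algebra κ F] {p : ℕ} {z : ℕ → F} {c : ℕ → κ}

theorem coord (h : IsBlowupSeq p z c) (i : ℕ) : IsCoord κ (z i) (z (i + 1)) := by
  induction i with
  | zero => exact h.coord_zero
  | succ i ih =>
    have := (ih.div_left p).sub_algebraMap (c i)
    rwa [h.rel i, mul_div_cancel_left₀ _ (pow_ne_zero _ ih.ne_zero_right), add_sub_cancel_right] at this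

theorem term_ne_zero (h : IsBlowupSeq p z c) (i : ℕ) : z i ≠ 0 := (h.coord i).ne_zero_left

theorem eq_mul_unit (h : IsBlowupSeq p z c) (i : ℕ) :
    ∃ e, IsUnitAt κ (z (i + 1)) (z (i + 2)) e ∧ z i = z (i + 1) ^ p * e := by
  refine ⟨_, ?_, h.rel i⟩
  refine isUnitAt_of_eq (h.coord (i + 1)).indep (h.ne_zero i) (zero_mem _) (one_mem _) ?_
  ring

theorem locRing_le_succ (h : IsBlowupSeq p z c) (hp : 0 < p) (i : ℕ) :
    locRing κ (z i) (z (i + 1)) ≤ locRing κ (z (i + 1)) (z (i + 2)) := by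
  obtain ⟨e, he, hz⟩ := h.eq_mul_unit i
  refine locRing_le_locRing (h.coord (i + 1)).indep (a := z (i + 1) ^ (p - 1) * e) (b := 0) (a' := 1)
    (b' := 0) (mul_mem (pow_mem (left_mem_locRing _ _) _) he.mem) (zero_mem _) (one_mem _) (zero_mem _)
    ?_ (by ring)
  rw [mul_zero, add_zero, ← mul_assoc, ← pow_succ', Nat.sub_add_cancel hp, hz]

theorem isUnitAt_succ (h : IsBlowupSeq p z c) (hp : 0 < p) {i : ℕ} {f : F}
    (hf : IsUnitAt κ (z i) (z (i + 1)) f) : IsUnitAt κ (z (i + 1)) (z (i + 2)) f := by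
  rw [isUnitAt_iff (h.coord _).indep]
  exact ⟨hf.ne_zero, h.locRing_le_succ hp i hf.mem, h.locRing_le_succ hp i hf.inv.mem⟩

theorem locRing_le_add (h : IsBlowupSeq p z c) (hp : 0 < p) (i d : ℕ) :
    locRing κ (z i) (z (i + 1)) ≤ locRing κ (z (i + d)) (z (i + d + 1)) := by
  induction d with
  | zero => exact le_rfl
  | succ d ih => exact ih.trans (h.locRing_le_succ hp _)

theorem isUnitAt_add (h : IsBlowupSeq p z c) (hp : 0 < p) {i : ℕ} (d : ℕ) {f : F}
    (hf : IsUnitAt κ (z i) (z (i + 1)) f) : IsUnitAt κ (z (i + d)) (z (i + d + 1)) f := by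
  induction d with
  | zero => exact hf
  | succ d ih => exact h.isUnitAt_succ hp ih

theorem eq_pow_mul_unit (h : IsBlowupSeq p z c) (hp : 0 < p) (i d : ℕ) :
    ∃ e, IsUnitAt κ (z (i + d)) (z (i + d + 1)) e ∧ z i = z (i + d) ^ (p ^ d) * e := by
  induction d with
  | zero => exact ⟨1, .one, by simp⟩
  | succ d ih =>
    obtain ⟨e, he, hz⟩ := ih
    obtain ⟨e', he', hz'⟩ := h.eq_mul_unit (i + d)
    refine ⟨e' ^ (p ^ d) * e, (he'.pow _).mul (h.isUnitAt_succ hp he), ?_⟩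
    rw [hz, hz', mul_pow, ← pow_mul, ← pow_succ', mul_assoc]
    rfl

theorem evalPair_eq (h : IsBlowupSeq p z c) (hp : 2 ≤ p) (r : ℕ) : ∀ (i : ℕ)
    (P : MvPolynomial (Fin 2) κ), coeff (Finsupp.single 1 r) P ≠ 0 → ∃ d m e,
      IsUnitAt κ (z (i + d)) (z (i + d + 1)) e ∧
      evalPair κ (z i) (z (i + 1)) P = z (i + d) ^ (m : ℕ) * e := by
  induction r using Nat.strong_induction_on with
  | _ r ih =>
    intro i P hP
    rcases Nat.eq_zero_or_pos r with rfl | hr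
    · refine ⟨0, 0, _, ⟨P, 1, ?_, by simp, ?_, by simp, rfl⟩, by simp⟩
      · rwa [Finsupp.single_zero] at hP
      · intro h0
        have := (h.coord i).indep (h0.trans (map_zero _).symm)
        simp [this] at hP
    · have hP0 : P ≠ 0 := by rintro rfl; simp at hP
      obtain ⟨w, r', P', h1, h2, h3, h4⟩ := exists_evalPair_eq_pow_mul _ _ _ _ p (by omega) (h.rel i) P hP0
      have h5 := h4 _ (mem_support_iff.mpr hP)
      simp only [Finsupp.single_apply, Fin.one_eq_zero_iff] at h5
      norm_num at h5
      -- The monomial y^r has weight r, so r' p ≤ w ≤ r with p ≥ 2 and r > 0.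
      have h6 : r' < r := by nlinarith
      obtain ⟨d, m, e, he, h7⟩ := ih r' h6 (i + 1) P' h2
      obtain ⟨e', he', h8⟩ := h.eq_pow_mul_unit (by omega) (i + 1) d
      rw [show i + 1 + d = i + (d + 1) by ring] at *
      refine ⟨d + 1, p ^ d * w + m, e' ^ w * e, (he'.pow _).mul he, ?_⟩
      change evalPair κ (z (i + 1)) (z (i + 2)) P' = _ at h7
      rw [h1, h7, h8]
      ring

/-- Numerator and denominator each become a power of a coordinate times a unit at some level. Units
stay units at later levels, so the sum of the two levels serves for both. -/
theorem exists_eq_zpow_mul (h : IsBlowupSeq p z c) (hp : 2 ≤ p) {f : F} (hf : f ≠ 0) :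
    ∃ (j : ℕ) (m : ℤ) (e : F), IsUnitAt κ (z j) (z (j + 1)) e ∧ f = z j ^ m * e := by
  have key : ∀ P : MvPolynomial (Fin 2) κ, P ≠ 0 → ∃ (j m : ℕ) (e : F),
      IsUnitAt κ (z j) (z (j + 1)) e ∧ evalPair κ (z 0) (z 1) P = z j ^ m * e := by
    intro P hP0
    -- A first blowup is needed to create a pure power of the second variable, on whose exponent the
    -- descent runs.
    obtain ⟨w, r', P', h1, h2, h3, h4⟩ := exists_evalPair_eq_pow_mul _ _ _ _ p (by omega) (h.rel 0) P hP0
    obtain ⟨d, m, e, he, h7⟩ := h.evalPair_eq hp r' 1 P' h2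
    obtain ⟨e', he', h8⟩ := h.eq_pow_mul_unit (by omega) 1 d
    refine ⟨1 + d, p ^ d * w + m, e' ^ w * e, (he'.pow _).mul he, ?_⟩
    change evalPair κ (z (0 + 1)) (z (0 + 2)) P' = _ at h7
    rw [h1, h7, zero_add, h8]
    ring
  obtain ⟨P, Q, e⟩ := (IntermediateField.mem_adjoin_range_iff κ ![z 0, z 1] f).mp (by
    rw [Matrix.range_pair, h.coord_zero.gen]; exact IntermediateField.mem_top)
  have hP : P ≠ 0 := by rintro rfl; simp at e; exact hf e
  have hQ : Q ≠ 0 := by rintro rfl; simp at e; exact hf e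
  obtain ⟨j, m, a, ha, eP⟩ := key P hP
  obtain ⟨j', m', a', ha', eQ⟩ := key Q hQ
  obtain ⟨b, hb, h1⟩ := h.eq_pow_mul_unit (by omega) j j'
  obtain ⟨b', hb', h1'⟩ := h.eq_pow_mul_unit (by omega) j' j
  have ha2 := h.isUnitAt_add (by omega) j' ha
  have ha2' := h.isUnitAt_add (by omega) j ha'
  rw [show j' + j = j + j' by ring] at *
  refine ⟨j + j', (p ^ j' * m : ℕ) - (p ^ j * m' : ℕ), b ^ m * a * (b' ^ m' * a')⁻¹,
    ((hb.pow _).mul ha2).mul ((hb'.pow _).mul ha2').inv, ?_⟩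
  have hz0 := h.term_ne_zero (j + j')
  have := ha2'.ne_zero
  have := hb'.ne_zero
  rw [zpow_sub₀ hz0, zpow_natCast, zpow_natCast]
  change f = evalPair κ (z 0) (z 1) P / evalPair κ (z 0) (z 1) Q at e
  rw [e, eP, eQ, h1, h1']
  field_simp
  ring

/-- Both sides are rewritten at level j + j', where z j is the p^j'-th power of the coordinate up to
a unit. The exponents agree there because a nonzero power of the coordinate is not a unit. This
makes the value m / p^j well defined. -/
theorem zpow_mul_eq_zpow_mul (h : IsBlowupSeq p z c) (hp : 0 < p) {j j' : ℕ} {m m' : ℤ} {e e' : F}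
    (he : IsUnitAt κ (z j) (z (j + 1)) e) (he' : IsUnitAt κ (z j') (z (j' + 1)) e')
    (heq : z j ^ m * e = z j' ^ m' * e') : m * p ^ j' = m' * p ^ j := by
  obtain ⟨b, hb, h1⟩ := h.eq_pow_mul_unit hp j j'
  obtain ⟨b', hb', h1'⟩ := h.eq_pow_mul_unit hp j' j
  have ha2 := h.isUnitAt_add hp j' he
  have ha2' := h.isUnitAt_add hp j he'
  rw [show j' + j = j + j' by ring] at *
  have hz0 := h.term_ne_zero (j + j')
  set t := z (j + j') with ht
  have hkey : ∀ k : ℕ, 0 < k → ¬ IsUnitAt κ t (z (j + j' + 1)) (t ^ k) := by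
    intro k hk hu
    refine hu.ne_zero_of_eq (h.coord _).indep (c := 0) (r := t ^ (k - 1)) (s := 0)
      (pow_mem (left_mem_locRing _ _) _) (zero_mem _) ?_ rfl
    rw [map_zero, ← pow_succ', Nat.sub_add_cancel hk]
    ring
  have hu : IsUnitAt κ t (z (j + j' + 1)) (t ^ (m * p ^ j' - m' * p ^ j)) := by
    have : t ^ (m * (p : ℤ) ^ j' - m' * (p : ℤ) ^ j) = (b' ^ m' * e') * (b ^ m * e)⁻¹ := by
      rw [h1, h1', mul_zpow, mul_zpow, ← zpow_natCast, ← zpow_natCast, ← zpow_mul, ← zpow_mul] at heq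
      rw [zpow_sub₀ hz0]
      have := hb.ne_zero
      have := ha2.ne_zero
      have : b ^ m ≠ 0 := zpow_ne_zero _ hb.ne_zero
      have h5 : t ^ (m' * (p : ℤ) ^ j) ≠ 0 := zpow_ne_zero _ hz0
      push_cast at heq
      rw [mul_comm m, mul_comm m'] at *
      rw [div_eq_iff h5]
      field_simp
      linear_combination heq
    rw [this]
    exact ((hb'.zpow _).mul ha2').mul ((hb.zpow _).mul ha2).inv
  rcases lt_trichotomy (m * (p : ℤ) ^ j' - m' * (p : ℤ) ^ j) 0 with h2 | h2 | h2
  · exfalso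
    have h3 := hu.inv
    rw [← zpow_neg] at h3
    obtain ⟨k, hk⟩ := Int.eq_ofNat_of_zero_le (a := -(m * (p : ℤ) ^ j' - m' * (p : ℤ) ^ j)) (by omega)
    rw [hk, zpow_natCast] at h3
    exact hkey k (by omega) h3
  · omega
  · exfalso
    obtain ⟨k, hk⟩ := Int.eq_ofNat_of_zero_le h2.le
    rw [hk, zpow_natCast] at hu
    exact hkey k (by omega) hu

theorem div_eq_div_of_zpow_mul_eq (h : IsBlowupSeq p z c) (hp : 0 < p) {j j' : ℕ} {m m' : ℤ} {e e' : F}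
    (he : IsUnitAt κ (z j) (z (j + 1)) e) (he' : IsUnitAt κ (z j') (z (j' + 1)) e')
    (heq : z j ^ m * e = z j' ^ m' * e') : (m : ℚ) / p ^ j = m' / p ^ j' := by
  have h1 := h.zpow_mul_eq_zpow_mul hp he he' heq
  have hp0 : (p : ℚ) ≠ 0 := by exact_mod_cast hp.ne'
  rw [div_eq_div_iff (pow_ne_zero _ hp0) (pow_ne_zero _ hp0)]
  exact_mod_cast h1

/-- The value of a nonzero element is `m / p ^ j`, where the element is `z j ^ m` up to a unit. -/
noncomputable def val (p : ℕ) (z : ℕ → F) (κ : Type*) [Field κ] [Algebra κ F] (f : F) : WithTop ℚ := by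
  classical exact
  if h : f ≠ 0 ∧ ∃ q : ℚ, ∃ (j : ℕ) (m : ℤ) (e : F), IsUnitAt κ (z j) (z (j + 1)) e ∧ f = z j ^ m * e ∧
    q = m / p ^ j then ((h.2.choose : ℚ) : WithTop ℚ) else ⊤

theorem val_eq (h : IsBlowupSeq p z c) (hp : 2 ≤ p) {j : ℕ} {m : ℤ} {e : F}
    (he : IsUnitAt κ (z j) (z (j + 1)) e) : val p z κ (z j ^ m * e) = ((m / p ^ j : ℚ) : WithTop ℚ) := by
  have hne : z j ^ m * e ≠ 0 := mul_ne_zero (zpow_ne_zero _ (h.term_ne_zero j)) he.ne_zero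
  have hex : z j ^ m * e ≠ 0 ∧ ∃ q : ℚ, ∃ (j' : ℕ) (m' : ℤ) (e' : F),
    IsUnitAt κ (z j') (z (j' + 1)) e' ∧ z j ^ m * e = z j' ^ m' * e' ∧
    q = m' / p ^ j' := ⟨hne, _, j, m, e, he, rfl, rfl⟩
  rw [val, dif_pos hex]
  obtain ⟨j', m', e', he', h1, h2⟩ := hex.2.choose_spec
  rw [h2, h.div_eq_div_of_zpow_mul_eq (by omega) he he' h1]

theorem val_zero : val p z κ (0 : F) = ⊤ := by simp [val]

theorem val_eq_coe (h : IsBlowupSeq p z c) (hp : 2 ≤ p) {f : F} (hf : f ≠ 0) :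
    ∃ (j : ℕ) (m : ℤ) (e : F), IsUnitAt κ (z j) (z (j + 1)) e ∧ f = z j ^ m * e ∧
      val p z κ f = ((m / p ^ j : ℚ) : WithTop ℚ) := by
  obtain ⟨j, m, e, he, rfl⟩ := h.exists_eq_zpow_mul hp hf
  exact ⟨j, m, e, he, rfl, h.val_eq hp he⟩

theorem exists_common (h : IsBlowupSeq p z c) (hp : 2 ≤ p) {f g : F} (hf : f ≠ 0) (hg : g ≠ 0) :
    ∃ (j : ℕ) (m n : ℤ) (a b : F), IsUnitAt κ (z j) (z (j + 1)) a ∧ IsUnitAt κ (z j) (z (j + 1)) b ∧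
      f = z j ^ m * a ∧ g = z j ^ n * b := by
  obtain ⟨j, m, a, ha, rfl⟩ := h.exists_eq_zpow_mul hp hf
  obtain ⟨j', m', a', ha', rfl⟩ := h.exists_eq_zpow_mul hp hg
  obtain ⟨b, hb, h1⟩ := h.eq_pow_mul_unit (by omega) j j'
  obtain ⟨b', hb', h1'⟩ := h.eq_pow_mul_unit (by omega) j' j
  have ha2 := h.isUnitAt_add (by omega) j' ha
  have ha2' := h.isUnitAt_add (by omega) j ha'
  rw [show j' + j = j + j' by ring] at *
  refine ⟨j + j', (p ^ j' : ℕ) * m, (p ^ j : ℕ) * m', b ^ m * a, b' ^ m' * a',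
    (hb.zpow _).mul ha2, (hb'.zpow _).mul ha2', ?_, ?_⟩
  · rw [h1, mul_zpow, ← zpow_natCast, ← zpow_mul, mul_assoc]
  · rw [h1', mul_zpow, ← zpow_natCast, ← zpow_mul, mul_assoc]

theorem val_nonneg_of_mem (h : IsBlowupSeq p z c) (hp : 2 ≤ p) {j : ℕ} {f : F}
    (hf : f ∈ locRing κ (z j) (z (j + 1))) : 0 ≤ val p z κ f := by
  by_cases hf0 : f = 0
  · rw [hf0, val_zero]; exact le_top
  obtain ⟨i, m, e, he, h1, h2⟩ := h.val_eq_coe hp hf0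
  rw [h2]
  by_contra! hlt
  have hlt' : ((m / p ^ i : ℚ)) < 0 := by exact_mod_cast hlt
  have hp0 : (0 : ℚ) < p := by exact_mod_cast (by omega : 0 < p)
  have hm : m < 0 := by
    by_contra! hm
    have : (0 : ℚ) ≤ m := by exact_mod_cast hm
    exact absurd hlt' (not_lt.mpr (by positivity))
  obtain ⟨k, hk⟩ := Int.eq_ofNat_of_zero_le (a := -m) (by omega)
  have hmem := h.locRing_le_add (by omega) j i hf
  have hi := h.isUnitAt_add (by omega) j he
  obtain ⟨b, hb, h3⟩ := h.eq_pow_mul_unit (by omega) i j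
  rw [show i + j = j + i by ring] at *
  have hz := h.term_ne_zero (j + i)
  have hu := (hb.pow k).mul (hi.inv)
  -- A negative value would make a positive power of the coordinate, times an element of the ring,
  -- invertible.
  have hE : z (j + i) ^ (p ^ j * k) * f = (b ^ k)⁻¹ * e := by
    have hm' : m = -(k : ℤ) := by omega
    have := hb.ne_zero
    rw [h1, hm', h3, zpow_neg, zpow_natCast, mul_pow, ← pow_mul]
    field_simp
  have hU : IsUnitAt κ (z (j + i)) (z (j + i + 1)) (z (j + i) ^ (p ^ j * k) * f) := by
    rw [hE]; exact (hb.pow k).inv.mul hi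
  have hpos : 0 < p ^ j * k := Nat.mul_pos (pow_pos (by omega) _) (by omega)
  refine hU.ne_zero_of_eq (h.coord _).indep (c := 0) (r := z (j + i) ^ (p ^ j * k - 1) * f) (s := 0)
      (mul_mem (pow_mem (left_mem_locRing _ _) _) hmem) (zero_mem _) ?_ rfl
  rw [map_zero, ← mul_assoc, ← pow_succ', Nat.sub_add_cancel hpos]
  ring

theorem val_mul (h : IsBlowupSeq p z c) (hp : 2 ≤ p) (f g : F) :
    val p z κ (f * g) = val p z κ f + val p z κ g := by
  by_cases hf : f = 0
  · rw [hf, zero_mul, val_zero, top_add]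
  by_cases hg : g = 0
  · rw [hg, mul_zero, val_zero, add_top]
  obtain ⟨j, m, n, a, b, ha, hb, rfl, rfl⟩ := h.exists_common hp hf hg
  have hz := h.term_ne_zero j
  rw [show z j ^ m * a * (z j ^ n * b) = z j ^ (m + n) * (a * b) by rw [zpow_add₀ hz]; ring,
    h.val_eq hp ha, h.val_eq hp hb, h.val_eq hp (ha.mul hb), ← WithTop.coe_add,
    ← add_div, ← Int.cast_add]

theorem val_add (h : IsBlowupSeq p z c) (hp : 2 ≤ p) (f g : F) :
    min (val p z κ f) (val p z κ g) ≤ val p z κ (f + g) := by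
  by_cases hf : f = 0
  · rw [hf, zero_add]; exact min_le_right _ _
  by_cases hg : g = 0
  · rw [hg, add_zero]; exact min_le_left _ _
  obtain ⟨j, m, n, a, b, ha, hb, rfl, rfl⟩ := h.exists_common hp hf hg
  have hz := h.term_ne_zero j
  have key : ∀ (m n : ℤ) (a b : F), IsUnitAt κ (z j) (z (j + 1)) a → IsUnitAt κ (z j) (z (j + 1)) b →
      m ≤ n → val p z κ (z j ^ m * a) ≤ val p z κ (z j ^ m * a + z j ^ n * b) := by
    intro m n a b ha hb hmn
    obtain ⟨d, rfl⟩ := Int.exists_add_of_le hmn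
    rw [show z j ^ m * a + z j ^ (m + (d : ℤ)) * b = (z j ^ m * a) * (1 + a⁻¹ * (z j ^ d * b)) by
      have := ha.ne_zero
      rw [zpow_add₀ hz, zpow_natCast]; field_simp, h.val_mul hp (z j ^ m * a)]
    refine le_add_of_nonneg_right (h.val_nonneg_of_mem hp (j := j) ?_)
    exact add_mem (one_mem _) (mul_mem ha.inv.mem (mul_mem (pow_mem (left_mem_locRing _ _) _) hb.mem))
  rcases le_total m n with hmn | hmn
  · exact (min_le_left _ _).trans (key m n a b ha hb hmn)
  · rw [add_comm]
    exact (min_le_right _ _).trans (key n m b a hb ha hmn)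

/-- The valuation defined by a blowup sequence. -/
noncomputable def valuation (h : IsBlowupSeq p z c) (hp : 2 ≤ p) : AddValuation F (WithTop ℚ) :=
  AddValuation.of (val p z κ) val_zero
    (by have := h.val_eq hp (j := 0) (m := 0) (e := 1) .one; simpa using this)
    (h.val_add hp) (h.val_mul hp)

theorem valuation_eq (h : IsBlowupSeq p z c) (hp : 2 ≤ p) {j : ℕ} {m : ℤ} {e : F}
    (he : IsUnitAt κ (z j) (z (j + 1)) e) :
    h.valuation hp (z j ^ m * e) = ((m / p ^ j : ℚ) : WithTop ℚ) := h.val_eq hp he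

theorem valuation_algebraMap (h : IsBlowupSeq p z c) (hp : 2 ≤ p) {a : κ} (ha : a ≠ 0) :
    h.valuation hp (algebraMap κ F a) = 0 := by
  have := h.valuation_eq hp (j := 0) (m := 0) (IsUnitAt.of_algebraMap ha)
  simpa using this

theorem valuation_term (h : IsBlowupSeq p z c) (hp : 2 ≤ p) (j : ℕ) :
    h.valuation hp (z j) = ((1 / p ^ j : ℚ) : WithTop ℚ) := by
  have := h.valuation_eq hp (j := j) (m := 1) .one
  simpa using this

theorem valuation_mem (h : IsBlowupSeq p z c) (hp : 2 ≤ p) {f : F} (hf : f ≠ 0) :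
    ∃ (j : ℕ) (m : ℤ), h.valuation hp f = ((m / p ^ j : ℚ) : WithTop ℚ) := by
  obtain ⟨j, m, -, -, -, h1⟩ := h.val_eq_coe hp hf
  exact ⟨j, m, h1⟩

end IsBlowupSeq

end

/-! ### Local rings dominated by a valuation. -/

section

open IsLocalRing MvPolynomial

/-- The subring `R` is local with maximal ideal the elements of positive value. -/
def IsCentered {F : Type*} [Field F] (ν : AddValuation F (WithTop ℚ)) (R : Subring F) : Prop :=
  ∀ f ∈ R, 0 ≤ ν f ∧ (ν f = 0 → f⁻¹ ∈ R)

section Centered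

variable {F : Type*} [Field F] {ν : AddValuation F (WithTop ℚ)}

theorem AddValuation.map_inv_of_eq_zero {f : F} (hf : ν f = 0) : ν f⁻¹ = 0 := by
  have h0 : f ≠ 0 := by rintro rfl; simp at hf
  have := ν.map_mul f f⁻¹
  rw [mul_inv_cancel₀ h0, ν.map_one, hf, zero_add] at this
  exact this.symm

theorem AddValuation.map_ne_top {f : F} (hf : f ≠ 0) : ν f ≠ ⊤ := fun h => hf (ν.top_iff.mp h)

theorem IsCentered.isUnit_iff {R : Subring F} (hR : IsCentered ν R) (f : R) :
    IsUnit f ↔ ν (f : F) = 0 := by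
  constructor
  · rintro ⟨w, rfl⟩
    have h1 := (hR _ (w : R).2).1
    have h2 := (hR _ ((w⁻¹ : Rˣ) : R).2).1
    have h3 : ν ((w : R) : F) + ν ((w⁻¹ : Rˣ) : R) = 0 := by
      rw [← ν.map_mul, ← Subring.coe_mul]; simp
    refine le_antisymm ?_ h1
    rw [← h3]
    exact le_add_of_nonneg_right h2
  · intro h
    have h0 : (f : F) ≠ 0 := by intro h0; rw [h0] at h; simp at h
    exact IsUnit.of_mul_eq_one ⟨_, (hR f f.2).2 h⟩ (Subtype.ext (mul_inv_cancel₀ h0))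

theorem IsCentered.mem_maximalIdeal {R : Subring F} [IsLocalRing R] (hR : IsCentered ν R) (f : R) :
    f ∈ maximalIdeal R ↔ 0 < ν (f : F) := by
  rw [IsLocalRing.mem_maximalIdeal, mem_nonunits_iff, hR.isUnit_iff]
  exact ⟨fun h => lt_of_le_of_ne (hR f f.2).1 (Ne.symm h), fun h => h.ne'⟩

theorem isLocalHom_inclusion_of_isCentered {R S : Subring F} (hR : IsCentered ν R) (hS : IsCentered ν S)
    (h : R ≤ S) : IsLocalHom (Subring.inclusion h) := by
  refine ⟨fun a ha => ?_⟩
  rw [hS.isUnit_iff] at ha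
  exact (hR.isUnit_iff a).mpr ha

theorem isCentered_of_le_valuationLocalRing {F : Type*} [Field F] {ν : AddValuation F (WithTop ℚ)}
    {R : LocalSubring F} (h : R ≤ valuationLocalRing ν) : IsCentered ν R.toSubring := by
  obtain ⟨hle, hloc⟩ := h
  intro f hf
  have h1 := (mem_valuationLocalRing ν f).mp (hle hf)
  refine ⟨h1, fun h0 => ?_⟩
  have hne : f ≠ 0 := by rintro rfl; simp at h0
  have h2 : IsUnit (Subring.inclusion hle ⟨f, hf⟩) :=
    IsUnit.of_mul_eq_one ⟨f⁻¹, (mem_valuationLocalRing ν _).mpr (AddValuation.map_inv_of_eq_zero h0).ge⟩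
      (Subtype.ext (mul_inv_cancel₀ hne))
  obtain ⟨w, hw⟩ := (isUnit_map_iff _ _).mp h2
  have h3 : f * ((w⁻¹ : R.toSubringˣ) : R.toSubring) = 1 := by
    have := congrArg Subtype.val w.mul_inv
    rw [hw] at this
    exact this
  rw [← eq_inv_of_mul_eq_one_right h3]
  exact Subtype.property _

theorem le_valuationLocalRing_of_isCentered {R : LocalSubring F} (h : IsCentered ν R.toSubring) :
    R ≤ valuationLocalRing ν := by
  have hle : R.toSubring ≤ (valuationLocalRing ν).toSubring := fun f hf =>
    (mem_valuationLocalRing ν f).mpr (h f hf).1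
  refine ⟨hle, ⟨fun a ha => ?_⟩⟩
  rw [h.isUnit_iff]
  obtain ⟨w, hw⟩ := ha
  have h1 := (mem_valuationLocalRing ν _).mp (((w⁻¹ : (valuationLocalRing ν).toSubringˣ) :
    (valuationLocalRing ν).toSubring)).2
  have h2 : (a : F) * ((w⁻¹ : (valuationLocalRing ν).toSubringˣ) : (valuationLocalRing ν).toSubring) = 1 := by
    have := congrArg Subtype.val w.mul_inv
    rw [hw] at this
    exact this
  have h3 := ν.map_mul (a : F) ((w⁻¹ : (valuationLocalRing ν).toSubringˣ) : (valuationLocalRing ν).toSubring)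
  rw [h2, ν.map_one] at h3
  refine le_antisymm ?_ (h a a.2).1
  rw [h3]
  exact le_add_of_nonneg_right h1

variable {κ : Type*} [Field κ] [Algebra κ F] {x y : F}

theorem valuation_add_eq_zero (hκ : ∀ a : κ, a ≠ 0 → ν (algebraMap κ F a) = 0) (hx : 0 < ν x) (hy : 0 < ν y)
    {a : κ} (ha : a ≠ 0) {r s : F} (hr : 0 ≤ ν r) (hs : 0 ≤ ν s) :
    ν (algebraMap κ F a + x * r + y * s) = 0 := by
  have h1 : 0 < ν (x * r + y * s) := by
    refine (lt_min ?_ ?_).trans_le (ν.map_add _ _)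
    · rw [ν.map_mul]; exact add_pos_of_pos_of_nonneg hx hr
    · rw [ν.map_mul]; exact add_pos_of_pos_of_nonneg hy hs
  rw [add_assoc, ν.map_add_eq_of_lt_left (by rwa [hκ a ha]), hκ a ha]

theorem valuation_algebraMap_nonneg (hκ : ∀ a : κ, a ≠ 0 → ν (algebraMap κ F a) = 0) (a : κ) :
    0 ≤ ν (algebraMap κ F a) := by
  by_cases ha : a = 0
  · simp [ha]
  · exact (hκ a ha).ge

theorem isCentered_locRing (hκ : ∀ a : κ, a ≠ 0 → ν (algebraMap κ F a) = 0) (hx : 0 < ν x) (hy : 0 < ν y)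
    (hxy : AlgebraicIndependent κ ![x, y]) : IsCentered ν (locRing κ x y) := by
  have h1 : ∀ P : MvPolynomial (Fin 2) κ, 0 ≤ ν (evalPair κ x y P) := by
    intro P
    induction P using MvPolynomial.induction_on with
    | C a => rw [algHom_C]; exact valuation_algebraMap_nonneg hκ a
    | add p q hp hq => rw [map_add]; exact (le_min hp hq).trans (ν.map_add _ _)
    | mul_X p i hp =>
      rw [map_mul, ν.map_mul]
      refine add_nonneg hp ?_
      fin_cases i <;> simp [hx.le, hy.le]
  have h2 : ∀ P : MvPolynomial (Fin 2) κ, constantCoeff P ≠ 0 → ν (evalPair κ x y P) = 0 := by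
    intro P hP
    obtain ⟨P0, P1, e⟩ := MvPolynomial.exists_eq_C_add_X_mul_add_X_mul P
    rw [e]
    simp only [map_add, map_mul, evalPair_X_zero, evalPair_X_one, algHom_C]
    exact valuation_add_eq_zero hκ hx hy hP (h1 _) (h1 _)
  have h3 : ∀ f ∈ locRing κ x y, 0 ≤ ν f := by
    rintro _ ⟨P, Q, hQ, hQ', rfl⟩
    rw [div_eq_mul_inv, ν.map_mul, AddValuation.map_inv_of_eq_zero (h2 Q hQ), add_zero]
    exact h1 P
  intro f hf
  refine ⟨h3 f hf, fun h0 => ?_⟩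
  obtain ⟨c, r, hr, s, hs, e⟩ := exists_eq_add_mul_add_mul_of_mem_locRing hf
  refine (isUnitAt_of_eq hxy (c := c) ?_ hr hs e).inv.mem
  rintro rfl
  rw [map_zero, zero_add] at e
  have : 0 < ν f := by
    rw [e]
    refine (lt_min ?_ ?_).trans_le (ν.map_add _ _)
    · rw [ν.map_mul]; exact add_pos_of_pos_of_nonneg hx (h3 r hr)
    · rw [ν.map_mul]; exact add_pos_of_pos_of_nonneg hy (h3 s hs)
  exact this.ne' h0

theorem locRing_le_of_isCentered (hκ : ∀ a : κ, a ≠ 0 → ν (algebraMap κ F a) = 0) (hx : 0 < ν x) (hy : 0 < ν y)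
    {S : Subring F} (hS : IsCentered ν S) (hκS : ∀ a, algebraMap κ F a ∈ S) (hxS : x ∈ S) (hyS : y ∈ S) :
    locRing κ x y ≤ S := by
  refine locRing_le hκS hxS hyS fun c hc r hr s hs => ?_
  exact (hS _ (add_mem (add_mem (hκS c) (mul_mem hxS hr)) (mul_mem hyS hs))).2
    (valuation_add_eq_zero hκ hx hy hc (hS r hr).1 (hS s hs).1)

/-- Of the two quotients offered by the factorization step, y/x in R' has value at most zero when ν
y ≤ ν x. It then has value zero and is invertible in R', so x/y lies in R' in either case. -/
theorem eq_locRing_or_div_mem (hxy : IsCoord κ x y) {R' : Subring F} [IsLocalRing R']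
    [UniqueFactorizationMonoid R'] (hle : locRing κ x y ≤ R') (hR : IsCentered ν (locRing κ x y))
    (hR' : IsCentered ν R') (hν : ν y ≤ ν x) : R' = locRing κ x y ∨ x / y ∈ R' := by
  have := isLocalRing_locRing hxy.indep
  have := isNoetherianRing_locRing hxy.indep
  have hp := isParamPair_locRing hxy.indep
  have := hxy.isFractionRing
  let : Algebra (locRing κ x y) R' := (Subring.inclusion hle).toAlgebra
  have : IsScalarTower (locRing κ x y) R' F := .of_algebraMap_eq fun _ => rfl
  have : IsLocalHom (algebraMap (locRing κ x y) R') := isLocalHom_inclusion_of_isCentered hR hR' hle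
  have : FaithfulSMul R' F := (faithfulSMul_iff_algebraMap_injective _ _).mpr Subtype.val_injective
  have hx0 := hxy.ne_zero_left
  have hy0 := hxy.ne_zero_right
  rcases surjective_algebraMap_or_dvd_of_birational (R := locRing κ x y) (R' := R') (F := F) hp.maximalIdeal_eq
    hp.prime_left hp.prime_right.ne_zero with h | ⟨q, h⟩ | ⟨q, h⟩
  · left
    refine le_antisymm (fun f hf => ?_) hle
    obtain ⟨g, hg⟩ := h ⟨f, hf⟩
    have : (g : F) = f := congrArg Subtype.val hg
    rw [← this]
    exact g.2
  · right
    have h1 : y = x * q := congrArg Subtype.val h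
    have h2 := (hR' q q.2).1
    have h3 : ν (q : F) = 0 := by
      rw [h1, ν.map_mul] at hν
      refine le_antisymm ?_ h2
      have hx1 := AddValuation.map_ne_top (ν := ν) hx0
      have hq1 : ν (q : F) ≠ ⊤ := AddValuation.map_ne_top (by rintro hq; rw [hq, mul_zero] at h1; exact hy0 h1)
      lift ν x to ℚ using hx1 with a
      lift ν (q : F) to ℚ using hq1 with b
      have : a + b ≤ a := by exact_mod_cast hν
      exact_mod_cast (by linarith : b ≤ 0)
    have h4 := (hR' q q.2).2 h3
    have h5 : x / y = (q : F)⁻¹ := by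
      rw [h1]; field_simp
    rwa [h5]
  · right
    have h1 : x = y * q := congrArg Subtype.val h
    rw [h1, mul_div_cancel_left₀ _ hy0]
    exact q.2

end Centered

/-! ### The local rings along the valuation of a blowup sequence. -/

namespace IsBlowupSeq

variable {κ F : Type*} [Field κ] [Field F] [Algebra κ F] {p : ℕ} {z : ℕ → F} {c : ℕ → κ}
  {ν : AddValuation F (WithTop ℚ)} {C : ℚ}

theorem valuation_div (h : IsBlowupSeq p z c) (hp : 2 ≤ p)
    (hz : ∀ i, ν (z i) = ((C / p ^ i : ℚ) : WithTop ℚ)) (i l : ℕ) :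
    ν (z i / z (i + 1) ^ l) = ((C * (p - l) / p ^ (i + 1) : ℚ) : WithTop ℚ) := by
  have hne := AddValuation.map_ne_top (ν := ν) (h.coord i |>.div_left l).ne_zero_left
  have h1 : ν (z i) = ν (z i / z (i + 1) ^ l) + l • ν (z (i + 1)) := by
    rw [← ν.map_pow, ← ν.map_mul, div_mul_cancel₀ _ (pow_ne_zero _ (h.term_ne_zero _))]
  rw [hz, hz] at h1
  lift ν (z i / z (i + 1) ^ l) to ℚ using hne with a ha
  have hp0 : (p : ℚ) ≠ 0 := by positivity
  have h2 : C / p ^ i = a + l * (C / p ^ (i + 1)) := by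
    rw [← nsmul_eq_mul]
    exact_mod_cast h1
  have h3 : a = C * (p - l) / p ^ (i + 1) := by
    rw [pow_succ] at *
    field_simp at h2 ⊢
    linear_combination -h2
  rw [h3]

theorem valuation_pos (hp : 2 ≤ p) (hC : 0 < C)
    (hz : ∀ i, ν (z i) = ((C / p ^ i : ℚ) : WithTop ℚ)) (i : ℕ) : 0 < ν (z i) := by
  rw [hz]
  have hp0 : (0 : ℚ) < p := by positivity
  exact_mod_cast (by positivity : 0 < C / p ^ i)

theorem valuation_le_div (h : IsBlowupSeq p z c) (hp : 2 ≤ p) (hC : 0 < C)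
    (hz : ∀ i, ν (z i) = ((C / p ^ i : ℚ) : WithTop ℚ)) (i l : ℕ) (hl : l < p) :
    ν (z (i + 1)) ≤ ν (z i / z (i + 1) ^ l) := by
  rw [h.valuation_div hp hz, hz]
  have hp0 : (0 : ℚ) < p := by positivity
  have : (1 : ℚ) ≤ p - l := by
    have : (l : ℚ) + 1 ≤ p := by exact_mod_cast hl
    linarith
  have h2 : C / p ^ (i + 1) ≤ C * (p - l) / p ^ (i + 1) := by
    gcongr
    exact le_mul_of_one_le_right hC.le this
  exact_mod_cast h2

theorem valuation_div_pos (h : IsBlowupSeq p z c) (hp : 2 ≤ p) (hC : 0 < C)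
    (hz : ∀ i, ν (z i) = ((C / p ^ i : ℚ) : WithTop ℚ)) (i l : ℕ) (hl : l < p) :
    0 < ν (z i / z (i + 1) ^ l) :=
  (valuation_pos hp hC hz _).trans_le (h.valuation_le_div hp hC hz i l hl)

theorem isCentered (h : IsBlowupSeq p z c) (hp : 2 ≤ p) (hC : 0 < C)
    (hκ : ∀ a : κ, a ≠ 0 → ν (algebraMap κ F a) = 0)
    (hz : ∀ i, ν (z i) = ((C / p ^ i : ℚ) : WithTop ℚ)) (i l : ℕ) (hl : l < p) :
    IsCentered ν (locRing κ (z i / z (i + 1) ^ l) (z (i + 1))) :=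
  isCentered_locRing hκ (h.valuation_div_pos hp hC hz i l hl) (valuation_pos hp hC hz _)
    ((h.coord i).div_left l).indep

/-- Finitely many generators of the maximal ideal give a positive lower bound for the values on it,
whereas C / p^i tends to zero. -/
theorem not_forall_mem (hp : 2 ≤ p) (hC : 0 < C)
    (hz : ∀ i, ν (z i) = ((C / p ^ i : ℚ) : WithTop ℚ)) {R' : Subring F} [IsLocalRing R']
    [IsNoetherianRing R'] (hR' : IsCentered ν R') : ¬ ∀ i, z i ∈ R' := by
  classical
  intro hall
  have hfg : (maximalIdeal R').FG := IsNoetherian.noetherian _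
  obtain ⟨S, hS⟩ := hfg
  have hδ : ∃ δ : ℚ, 0 < δ ∧ ∀ s ∈ S, (δ : WithTop ℚ) ≤ ν (s : F) := by
    have hpos : ∀ s ∈ S, 0 < ν (s : F) := fun s hs => by
      rw [← hR'.mem_maximalIdeal, ← hS]
      exact Submodule.subset_span hs
    clear hS
    induction S using Finset.induction_on with
    | empty => exact ⟨1, one_pos, by simp⟩
    | insert a S _ ih =>
      obtain ⟨δ, h1, h2⟩ := ih fun s hs => hpos s (Finset.mem_insert_of_mem hs)
      have h3 := hpos a (Finset.mem_insert_self _ _)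
      obtain ⟨ε, h4, h5⟩ : ∃ ε : ℚ, 0 < ε ∧ (ε : WithTop ℚ) ≤ ν (a : F) := by
        generalize ν (a : F) = t at h3
        cases t with
        | top => exact ⟨1, one_pos, le_top⟩
        | coe t => exact ⟨t, by exact_mod_cast h3, le_rfl⟩
      refine ⟨min δ ε, lt_min h1 h4, fun s hs => ?_⟩
      rcases Finset.mem_insert.mp hs with rfl | hs
      · exact le_trans (by exact_mod_cast min_le_right _ _) h5
      · exact le_trans (by exact_mod_cast min_le_left _ _) (h2 s hs)
  obtain ⟨δ, hδ0, hδ⟩ := hδ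
  have key : ∀ f ∈ maximalIdeal R', (δ : WithTop ℚ) ≤ ν (f : F) := by
    intro f hf
    rw [← hS] at hf
    induction hf using Submodule.span_induction with
    | mem x hx => exact hδ x hx
    | zero => simp
    | add x y _ _ hx hy => exact (le_min hx hy).trans (ν.map_add _ _)
    | smul a x _ hx =>
      rw [smul_eq_mul, Subring.coe_mul, ν.map_mul]
      exact hx.trans (le_add_of_nonneg_left (hR' a a.2).1)
  have hp1 : (1 : ℚ) < p := by exact_mod_cast (by omega : 1 < p)
  obtain ⟨n, hn⟩ := pow_unbounded_of_one_lt (C / δ) hp1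
  have h1 := key ⟨z n, hall n⟩ ((hR'.mem_maximalIdeal _).mpr (valuation_pos hp hC hz n))
  change (δ : WithTop ℚ) ≤ ν (z n) at h1
  rw [hz] at h1
  have h2 : δ ≤ C / p ^ n := by exact_mod_cast h1
  rw [div_lt_iff₀ hδ0] at hn
  rw [le_div_iff₀ (by positivity)] at h2
  linarith

/-- The factorial local rings above `κ[z 0, z 1]` along the valuation are its iterated blowups. -/
theorem exists_eq_locRing (h : IsBlowupSeq p z c) (hp : 2 ≤ p) (hC : 0 < C)
    (hκ : ∀ a : κ, a ≠ 0 → ν (algebraMap κ F a) = 0)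
    (hz : ∀ i, ν (z i) = ((C / p ^ i : ℚ) : WithTop ℚ)) {R' : Subring F} [IsLocalRing R']
    [IsNoetherianRing R'] [UniqueFactorizationMonoid R'] (hR' : IsCentered ν R')
    (hle : locRing κ (z 0) (z 1) ≤ R') :
    ∃ i l, l < p ∧ R' = locRing κ (z i / z (i + 1) ^ l) (z (i + 1)) := by
  by_contra! hne
  have hκR : ∀ a, algebraMap κ F a ∈ R' := fun a => hle (algebraMap_mem_locRing _ _ a)
  apply not_forall_mem hp hC hz hR'
  suffices ∀ i, z i ∈ R' ∧ z (i + 1) ∈ R' from fun i => (this i).1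
  intro i
  induction i with
  | zero => exact ⟨hle (left_mem_locRing _ _), hle (right_mem_locRing _ _)⟩
  | succ i ih =>
    refine ⟨ih.2, ?_⟩
    -- One passage from z i to z (i + 2) consists of p quadratic transforms. As R' differs from each
    -- intermediate ring it contains the next quotient, and the last one is z (i + 2) + c i.
    have h1 : ∀ l ≤ p, z i / z (i + 1) ^ l ∈ R' := by
      intro l
      induction l with
      | zero => intro _; simpa using ih.1
      | succ l ihl =>
        intro hl
        have h2 := locRing_le_of_isCentered hκ (h.valuation_div_pos hp hC hz i l (by omega))
          (valuation_pos hp hC hz (i + 1)) hR' hκR (ihl (by omega)) ih.2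
        rcases eq_locRing_or_div_mem ((h.coord i).div_left l) h2 (h.isCentered hp hC hκ hz i l (by omega))
          hR' (h.valuation_le_div hp hC hz i l (by omega)) with h3 | h3
        · exact absurd h3 (hne i l (by omega))
        · rwa [div_div, ← pow_succ] at h3
    have h2 := sub_mem (h1 p le_rfl) (hκR (c i))
    rwa [h.rel i, mul_div_cancel_left₀ _ (pow_ne_zero _ (h.term_ne_zero _)), add_sub_cancel_right] at h2

end IsBlowupSeq

end

/-! ### The stable form and its invariance under blowing up. -/

section

open MvPolynomial

/-- The shape `u = γ x ^ p`, `v = τ y ^ p + σ x` with units `γ, τ, σ`, where the linear term of `γ` in `y`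
does not vanish; it reproduces itself under blowing up. -/
def IsStableForm (κ : Type*) {F : Type*} [Field κ] [Field F] [Algebra κ F] (p : ℕ) (x y u v : F) : Prop :=
  ∃ γ τ σ : F, IsUnitAt κ x y γ ∧ IsUnitAt κ x y τ ∧ IsUnitAt κ x y σ ∧
    u = γ * x ^ p ∧ v = τ * y ^ p + σ * x ∧
    ∃ γ₀ γ₁ : κ, γ₀ ≠ 0 ∧ γ₁ ≠ 0 ∧ ∃ r ∈ locRing κ x y, ∃ s ∈ locRing κ x y,
      γ = algebraMap κ F γ₀ + algebraMap κ F γ₁ * y + x * r + y ^ 2 * s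

section StableForm

variable {κ F : Type*} [Field κ] [Field F] [Algebra κ F] {p : ℕ} {x y u v : F}

theorem IsStableForm.of_eq (hxy : AlgebraicIndependent κ ![x, y]) (hu : u = x ^ p * (1 + y)) (hv : v = y ^ p + x) :
    IsStableForm κ p x y u v := by
  refine ⟨1 + y, 1, 1, ?_, .one, .one, by rw [hu]; ring, by rw [hv]; ring, 1, 1, one_ne_zero, one_ne_zero,
    0, zero_mem _, 0, zero_mem _, by simp⟩
  exact isUnitAt_of_eq hxy one_ne_zero (zero_mem _) (one_mem _) (by simp)

/-- With x = y^p (Y + c) one has v = γ' y^p for γ' = τ + σ (Y + c), and u / v^p = γ (Y^p + c^p) /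
γ'^p. By Frobenius γ'^p = g^p + σ₀^p Y^p + y^p t^p, so after subtraction of a constant only Y^p and
y times units remain. The roles interchange: σ₀ becomes the linear coefficient of the new γ, and γ₁
c^p / g^p the constant term of the new σ. -/
theorem IsStableForm.exists_blowup (hp : p.Prime) [CharP κ p] (hκ : 3 ≤ Cardinal.mk κ) (hxy : IsCoord κ x y)
    (h : IsStableForm κ p x y u v) : ∃ c β : κ, c ≠ 0 ∧ β ≠ 0 ∧ v ≠ 0 ∧
      IsStableForm κ p y (x / y ^ p - algebraMap κ F c) v (u / v ^ p - algebraMap κ F β) := by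
  have : Fact p.Prime := ⟨hp⟩
  have hpF : CharP F p := charP_of_injective_algebraMap (algebraMap κ F).injective p
  have : ExpChar F p := .prime hp
  have : ExpChar κ p := .prime hp
  obtain ⟨γ, τ, σ, hγ, hτ, hσ, hu, hv, γ₀, γ₁, hγ₀, hγ₁, r, hr, s, hs, eγ⟩ := h
  obtain ⟨τ₀, hτ₀, a, ha, b, hb, eτ⟩ := hτ.exists_eq hxy.indep
  obtain ⟨σ₀, hσ₀, a', ha', b', hb', eσ⟩ := hσ.exists_eq hxy.indep
  -- The value -τ₀ / σ₀ would make the constant term g of γ' vanish. Avoiding it together with 0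
  -- uses the three elements of κ.
  obtain ⟨c, hc0, hc1⟩ := Cardinal.exists_ne_ne_of_three_le hκ 0 (-τ₀ / σ₀)
  set g := τ₀ + σ₀ * c with hg
  have hg0 : g ≠ 0 := by
    intro h0
    apply hc1
    field_simp
    linear_combination h0
  -- This is the residue of u / v^p = γ (Y + c)^p / γ'^p.
  set β := γ₀ * c ^ p / g ^ p with hβ
  have hβ0 : β ≠ 0 := div_ne_zero (mul_ne_zero hγ₀ (pow_ne_zero _ hc0)) (pow_ne_zero _ hg0)
  have hp2 := hp.two_le
  have hy0 := hxy.ne_zero_right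
  have hXY := (hxy.div_left p).sub_algebraMap c
  set Y := x / y ^ p - algebraMap κ F c with hY
  have ex : x = y ^ p * (Y + algebraMap κ F c) := by
    rw [hY]; field_simp; ring
  have hX := left_mem_locRing (κ := κ) y Y
  have hYm := right_mem_locRing (κ := κ) y Y
  have hC := algebraMap_mem_locRing (κ := κ) y Y
  have hle : locRing κ x y ≤ locRing κ y Y := by
    refine locRing_le_locRing hXY.indep (a := y ^ (p - 1) * (Y + algebraMap κ F c)) (b := 0) (a' := 1) (b' := 0)
      (mul_mem (pow_mem hX _) (add_mem hYm (hC c))) (zero_mem _) (one_mem _) (zero_mem _) ?_ (by ring)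
    rw [mul_zero, add_zero, ← mul_assoc, ← pow_succ', Nat.sub_add_cancel (by omega), ← ex]
  replace hr := hle hr
  replace hs := hle hs
  replace ha := hle ha
  replace hb := hle hb
  replace ha' := hle ha'
  replace hb' := hle hb'
  obtain ⟨q, rfl⟩ : ∃ q, p = q + 2 := ⟨p - 2, by omega⟩
  set c' := algebraMap κ F c with hc'
  have hYc := add_mem hYm (hC c)
  rw [← hc'] at hYc
  set t := y ^ (q + 1) * (Y + c') * a + b + (y ^ (q + 1) * (Y + c') * a' + b') * (Y + c') with ht
  have htm : t ∈ locRing κ y Y :=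
    add_mem (add_mem (mul_mem (mul_mem (pow_mem hX _) hYc) ha) hb)
      (mul_mem (add_mem (mul_mem (mul_mem (pow_mem hX _) hYc) ha') hb') hYc)
  set γ' := τ + σ * (Y + c') with hγ'
  have eγ' : γ' = algebraMap κ F g + algebraMap κ F σ₀ * Y + y * t := by
    rw [hγ', eτ, eσ, hg, ht, map_add, map_mul, ← hc']
    conv_lhs => rw [ex]
    ring
  have hγ'u : IsUnitAt κ y Y γ' :=
    isUnitAt_of_eq hXY.indep hg0 htm (hC σ₀) (by rw [eγ']; ring)
  have hγ'0 := hγ'u.ne_zero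
  have ev : v = γ' * y ^ (q + 2) := by
    rw [hv, hγ']; conv_lhs => rw [ex]
    ring
  have hv0 : v ≠ 0 := by rw [ev]; exact mul_ne_zero hγ'0 (pow_ne_zero _ hy0)
  refine ⟨c, β, hc0, hβ0, hv0, γ', ?_⟩
  set s₂ := y ^ q * (Y + c') * r + s with hs₂
  have hs₂m : s₂ ∈ locRing κ y Y := add_mem (mul_mem (mul_mem (pow_mem hX _) hYc) hr) hs
  have eγ2 : γ = algebraMap κ F γ₀ + y * (algebraMap κ F γ₁ + y * s₂) := by
    rw [eγ, hs₂]; conv_lhs => rw [ex]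
    ring
  -- The constant term of the numerator of the new τ; additivity of Frobenius on g = τ₀ + σ₀ c gives
  -- e₀ g^p = γ₀ τ₀^p, which is not zero.
  set e₀ := γ₀ - β * σ₀ ^ (q + 2) with he₀
  have he₀0 : e₀ ≠ 0 := by
    have h1 : e₀ * g ^ (q + 2) = γ₀ * τ₀ ^ (q + 2) := by
      have h2 : g ^ (q + 2) = τ₀ ^ (q + 2) + (σ₀ * c) ^ (q + 2) := add_pow_char _ _ _
      have h3 : g ^ (q + 2) ≠ 0 := pow_ne_zero _ hg0
      rw [he₀, hβ]
      field_simp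
      rw [h2]
      ring
    intro h0
    rw [h0, zero_mul] at h1
    exact mul_ne_zero hγ₀ (pow_ne_zero _ hτ₀) h1.symm
  -- The new τ and σ are the coefficients of Y^p and y in γ (Y^p + c^p) - β γ'^p, divided by γ'^p.
  -- The constants γ₀ c^p and β g^p cancel, and the rest of γ c^p is divisible by y with leading
  -- coefficient γ₁ c^p.
  refine ⟨(algebraMap κ F e₀ + y * (algebraMap κ F γ₁ + y * s₂)) * (γ'⁻¹) ^ (q + 2),
    (algebraMap κ F (γ₁ * c ^ (q + 2)) +
      y * (s₂ * c' ^ (q + 2) - algebraMap κ F β * y ^ q * t ^ (q + 2))) * (γ'⁻¹) ^ (q + 2),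
    hγ'u, ?_, ?_, ev, ?_, g, σ₀, hg0, hσ₀, t, htm, 0, zero_mem _, by rw [eγ']; ring⟩
  · refine IsUnitAt.mul ?_ (hγ'u.inv.pow _)
    exact isUnitAt_of_eq hXY.indep he₀0 (add_mem (hC γ₁) (mul_mem hX hs₂m)) (zero_mem _) (by ring)
  · refine IsUnitAt.mul ?_ (hγ'u.inv.pow _)
    refine isUnitAt_of_eq hXY.indep (c := γ₁ * c ^ (q + 2))
      (r := s₂ * c' ^ (q + 2) - algebraMap κ F β * y ^ q * t ^ (q + 2)) (s := 0)
      (mul_ne_zero hγ₁ (pow_ne_zero _ hc0)) (sub_mem (mul_mem hs₂m (pow_mem (hC c) _))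
      (mul_mem (mul_mem (hC β) (pow_mem hX _)) (pow_mem htm _))) (zero_mem (locRing κ y Y)) ?_
    rw [mul_zero, add_zero]
  · have h1 : γ' ^ (q + 2) = algebraMap κ F g ^ (q + 2) + algebraMap κ F σ₀ ^ (q + 2) * Y ^ (q + 2) +
        y ^ (q + 2) * t ^ (q + 2) := by
      rw [eγ', add_pow_char, add_pow_char, mul_pow, mul_pow]
    have h2 : (Y + c') ^ (q + 2) = Y ^ (q + 2) + c' ^ (q + 2) := add_pow_char _ _ _
    have h3 : algebraMap κ F β * algebraMap κ F g ^ (q + 2) = algebraMap κ F γ₀ * c' ^ (q + 2) := by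
      rw [hc', ← map_pow, ← map_pow, ← map_mul, ← map_mul, hβ,
        div_mul_cancel₀ _ (pow_ne_zero _ hg0)]
    have h4 : algebraMap κ F e₀ = algebraMap κ F γ₀ - algebraMap κ F β * algebraMap κ F σ₀ ^ (q + 2) := by
      rw [he₀, map_sub, map_mul, map_pow]
    have h5 : u / v ^ (q + 2) = γ * (Y + c') ^ (q + 2) / γ' ^ (q + 2) := by
      rw [hu, ev, ex, mul_pow, mul_pow]
      have : (y ^ (q + 2)) ^ (q + 2) ≠ 0 := pow_ne_zero _ (pow_ne_zero _ hy0)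
      field_simp
    rw [h5, h2, h4, map_mul, map_pow, ← hc', inv_pow]
    have h6 : γ' ^ (q + 2) ≠ 0 := pow_ne_zero _ hγ'0
    rw [div_sub' h6, div_eq_mul_inv, mul_right_comm, mul_right_comm _ _ y, ← add_mul, h1]
    congr 1
    rw [eγ2]
    linear_combination -h3

theorem exists_isBlowupSeq_pair {K : Type*} [Field K] [Algebra κ K] [Algebra K F] [IsScalarTower κ K F]
    (hp : p.Prime) [CharP κ p] (hκ : 3 ≤ Cardinal.mk κ) {x y : F} {u v : K} (hxy : IsCoord κ x y)
    (huv : IsCoord κ u v) (hu : algebraMap K F u = x ^ p * (1 + y)) (hv : algebraMap K F v = y ^ p + x) :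
    ∃ (z : ℕ → F) (w : ℕ → K) (c b : ℕ → κ), IsBlowupSeq p z c ∧ IsBlowupSeq p w b ∧
      z 0 = x ∧ z 1 = y ∧ w 0 = u ∧ w 1 = v ∧
      ∀ i, IsStableForm κ p (z i) (z (i + 1)) (algebraMap K F (w i)) (algebraMap K F (w (i + 1))) := by
  let T := {s : (F × F) × (K × K) // IsCoord κ s.1.1 s.1.2 ∧
    IsStableForm κ p s.1.1 s.1.2 (algebraMap K F s.2.1) (algebraMap K F s.2.2)}
  have step : ∀ s : T, ∃ s' : T, ∃ c b : κ, c ≠ 0 ∧ b ≠ 0 ∧ s'.1.1.1 = s.1.1.2 ∧ s'.1.2.1 = s.1.2.2 ∧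
      s.1.1.1 = s.1.1.2 ^ p * (s'.1.1.2 + algebraMap κ F c) ∧
      s.1.2.1 = s.1.2.2 ^ p * (s'.1.2.2 + algebraMap κ K b) := by
    rintro ⟨⟨⟨x, y⟩, u, v⟩, hxy, hs⟩
    obtain ⟨c, b, hc, hb, hv0, h⟩ := hs.exists_blowup hp hκ hxy
    have hv0' : v ≠ 0 := by rintro rfl; simp at hv0
    refine ⟨⟨⟨⟨y, x / y ^ p - algebraMap κ F c⟩, v, u / v ^ p - algebraMap κ K b⟩,
      (hxy.div_left p).sub_algebraMap c, ?_⟩, c, b, hc, hb, rfl, rfl, ?_, ?_⟩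
    · simpa [← IsScalarTower.algebraMap_apply] using h
    · have := hxy.ne_zero_right
      simp only
      field_simp
      ring
    · simp only
      field_simp
      ring
  choose nx c b hc hb h1 h2 h3 h4 using step
  let S : ℕ → T := fun n => Nat.rec ⟨⟨⟨x, y⟩, u, v⟩, hxy, .of_eq hxy.indep hu hv⟩ (fun _ s => nx s) n
  have hS : ∀ n, S (n + 1) = nx (S n) := fun n => rfl
  have e1 : ∀ n, (S (n + 1)).1.1.1 = (S n).1.1.2 := fun n => by rw [hS, h1]
  have e2 : ∀ n, (S (n + 1)).1.2.1 = (S n).1.2.2 := fun n => by rw [hS, h2]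
  refine ⟨fun n => (S n).1.1.1, fun n => (S n).1.2.1, fun n => c (S n), fun n => b (S n),
    ⟨?_, fun n => hc _, fun n => ?_⟩, ⟨?_, fun n => hb _, fun n => ?_⟩, rfl, e1 0, rfl, e2 0, fun n => ?_⟩
  · change IsCoord κ (S 0).1.1.1 (S (0 + 1)).1.1.1
    rw [e1]; exact hxy
  · change (S n).1.1.1 = (S (n + 1)).1.1.1 ^ p * ((S (n + 1 + 1)).1.1.1 + _)
    rw [e1 (n + 1), e1 n, hS]; exact h3 _
  · change IsCoord κ (S 0).1.2.1 (S (0 + 1)).1.2.1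
    rw [e2]; exact huv
  · change (S n).1.2.1 = (S (n + 1)).1.2.1 ^ p * ((S (n + 1 + 1)).1.2.1 + _)
    rw [e2 (n + 1), e2 n, hS]; exact h4 _
  · change IsStableForm κ p (S n).1.1.1 (S (n + 1)).1.1.1 (algebraMap K F (S n).1.2.1)
      (algebraMap K F (S (n + 1)).1.2.1)
    rw [e1, e2]; exact (S n).2.2

end StableForm

end

/-! ### Parameters, monomials, and monomial pairs. -/

section

open IsLocalRing

namespace IsParamPair

variable {R : Type*} [CommRing R] [IsLocalRing R] {x y : R}

theorem left_mem (h : IsParamPair x y) : x ∈ maximalIdeal R :=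
  h.maximalIdeal_eq ▸ Ideal.subset_span (by simp)

theorem right_mem (h : IsParamPair x y) : y ∈ maximalIdeal R :=
  h.maximalIdeal_eq ▸ Ideal.subset_span (by simp)

theorem not_associated (h : IsParamPair x y) : ¬ Associated x y := fun h' => h.not_dvd h'.dvd

theorem mem_maximalIdeal_of_dvd_mul (h : IsParamPair x y) {w : R} (hw : x ∣ y * w) : w ∈ maximalIdeal R :=
  Ideal.mem_of_dvd _ ((h.prime_left.dvd_or_dvd hw).resolve_left h.not_dvd) h.left_mem

theorem exists_eq_of_mem (h : IsParamPair x y) {f : R} (hf : f ∈ maximalIdeal R) : ∃ a b, f = a * x + b * y := by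
  rw [h.maximalIdeal_eq, Ideal.mem_span_pair] at hf
  obtain ⟨a, b, e⟩ := hf
  exact ⟨a, b, e.symm⟩

theorem _root_.IsLocalRing.isUnit_add_of_mem {a b : R} (ha : IsUnit a) (hb : b ∈ maximalIdeal R) : IsUnit (a + b) := by
  by_contra h
  have h1 : a + b ∈ maximalIdeal R := h
  have h2 := sub_mem h1 hb
  rw [add_sub_cancel_right] at h2
  exact h2 ha

/-- One of two parameters involves `y` linearly. -/
theorem exists_isUnit_right (h : IsParamPair x y) {f g : R} (hfg : IsParamPair f g) :
    (∃ a b, IsUnit b ∧ f = a * x + b * y) ∨ ∃ a b, IsUnit b ∧ g = a * x + b * y := by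
  obtain ⟨a, b, e⟩ := h.exists_eq_of_mem hfg.left_mem
  obtain ⟨c, d, e'⟩ := h.exists_eq_of_mem hfg.right_mem
  by_cases hb : IsUnit b
  · exact Or.inl ⟨a, b, hb, e⟩
  by_cases hd : IsUnit d
  · exact Or.inr ⟨c, d, hd, e'⟩
  exfalso
  obtain ⟨α, β, e''⟩ := hfg.exists_eq_of_mem h.right_mem
  have h1 : IsUnit (1 + -(α * b + β * d)) := by
    refine IsLocalRing.isUnit_add_of_mem isUnit_one (neg_mem (add_mem ?_ ?_))
    · exact Ideal.mul_mem_left _ _ hb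
    · exact Ideal.mul_mem_left _ _ hd
  refine h.not_dvd (h1.dvd_mul_right.mp ⟨α * a + β * c, ?_⟩)
  rw [e, e'] at e''
  linear_combination e''

variable [IsDomain R]

theorem associated_left [IsNoetherianRing R] (h : IsParamPair x y) {x' : R} (hx : Associated x x') :
    IsParamPair x' y := by
  refine h.of_span_eq ?_
  rw [h.maximalIdeal_eq, Ideal.span_insert, Ideal.span_insert, Ideal.span_singleton_eq_span_singleton.mpr hx]

theorem add_mul_right [IsNoetherianRing R] (h : IsParamPair x y) (a : R) {b : R} (hb : IsUnit b) :
    IsParamPair x (a * x + b * y) := by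
  refine h.of_span_eq ?_
  rw [h.maximalIdeal_eq]
  obtain ⟨b', hb'⟩ := hb.exists_left_inv
  apply le_antisymm <;> rw [Ideal.span_le, Set.insert_subset_iff, Set.singleton_subset_iff]
  · exact ⟨Ideal.subset_span (by simp), Ideal.mem_span_pair.mpr ⟨-b' * a, b', by linear_combination y * hb'⟩⟩
  · exact ⟨Ideal.subset_span (by simp), Ideal.mem_span_pair.mpr ⟨a, b, rfl⟩⟩

theorem isUnit_coeff (h : IsParamPair x y) {f c d : R} (hf : IsParamPair y f) (e : f = c * x + d * y) : IsUnit c := by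
  by_contra hc
  obtain ⟨α, β, e'⟩ := hf.exists_eq_of_mem h.left_mem
  have h1 : IsUnit (1 + -(β * c)) :=
    IsLocalRing.isUnit_add_of_mem isUnit_one (neg_mem (Ideal.mul_mem_left _ _ hc))
  refine h.not_dvd' (h1.dvd_mul_right.mp ⟨α + β * d, ?_⟩)
  rw [e] at e'
  linear_combination e'

/-- A parameter complementary to `y`, expanded in powers of `y` up to a given order. -/
theorem exists_eq_add_pow [IsNoetherianRing R] (h : IsParamPair x y) {f : R} (hf : IsParamPair y f) {e : ℕ}
    (he : 0 < e) : ∃ c d s, IsUnit c ∧ 0 < s ∧ s ≤ e ∧ (s < e → IsUnit d) ∧ f = c * x + d * y ^ s := by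
  rcases mem_span_or_exists_eq_add_unit_mul_pow h.maximalIdeal_eq f with ⟨r, hr⟩ | ⟨r, w, s, hw, hr⟩
  · exact ⟨r, 0, e, h.isUnit_coeff hf (d := 0) (by rw [hr]; ring), he, le_rfl, fun h => absurd h (lt_irrefl _),
      by rw [hr]; ring⟩
  · have hs : 0 < s := by
      rw [Nat.pos_iff_ne_zero]
      rintro rfl
      have : w ∈ maximalIdeal R := by
        rw [show w = f - x * r by rw [hr]; ring]
        exact sub_mem hf.right_mem (Ideal.mul_mem_right _ _ h.left_mem)
      exact this hw
    have hr' : IsUnit r := h.isUnit_coeff hf (d := w * y ^ (s - 1)) (by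
      rw [hr]; conv_lhs => rw [← Nat.sub_add_cancel hs]
      ring)
    by_cases hse : s ≤ e
    · exact ⟨r, w, s, hr', hs, hse, fun _ => hw, by rw [hr]; ring⟩
    · refine ⟨r, w * y ^ (s - e), e, hr', he, le_rfl, fun h => absurd h (lt_irrefl _), ?_⟩
      rw [hr, mul_assoc, ← pow_add, Nat.sub_add_cancel (by omega)]; ring

theorem not_prime_dvd_of_dvd (h : IsParamPair x y) {a b q : R} (ha : IsUnit a) (hb : IsUnit b) {e : ℕ}
    (he : 0 < e) (hq : Prime q) (hd : q ∣ a * y ^ e + b * x) : ¬ q ∣ x ∧ ¬ q ∣ y := by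
  have key : ¬ (q ∣ x ∧ q ∣ y) := fun ⟨h1, h2⟩ =>
    h.not_dvd ((h.prime_left.dvd_of_not_unit_dvd hq.not_isUnit h1).trans h2)
  constructor
  · intro hx
    refine key ⟨hx, ?_⟩
    rw [dvd_add_left (hx.mul_left b), ha.dvd_mul_left] at hd
    exact hq.dvd_of_dvd_pow hd
  · intro hy
    refine key ⟨?_, hy⟩
    rwa [dvd_add_right ((dvd_pow hy he.ne').mul_left a), hb.dvd_mul_left] at hd

theorem prime_add (h : IsParamPair x y) [IsNoetherianRing R] {a b : R} (hb : IsUnit b) {e : ℕ} (he : 0 < e) :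
    IsParamPair (a * y ^ e + b * x) y := by
  have := (h.symm.add_mul_right (a * y ^ (e - 1)) hb).symm
  rwa [mul_assoc, ← pow_succ, Nat.sub_add_cancel he] at this

end IsParamPair

/-- `f` is a monomial in `x` and `y`, up to a unit. -/
def IsMonomialIn {R : Type*} [CommMonoid R] (x y f : R) : Prop := ∃ a b, Associated f (x ^ a * y ^ b)

namespace IsMonomialIn

variable {R : Type*} [CommRing R] {x y f q : R}

theorem symm (h : IsMonomialIn x y f) : IsMonomialIn y x f := by
  obtain ⟨a, b, h⟩ := h
  exact ⟨b, a, mul_comm (x ^ a) _ ▸ h⟩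

theorem congr_left {x' : R} (hx : Associated x x') (h : IsMonomialIn x y f) : IsMonomialIn x' y f := by
  obtain ⟨a, b, h⟩ := h
  exact ⟨a, b, h.trans ((hx.pow_pow).mul_mul .rfl)⟩

theorem associated_pow (h : IsMonomialIn x y f) (hx : ¬ x ∣ f) : ∃ b, Associated f (y ^ b) := by
  obtain ⟨a, b, h⟩ := h
  rcases Nat.eq_zero_or_pos a with rfl | ha
  · exact ⟨b, by simpa using h⟩
  · exact absurd (((dvd_pow_self x ha.ne').mul_right _).trans h.symm.dvd) hx

variable [IsDomain R]

theorem associated_of_prime_dvd (h : IsMonomialIn x y f) (hx : Prime x) (hy : Prime y) (hq : Prime q) (hd : q ∣ f) :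
    Associated q x ∨ Associated q y := by
  obtain ⟨a, b, h⟩ := h
  rcases hq.dvd_or_dvd (hd.trans h.dvd) with h1 | h1
  · exact Or.inl ((hq.dvd_prime_iff_associated hx).mp (hq.dvd_of_dvd_pow h1))
  · exact Or.inr ((hq.dvd_prime_iff_associated hy).mp (hq.dvd_of_dvd_pow h1))

theorem exponents_eq (hx : Prime x) (hy : Prime y) (hxy : ¬ Associated x y) {a b a' b' : ℕ}
    (h : Associated (x ^ a * y ^ b) (x ^ a' * y ^ b')) : a = a' ∧ b = b' := by
  have key : ∀ {x y : R} (hx : Prime x) (hy : Prime y) (hxy : ¬ Associated x y) {a b a' b' : ℕ}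
      (h : x ^ a * y ^ b ∣ x ^ a' * y ^ b'), a ≤ a' := by
    intro x y hx hy hxy a b a' b' h
    have h1 : ¬ x ∣ y ^ b' := fun h => hxy ((hx.dvd_prime_iff_associated hy).mp (hx.dvd_of_dvd_pow h))
    have h2 := hx.pow_dvd_of_dvd_mul_right a h1 ((dvd_mul_right _ _).trans h)
    exact (pow_dvd_pow_iff hx.ne_zero hx.not_isUnit).mp h2
  have hxy' : ¬ Associated y x := fun h => hxy h.symm
  have h' := h
  rw [mul_comm (x ^ a), mul_comm (x ^ a')] at h'
  exact ⟨le_antisymm (key hx hy hxy h.dvd) (key hx hy hxy h.symm.dvd),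
    le_antisymm (key hy hx hxy' h'.dvd) (key hy hx hxy' h'.symm.dvd)⟩

end IsMonomialIn

/-- `f` and `g` are monomials in some parameters, with multiplicatively independent exponents. -/
def IsMonomialPair {R : Type*} [CommRing R] [IsLocalRing R] (f g : R) : Prop :=
  ∃ x y : R, IsParamPair x y ∧ IsMonomialIn x y f ∧ IsMonomialIn x y g ∧
    ∀ m n : ℕ, Associated (f ^ m) (g ^ n) → m = 0 ∧ n = 0

namespace IsMonomialPair

variable {R : Type*} [CommRing R] [IsLocalRing R] {f g : R}

theorem symm (h : IsMonomialPair f g) : IsMonomialPair g f := by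
  obtain ⟨x, y, h, hf, hg, hind⟩ := h
  exact ⟨x, y, h, hg, hf, fun m n h => (hind n m h.symm).symm⟩

variable [IsDomain R]

theorem exists_isParamPair [IsNoetherianRing R] (h : IsMonomialPair f g) {q : R} (hq : Prime q) (hd : q ∣ f) :
    ∃ z, IsParamPair q z ∧ IsMonomialIn q z f ∧ IsMonomialIn q z g := by
  obtain ⟨x, y, h, hf, hg, -⟩ := h
  rcases hf.associated_of_prime_dvd h.prime_left h.prime_right hq hd with h1 | h1
  · exact ⟨y, h.associated_left h1.symm, hf.congr_left h1.symm, hg.congr_left h1.symm⟩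
  · exact ⟨x, h.symm.associated_left h1.symm, hf.symm.congr_left h1.symm, hg.symm.congr_left h1.symm⟩

theorem isMonomialIn_of_prime_dvd [IsNoetherianRing R] (h : IsMonomialPair f g) {q r : R} (hq : Prime q) (hqf : q ∣ f)
    (hr : Prime r) (hrf : r ∣ f) (hqr : ¬ Associated q r) : IsMonomialIn q r f ∧ IsMonomialIn q r g := by
  obtain ⟨z, hz, hf, hg⟩ := h.exists_isParamPair hq hqf
  rcases hf.associated_of_prime_dvd hz.prime_left hz.prime_right hr hrf with h1 | h1
  · exact absurd h1.symm hqr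
  · exact ⟨(hf.symm.congr_left h1.symm).symm, (hg.symm.congr_left h1.symm).symm⟩

/-- An association of f₀^m with f₁^n equates exponents in a factorial sense, which is a linear
dependence between the rows of the matrix unless m = n = 0. -/
theorem of_matrix {x : Fin 2 → R} (hx : IsParamPair (x 0) (x 1)) (δ : Fin 2 → Rˣ) (a : Matrix (Fin 2) (Fin 2) ℕ)
    (hdet : (a.map (fun m : ℕ => (m : ℤ))).det ≠ 0) {f : Fin 2 → R} (hf : ∀ i, f i = δ i * ∏ j, x j ^ a i j) :
    IsMonomialPair (f 0) (f 1) := by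
  have h : ∀ i, Associated (f i) (x 0 ^ a i 0 * x 1 ^ a i 1) := by
    intro i
    rw [hf, Fin.prod_univ_two]
    exact associated_unit_mul_left _ _ (δ i).isUnit
  refine ⟨x 0, x 1, hx, ⟨_, _, h 0⟩, ⟨_, _, h 1⟩, fun m n hmn => ?_⟩
  have h1 := ((h 0).pow_pow (n := m)).symm.trans (hmn.trans ((h 1).pow_pow (n := n)))
  rw [mul_pow, mul_pow, ← pow_mul, ← pow_mul, ← pow_mul, ← pow_mul] at h1
  obtain ⟨h2, h3⟩ := IsMonomialIn.exponents_eq hx.prime_left hx.prime_right hx.not_associated h1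
  rw [Matrix.det_fin_two] at hdet
  simp only [Matrix.map_apply] at hdet
  zify at h2 h3
  constructor <;> by_contra hne <;> apply hdet
  · have : (m : ℤ) ≠ 0 := by exact_mod_cast hne
    apply mul_left_cancel₀ this
    linear_combination h2 * a 1 1 - h3 * a 1 0
  · have : (n : ℤ) ≠ 0 := by exact_mod_cast hne
    apply mul_left_cancel₀ this
    linear_combination h2 * a 0 1 - h3 * a 0 0

end IsMonomialPair

end

/-! ### Local obstructions to monomiality. -/

section

open IsLocalRing

namespace IsParamPair

variable {R : Type*} [CommRing R] [IsDomain R] [IsLocalRing R] [IsNoetherianRing R] {X Y : R}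

theorem exists_prime_dvd_add (h : IsParamPair X Y) {a b : R} (ha : IsUnit a) (hb : IsUnit b) {e : ℕ}
    (he : 0 < e) : ∃ q, Prime q ∧ q ∣ a * Y ^ e + b * X ∧ ¬ q ∣ X ∧ ¬ q ∣ Y := by
  have := uniqueFactorizationMonoid_of_maximalIdeal_eq_span_pair h.maximalIdeal_eq h.prime_left
  have hprime := (h.prime_add (a := a) hb he).prime_left
  exact ⟨_, hprime, dvd_rfl, h.not_prime_dvd_of_dvd ha hb he hprime dvd_rfl⟩

theorem not_add_dvd (h : IsParamPair X Y) {a b : R} (ha : IsUnit a) (hb : IsUnit b) {e : ℕ}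
    (he : 0 < e) {g : R} (hg : IsUnit g) (m n : ℕ) : ¬ a * Y ^ e + b * X ∣ g * (X ^ m * Y ^ n) := by
  obtain ⟨q, hq, hd, hqX, hqY⟩ := h.exists_prime_dvd_add ha hb he
  intro hdvd
  have := hd.trans hdvd
  rw [hg.dvd_mul_left] at this
  rcases hq.dvd_or_dvd this with h1 | h1
  · exact hqX (hq.dvd_of_dvd_pow h1)
  · exact hqY (hq.dvd_of_dvd_pow h1)

/-- Here f = Y^l Z with Z = τ Y^(p-l) + σ X, and a prime factor q of Z other than X and Y. Since q
and Y both divide f, the pair is monomial in q and Y; since q does not divide g, g is a power of Y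
up to a unit. Dividing g by Y^(ls) and reading the quotient modulo Y excludes s < p. For s = p,
Frobenius reduces the quotient to X^p (cγ + dσ^p) modulo Y². -/
theorem mem_span_of_isMonomialPair_of_pos {p : ℕ} (hp : p.Prime) [CharP R p] (h : IsParamPair X Y)
    {γ τ σ c d : R} (hγ : IsUnit γ) (hτ : IsUnit τ) (hσ : IsUnit σ) (hc : IsUnit c) {l s : ℕ} (hl0 : 0 < l) (hl : l < p)
    (hs : 0 < s) (hsp : s ≤ p) (hd : s < p → IsUnit d) {f g : R} (hf : f = τ * Y ^ p + σ * (X * Y ^ l))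
    (hg : g = c * (γ * (X * Y ^ l) ^ p) + d * f ^ s) (hm : IsMonomialPair f g) :
    c * γ + d * σ ^ p ∈ Ideal.span {X, Y ^ 2} := by
  have : Fact p.Prime := ⟨hp⟩
  have hX := h.prime_left
  have hY := h.prime_right
  have hp2 := hp.two_le
  obtain ⟨q, hq, hqd, hqX, hqY⟩ := h.exists_prime_dvd_add hτ hσ (e := p - l) (by omega)
  set Z := τ * Y ^ (p - l) + σ * X with hZ
  have hfZ : f = Y ^ l * Z := by
    have : Y ^ p = Y ^ (p - l) * Y ^ l := by rw [← pow_add, Nat.sub_add_cancel hl.le]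
    rw [hf, hZ, this]; ring
  have hqf : q ∣ f := hfZ ▸ hqd.mul_left _
  have hYf : Y ∣ f := hfZ ▸ (dvd_pow_self Y hl0.ne').mul_right _
  have hgm := (hm.isMonomialIn_of_prime_dvd hq hqf hY hYf fun h => hqY h.dvd).2
  have hqg : ¬ q ∣ g := by
    rw [hg, dvd_add_left ((dvd_pow hqf hs.ne').mul_left _), hc.dvd_mul_left, hγ.dvd_mul_left]
    intro h1
    rcases hq.dvd_or_dvd (hq.dvd_of_dvd_pow h1) with h1 | h1
    · exact hqX h1
    · exact hqY (hq.dvd_of_dvd_pow h1)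
  obtain ⟨a, ha⟩ := hgm.associated_pow hqg
  set H := c * γ * X ^ p * Y ^ (l * (p - s)) + d * Z ^ s with hH
  have hgH : g = Y ^ (l * s) * H := by
    have : Y ^ (l * p) = Y ^ (l * (p - s)) * Y ^ (l * s) := by
      rw [← pow_add, ← mul_add, Nat.sub_add_cancel hsp]
    rw [hg, hH, hfZ, mul_pow, mul_pow, ← pow_mul, this, ← pow_mul]; ring
  obtain ⟨i, -, hi⟩ := (dvd_prime_pow hY a).mp ((hgH ▸ dvd_mul_left H _).trans ha.dvd)
  have hZm : Z ∈ maximalIdeal R :=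
    add_mem (Ideal.mul_mem_left _ _ (Ideal.pow_mem_of_mem _ h.right_mem _ (by omega)))
      (Ideal.mul_mem_left _ _ h.left_mem)
  have hHm : H ∈ maximalIdeal R :=
    add_mem (Ideal.mul_mem_right _ _ (Ideal.mul_mem_left _ _ (Ideal.pow_mem_of_mem _ h.left_mem _ (by omega))))
      (Ideal.mul_mem_left _ _ (Ideal.pow_mem_of_mem _ hZm _ hs))
  have hi0 : i ≠ 0 := by
    rintro rfl
    rw [pow_zero, associated_one_iff_isUnit] at hi
    exact hHm hi
  have hYH : Y ∣ H := (dvd_pow_self Y hi0).trans hi.symm.dvd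
  have hYX : ¬ Y ∣ X ^ p := fun h1 => h.not_dvd' (hY.dvd_of_dvd_pow h1)
  rcases hsp.lt_or_eq with hlt | rfl
  · exfalso
    have hpos : l * (p - s) ≠ 0 := (Nat.mul_pos hl0 (by omega)).ne'
    rw [hH, dvd_add_right ((dvd_pow_self Y hpos).mul_left _), (hd hlt).dvd_mul_left] at hYH
    have h1 := hY.dvd_of_dvd_pow hYH
    rw [hZ, dvd_add_right ((dvd_pow_self Y (by omega)).mul_left _), hσ.dvd_mul_left] at h1
    exact h.not_dvd' h1
  · set E := c * γ + d * σ ^ s with hE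
    -- The power of Y in the Frobenius expansion of Z^p; it is at least Y² because l < p and p ≥ 2.
    obtain ⟨k, hk⟩ : ∃ k, (s - l) * s = k + 2 :=
      ⟨(s - l) * s - 2, by have := Nat.mul_le_mul (show 1 ≤ s - l by omega) hp2; omega⟩
    have hHE : H = X ^ s * E + Y ^ 2 * (d * τ ^ s * Y ^ k) := by
      rw [hH, hZ, add_pow_char, hE, Nat.sub_self, mul_zero, pow_zero, mul_pow, ← pow_mul, hk, pow_add]
      ring
    have hYE : Y ∣ E := by
      rw [hHE, dvd_add_left (((dvd_pow_self Y two_ne_zero)).mul_right _)] at hYH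
      exact (hY.dvd_or_dvd hYH).resolve_left hYX
    obtain ⟨i, rfl⟩ := Nat.exists_eq_succ_of_ne_zero hi0
    -- If H were exactly divisible by Y once, H / Y would be a unit, yet it lies in the maximal
    -- ideal.
    rcases Nat.eq_zero_or_pos i with rfl | hipos
    · exfalso
      obtain ⟨E', hE'⟩ := hYE
      rw [hHE, hE', show X ^ s * (Y * E') + Y ^ 2 * (d * τ ^ s * Y ^ k) =
        Y * (X ^ s * E' + Y * (d * τ ^ s * Y ^ k)) by ring, Nat.succ_eq_add_one, zero_add, pow_one] at hi
      obtain ⟨w, hw⟩ := hi.symm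
      have hw' := mul_left_cancel₀ hY.ne_zero hw
      have : (w : R) ∈ maximalIdeal R := by
        rw [hw']
        exact add_mem (Ideal.mul_mem_right _ _ (Ideal.pow_mem_of_mem _ h.left_mem _ (by omega)))
          (Ideal.mul_mem_right _ _ h.right_mem)
      exact this w.isUnit
    · have h2 : Y ^ 2 ∣ H := (pow_dvd_pow Y (by omega)).trans hi.symm.dvd
      rw [hHE, dvd_add_left (dvd_mul_right _ _)] at h2
      exact Ideal.mem_of_dvd _ (hY.pow_dvd_of_dvd_mul_left 2 hYX h2) (Ideal.subset_span (by simp))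

/-- Now f itself is a parameter not dividing g, so g is a unit times Z^m for a parameter Z
complementary to f. Comparing modulo X gives m ≥ ps, comparing modulo Y then excludes s < p. For s =
p the power Z^m contains Z^(p²), which is additive in aX + bY and hence a multiple of X^(p²) modulo
Y². -/
theorem mem_span_of_isMonomialPair_of_zero {p : ℕ} (hp : p.Prime) [CharP R p] (h : IsParamPair X Y)
    {γ τ σ c d : R} (hγ : IsUnit γ) (hτ : IsUnit τ) (hσ : IsUnit σ) (hc : IsUnit c) {s : ℕ}
    (hs : 0 < s) (hsp : s ≤ p) (hd : s < p → IsUnit d) {f g : R} (hf : f = τ * Y ^ p + σ * X)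
    (hg : g = c * (γ * X ^ p) + d * f ^ s) (hm : IsMonomialPair f g) :
    c * γ + d * σ ^ p ∈ Ideal.span {X, Y ^ 2} := by
  have : Fact p.Prime := ⟨hp⟩
  have hX := h.prime_left
  have hY := h.prime_right
  have hp2 := hp.two_le
  have hfY : IsParamPair f Y := hf ▸ h.prime_add hσ hp.pos
  obtain ⟨Z, hZ, -, hgm⟩ := hm.exists_isParamPair hfY.prime_left dvd_rfl
  have hXf : ¬ X ∣ f := by
    rw [hf, dvd_add_left (dvd_mul_left _ _), hτ.dvd_mul_left]
    exact fun h1 => h.not_dvd (hX.dvd_of_dvd_pow h1)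
  have hfg : ¬ f ∣ g := by
    rw [hg, dvd_add_left ((dvd_pow_self f hs.ne').mul_left _), hc.dvd_mul_left, hγ.dvd_mul_left]
    exact fun h1 => hXf (hX.dvd_of_not_unit_dvd hfY.prime_left.not_isUnit (hfY.prime_left.dvd_of_dvd_pow h1))
  obtain ⟨m, hgm⟩ := hgm.associated_pow hfg
  obtain ⟨ε, hε⟩ := hgm.symm
  -- Modulo X the parameter f is τ Y^p, without linear term, so Z must supply Y.
  obtain ⟨a, b, hb, hab⟩ : ∃ a b, IsUnit b ∧ Z = a * X + b * Y := by
    refine (h.exists_isUnit_right hZ).resolve_left ?_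
    rintro ⟨a, b, hb, e⟩
    have h1 : X ∣ Y * (b + -(τ * Y ^ (p - 1))) := ⟨σ - a, by
      have : Y ^ p = Y ^ (p - 1) * Y := by rw [← pow_succ, Nat.sub_add_cancel hp.one_le]
      rw [hf, this] at e
      linear_combination -e⟩
    exact h.mem_maximalIdeal_of_dvd_mul h1 (isUnit_add_of_mem hb (neg_mem (Ideal.mul_mem_left _ _
      (Ideal.pow_mem_of_mem _ h.right_mem _ (by omega)))))
  -- Modulo X the equation between g and Z^m compares d τ^s Y^(ps) with a unit times Y^m.
  have hpm : p * s ≤ m := by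
    by_contra hlt
    push Not at hlt
    have h1 : X ∣ f ^ s - (τ * Y ^ p) ^ s := (Dvd.intro_left σ (by rw [hf]; ring)).trans (sub_dvd_pow_sub_pow _ _ s)
    have h2 : X ∣ Z ^ m - (b * Y) ^ m := (Dvd.intro_left a (by rw [hab]; ring)).trans (sub_dvd_pow_sub_pow _ _ m)
    obtain ⟨r1, h1⟩ := h1
    obtain ⟨r2, h2⟩ := h2
    have h3 : X ∣ Y ^ m * (b ^ m * ε + -(d * τ ^ s * Y ^ (p * s - m))) := by
      have : Y ^ (p * s) = Y ^ m * Y ^ (p * s - m) := by rw [← pow_add, Nat.add_sub_cancel' hlt.le]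
      obtain ⟨n, rfl⟩ : ∃ n, p = n + 1 := ⟨p - 1, by omega⟩
      refine ⟨c * γ * X ^ n + d * r1 - r2 * ε, ?_⟩
      rw [mul_pow, ← pow_mul, this] at h1
      rw [mul_pow] at h2
      rw [hg] at hε
      linear_combination -h2 * ε + hε + d * h1
    rcases hX.dvd_or_dvd h3 with h4 | h4
    · exact h.not_dvd (hX.dvd_of_dvd_pow h4)
    · exact Ideal.mem_of_dvd _ h4 h.left_mem (isUnit_add_of_mem ((hb.pow m).mul ε.isUnit)
        (neg_mem (Ideal.mul_mem_left _ _ (Ideal.pow_mem_of_mem _ h.right_mem _ (by omega)))))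
  rcases hsp.lt_or_eq with hlt | rfl
  · exfalso
    -- Modulo Y, g has order exactly s in X, while Z^m has order at least m ≥ ps > s.
    have h1 : Y ∣ f ^ s - (σ * X) ^ s := by
      refine Dvd.dvd.trans ?_ (sub_dvd_pow_sub_pow _ _ s)
      rw [hf, add_sub_cancel_right]
      exact (dvd_pow_self Y hp.ne_zero).mul_left _
    have h2 : Y ∣ Z ^ m - (a * X) ^ m := (Dvd.intro_left b (by rw [hab]; ring)).trans (sub_dvd_pow_sub_pow _ _ m)
    obtain ⟨r1, h1⟩ := h1
    obtain ⟨r2, h2⟩ := h2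
    have hms : s < m := by nlinarith
    have h3 : Y ∣ X ^ s * (d * σ ^ s + (c * γ * X ^ (p - s) + -(ε * a ^ m * X ^ (m - s)))) := by
      have e1 : X ^ p = X ^ s * X ^ (p - s) := by rw [← pow_add, Nat.add_sub_cancel' hlt.le]
      have e2 : X ^ m = X ^ s * X ^ (m - s) := by rw [← pow_add, Nat.add_sub_cancel' hms.le]
      refine ⟨r2 * ε - d * r1, ?_⟩
      rw [mul_pow] at h1
      rw [mul_pow, e2] at h2
      rw [hg, e1] at hε
      linear_combination h2 * ε - hε - d * h1
    rcases hY.dvd_or_dvd h3 with h4 | h4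
    · exact h.not_dvd' (hY.dvd_of_dvd_pow h4)
    · exact Ideal.mem_of_dvd _ h4 h.right_mem (isUnit_add_of_mem ((hd hlt).mul (hσ.pow s)) (add_mem
        (Ideal.mul_mem_left _ _ (Ideal.pow_mem_of_mem _ h.left_mem _ (by omega)))
        (neg_mem (Ideal.mul_mem_left _ _ (Ideal.pow_mem_of_mem _ h.left_mem _ (by omega))))))
  · have e1 : Z ^ m = (a ^ (s * s) * X ^ (s * s) + b ^ (s * s) * Y ^ (s * s)) * Z ^ (m - s * s) := by
      rw [← mul_pow, ← mul_pow, pow_mul, pow_mul, ← add_pow_char, ← add_pow_char, ← hab, ← pow_mul, ← pow_add,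
        Nat.add_sub_cancel' hpm]
    obtain ⟨n, hn⟩ : ∃ n, s * s = n + (s + 1) := ⟨s * s - (s + 1), by
      have := Nat.mul_le_mul_right s hp2; omega⟩
    obtain ⟨n', hn'⟩ : ∃ n', s * s = n' + 2 := ⟨n + s - 1, by omega⟩
    have hYE : Y ^ 2 ∣ X ^ s * (c * γ + d * σ ^ s - X * (a ^ (s * s) * X ^ n * Z ^ (m - s * s) * ε)) := by
      refine ⟨b ^ (s * s) * Y ^ n' * Z ^ (m - s * s) * ε - d * τ ^ s * Y ^ n', ?_⟩
      have e2 : X ^ (s * s) = X ^ n * (X ^ s * X) := by rw [hn, pow_add, pow_succ]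
      have e3 : Y ^ (s * s) = Y ^ n' * Y ^ 2 := by rw [hn', pow_add]
      have e4 : f ^ s = τ ^ s * Y ^ (s * s) + σ ^ s * X ^ s := by
        rw [hf, add_pow_char, mul_pow, mul_pow, ← pow_mul]
      rw [e1, hg, e4, e2, e3] at hε
      linear_combination -hε
    have h1 := hY.pow_dvd_of_dvd_mul_left 2 (fun h1 => h.not_dvd' (hY.dvd_of_dvd_pow h1)) hYE
    obtain ⟨r, hr⟩ := h1
    exact Ideal.mem_span_pair.mpr ⟨a ^ (s * s) * X ^ n * Z ^ (m - s * s) * ε, r, by linear_combination -hr⟩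

theorem mem_span_of_isMonomialPair {p : ℕ} (hp : p.Prime) [CharP R p] (h : IsParamPair X Y)
    {γ τ σ c d : R} (hγ : IsUnit γ) (hτ : IsUnit τ) (hσ : IsUnit σ) (hc : IsUnit c) {l s : ℕ} (hl : l < p)
    (hs : 0 < s) (hsp : s ≤ p) (hd : s < p → IsUnit d) {f g : R} (hf : f = τ * Y ^ p + σ * (X * Y ^ l))
    (hg : g = c * (γ * (X * Y ^ l) ^ p) + d * f ^ s) (hm : IsMonomialPair f g) :
    c * γ + d * σ ^ p ∈ Ideal.span {X, Y ^ 2} := by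
  rcases Nat.eq_zero_or_pos l with rfl | hl0
  · rw [pow_zero, mul_one] at hf hg
    exact h.mem_span_of_isMonomialPair_of_zero hp hγ hτ hσ hc hs hsp hd hf hg hm
  · exact h.mem_span_of_isMonomialPair_of_pos hp hγ hτ hσ hc hl0 hl hs hsp hd hf hg hm

/-- In the stable form, with the source not blown up, no parameters of the source become monomials. -/
theorem not_isMonomialPair_of_stable {p : ℕ} (hp : p.Prime) [CharP R p] {κ A : Type*} [Field κ] [CommRing A]
    [IsDomain A] [IsLocalRing A] [IsNoetherianRing A] (φ : A →+* R) (ψ : κ →+* A)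
    (hA : ∀ a : A, ∃ c, a - ψ c ∈ maximalIdeal A) (hR : ∀ r : R, ∃ c, r - φ (ψ c) ∈ maximalIdeal R)
    (h : IsParamPair X Y) {u v : A} (huv : IsParamPair u v) {γ τ σ : R} (hγ : IsUnit γ) (hτ : IsUnit τ)
    (hσ : IsUnit σ) {l : ℕ} (hl : l < p) (hu : φ u = γ * (X * Y ^ l) ^ p) (hv : φ v = τ * Y ^ p + σ * (X * Y ^ l))
    {γ₀ γ₁ : κ} (hγ₁ : γ₁ ≠ 0) (hγ' : γ - (φ (ψ γ₀) + φ (ψ γ₁) * Y) ∈ Ideal.span {X, Y ^ 2})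
    {a b f g : A} (hb : IsUnit b) (hf : f = a * u + b * v) (hfg : IsParamPair f g) :
    ¬ IsMonomialPair (φ f) (φ g) := by
  intro hm
  have : Fact p.Prime := ⟨hp⟩
  set J := Ideal.span {X, Y ^ 2} with hJ
  have hXJ : X ∈ J := Ideal.subset_span (by simp)
  have hYJ : Y ^ 2 ∈ J := Ideal.subset_span (by simp)
  have hJm : J ≤ maximalIdeal R := by
    rw [hJ, Ideal.span_le, Set.insert_subset_iff, Set.singleton_subset_iff]
    exact ⟨h.left_mem, Ideal.pow_mem_of_mem _ h.right_mem _ two_pos⟩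
  obtain ⟨k, rfl⟩ : ∃ k, p = k + 2 := ⟨p - 2, by have := hp.two_le; omega⟩
  have huf : IsParamPair u f := hf ▸ huv.add_mul_right a hb
  obtain ⟨c, d, s, hc, hs, hsp, hd, hg⟩ := huf.exists_eq_add_pow hfg hp.pos
  have hb' := hb.map φ
  -- The image of f = a u + b v has the shape of v again, with σ replaced by this unit: the
  -- contribution of u is a multiple of X Y^l.
  have hσ' : IsUnit (φ b * σ + φ a * γ * (X * Y ^ l) ^ (k + 1)) :=
    isUnit_add_of_mem (hb'.mul hσ) (Ideal.mul_mem_left _ _ (Ideal.pow_mem_of_mem _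
      (Ideal.mul_mem_right _ _ h.left_mem) _ (by omega)))
  set σ' := φ b * σ + φ a * γ * (X * Y ^ l) ^ (k + 1) with eσ'
  have h1 := h.mem_span_of_isMonomialPair hp hγ (hb'.mul hτ) hσ' (hc.map φ) hl hs hsp (fun hlt => (hd hlt).map φ)
    (f := φ f) (g := φ g) (d := φ d) (by rw [hf, map_add, map_mul, map_mul, hu, hv, eσ']; ring)
    (by rw [hg, map_add, map_mul, map_mul, map_pow, hu]) hm
  -- The images of u and v lie in (X, Y^p), so elements of A are constants modulo J. This is the
  -- reason for working modulo (X, Y²).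
  have hφm : ∀ a ∈ maximalIdeal A, φ a ∈ J := by
    intro a ha
    obtain ⟨r, s, rfl⟩ := huv.exists_eq_of_mem ha
    rw [map_add, map_mul, map_mul, hu, hv]
    refine add_mem (Ideal.mul_mem_left _ _ (Ideal.mul_mem_left _ _ (Ideal.pow_mem_of_mem _
      (Ideal.mul_mem_right _ _ hXJ) _ (by omega)))) (Ideal.mul_mem_left _ _ (add_mem ?_ ?_))
    · rw [pow_add]
      exact Ideal.mul_mem_left _ _ (Ideal.mul_mem_left _ _ hYJ)
    · exact Ideal.mul_mem_left _ _ (Ideal.mul_mem_right _ _ hXJ)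
  obtain ⟨c₀, hc₀⟩ := hA c
  obtain ⟨d₀, hd₀⟩ := hA d
  obtain ⟨σ₀, hσ₀⟩ := hR σ'
  have hc₀0 : c₀ ≠ 0 := by
    rintro rfl
    rw [map_zero, sub_zero] at hc₀
    exact hc₀ hc
  replace hc₀ := hφm _ hc₀
  replace hd₀ := hφm _ hd₀
  obtain ⟨α, β, e⟩ := h.exists_eq_of_mem hσ₀
  have hσp : σ' ^ (k + 2) - φ (ψ σ₀) ^ (k + 2) ∈ J := by
    rw [← sub_pow_char, e, add_pow_char, mul_pow, mul_pow]
    refine add_mem (Ideal.mul_mem_left _ _ (Ideal.pow_mem_of_mem _ hXJ _ (by omega))) (Ideal.mul_mem_left _ _ ?_)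
    rw [pow_add]
    exact Ideal.mul_mem_left _ _ hYJ
  -- After replacing c, d and σ'^p by constants only γ contributes a linear term in Y, namely c₀ γ₁
  -- Y. Membership in (X, Y²) forces c₀ γ₁ = 0.
  have h2 : φ (ψ (c₀ * γ₀ + d₀ * σ₀ ^ (k + 2))) + φ (ψ (c₀ * γ₁)) * Y ∈ J := by
    have e1 : φ (ψ (c₀ * γ₀ + d₀ * σ₀ ^ (k + 2))) + φ (ψ (c₀ * γ₁)) * Y =
        φ c * γ + φ d * σ' ^ (k + 2) - φ (c - ψ c₀) * γ - φ (d - ψ d₀) * σ' ^ (k + 2)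
          - φ (ψ c₀) * (γ - (φ (ψ γ₀) + φ (ψ γ₁) * Y))
          - φ (ψ d₀) * (σ' ^ (k + 2) - φ (ψ σ₀) ^ (k + 2)) := by
      simp only [map_add, map_mul, map_pow, map_sub]
      ring
    rw [e1]
    exact sub_mem (sub_mem (sub_mem (sub_mem h1 (Ideal.mul_mem_right _ _ hc₀)) (Ideal.mul_mem_right _ _ hd₀))
      (Ideal.mul_mem_left _ _ hγ')) (Ideal.mul_mem_left _ _ hσp)
  have h3 : c₀ * γ₀ + d₀ * σ₀ ^ (k + 2) = 0 := by
    by_contra hne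
    exact hJm h2 (isUnit_add_of_mem (((Ne.isUnit hne).map ψ).map φ) (Ideal.mul_mem_left _ _ h.right_mem))
  rw [h3, map_zero, map_zero, zero_add, hJ, Ideal.mem_span_pair] at h2
  obtain ⟨r, t, e⟩ := h2
  have h4 : X ∣ Y * (φ (ψ (c₀ * γ₁)) + -(t * Y)) := ⟨r, by linear_combination -e⟩
  exact h.mem_maximalIdeal_of_dvd_mul h4 (isUnit_add_of_mem (((Ne.isUnit (mul_ne_zero hc₀0 hγ₁)).map ψ).map φ)
    (neg_mem (Ideal.mul_mem_left _ _ h.right_mem)))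

/-- The factor c v₁ + r v equals Y^l q with q = cτ Y^(p-l) + σ' X prime and not associated to X or
Y, while X divides f. If l > 0, then Y divides f too, so X and Y are the only admissible primes and
q dividing g is excluded. If l = 0, the admissible pairs are X with a complementary parameter, and q
≡ cτ Y^p modulo X is not one. -/
theorem not_isMonomialPair_of_blowup {p : ℕ} (hp : 2 ≤ p) (h : IsParamPair X Y) {γ τ σ c r e : R}
    (hτ : IsUnit τ) (hσ : IsUnit σ) (hc : IsUnit c) {l s : ℕ} (hl : l < p) {f g v v₁ : R}
    (hv : v = γ * (X * Y ^ l) ^ p) (hv₁ : v₁ = τ * Y ^ p + σ * (X * Y ^ l)) (hf : f = v * e)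
    (hg : g = v ^ s * (c * v₁ + r * v)) : ¬ IsMonomialPair f g := by
  intro hm
  obtain ⟨k, rfl⟩ : ∃ k, p = k + 2 := ⟨p - 2, by omega⟩
  have hX := h.prime_left
  have hY := h.prime_right
  have hσ' : IsUnit (c * σ + r * γ * (X * Y ^ l) ^ (k + 1)) :=
    isUnit_add_of_mem (hc.mul hσ) (Ideal.mul_mem_left _ _ (Ideal.pow_mem_of_mem _
      (Ideal.mul_mem_right _ _ h.left_mem) _ (by omega)))
  set σ' := c * σ + r * γ * (X * Y ^ l) ^ (k + 1) with eσ'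
  have hq : c * v₁ + r * v = Y ^ l * ((c * τ) * Y ^ (k + 2 - l) + σ' * X) := by
    have : Y ^ (k + 2) = Y ^ (k + 2 - l) * Y ^ l := by rw [← pow_add, Nat.sub_add_cancel hl.le]
    rw [eσ', hv, hv₁, this]; ring
  have hle : 0 < k + 2 - l := by omega
  have hP := h.prime_add (a := c * τ) hσ' hle
  obtain ⟨hqX, hqY⟩ := h.not_prime_dvd_of_dvd (hc.mul hτ) hσ' hle hP.prime_left dvd_rfl
  set q := (c * τ) * Y ^ (k + 2 - l) + σ' * X with eq
  have hqg : q ∣ g := by rw [hg, hq]; exact (dvd_mul_left _ _).mul_left _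
  have hXf : X ∣ f := by
    rw [hf, hv]
    exact ((((dvd_mul_right X _).trans (dvd_pow_self _ (by omega))).mul_left _)).mul_right _
  rcases Nat.eq_zero_or_pos l with rfl | hl0
  · obtain ⟨Z, hZ, -, hgm⟩ := hm.exists_isParamPair hX hXf
    rcases hgm.associated_of_prime_dvd hZ.prime_left hZ.prime_right hP.prime_left hqg with h1 | h1
    · exact hqX h1.dvd
    · obtain ⟨a, b, e⟩ := (hZ.symm.associated_left h1.symm).exists_eq_of_mem h.right_mem
      rw [eq, Nat.sub_zero] at e
      have h4 : X ∣ Y * (1 + -(a * (c * τ) * Y ^ (k + 1))) := ⟨a * σ' + b, by linear_combination e⟩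
      exact h.mem_maximalIdeal_of_dvd_mul h4 (isUnit_add_of_mem isUnit_one
        (neg_mem (Ideal.mul_mem_left _ _ (Ideal.pow_mem_of_mem _ h.right_mem _ (by omega)))))
  · have hYf : Y ∣ f := by
      rw [hf, hv]
      exact (((((dvd_pow_self Y hl0.ne').mul_left X).trans (dvd_pow_self _ (by omega))).mul_left _)).mul_right _
    rcases (hm.isMonomialIn_of_prime_dvd hX hXf hY hYf h.not_associated).2.associated_of_prime_dvd hX hY
      hP.prime_left hqg with h1 | h1
    · exact hqX h1.dvd
    · exact hqY h1.dvd

end IsParamPair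

namespace IsMonomialPair

variable {R : Type*} [CommRing R] [IsLocalRing R] {f g v : R}

theorem not_of_isUnit {e q : R} (he : IsUnit e) (hq : IsUnit q) {s : ℕ} (hf : f = v * e)
    (hg : g = v ^ s * q) : ¬ IsMonomialPair f g := by
  rintro ⟨x, y, -, -, -, h⟩
  have h1 : Associated f v := hf ▸ (associated_mul_unit_left v e he)
  have h2 : Associated g (v ^ s) := hg ▸ (associated_mul_unit_left _ q hq)
  have := (h s 1 (by rw [pow_one]; exact h1.pow_pow.trans h2.symm)).2
  omega

theorem not_of_eq_pow_mul {p : ℕ} (hp : 2 ≤ p) {e c r v₁ w : R} (he : IsUnit e) (hc : IsUnit c) (hw : IsUnit w)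
    (hv₁ : v₁ ∈ maximalIdeal R) (hv : v = v₁ ^ p * w) {s : ℕ} (hf : f = v * e)
    (hg : g = v ^ s * (c * v₁ + r * v)) : ¬ IsMonomialPair f g := by
  have h1 : IsUnit (c + r * w * v₁ ^ (p - 1)) :=
    isUnit_add_of_mem hc (Ideal.mul_mem_left _ _ (Ideal.pow_mem_of_mem _ hv₁ _ (by omega)))
  have h2 : Associated f (v₁ ^ p) := by
    rw [hf, hv, mul_assoc]; exact associated_mul_unit_left _ _ (hw.mul he)
  have h3 : Associated g (v₁ ^ (p * s + 1)) := by
    have : g = v₁ ^ (p * s + 1) * (w ^ s * (c + r * w * v₁ ^ (p - 1))) := by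
      have : v₁ ^ p = v₁ * v₁ ^ (p - 1) := by rw [← pow_succ', Nat.sub_add_cancel (by omega)]
      rw [hg, hv, pow_succ, pow_mul, mul_pow, this]; ring
    rw [this]; exact associated_mul_unit_left _ _ ((hw.pow s).mul h1)
  rintro ⟨x, y, -, -, -, h⟩
  have h4 := h (p * s + 1) p (by
    refine h2.pow_pow.trans (Associated.trans ?_ h3.pow_pow.symm)
    rw [← pow_mul, ← pow_mul, mul_comm]
    exact Associated.refl _)
  omega

end IsMonomialPair

/-- Write g = cW + d f^s with s ≤ e. Since ι f is ι v times a unit, ι g is divisible by (ι v)^s. The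
quotient is a unit when s < e, as d is one; when s = e and it is a nonunit, the constants must
cancel. What is left over then comes from the maximal ideal of A, which ι maps into the ideal of ι
v. -/
theorem IsParamPair.exists_eq_mul_of_blowup {A A₁ : Type*} [CommRing A] [IsDomain A] [IsLocalRing A]
    [IsNoetherianRing A] [CommRing A₁] [IsLocalRing A₁] (ι : A →+* A₁) {W v β a b f g : A}
    (h : IsParamPair W v) {v₁ : A₁} (hv : ι v ∈ maximalIdeal A₁) (hv₁ : v₁ ∈ maximalIdeal A₁) {e : ℕ} (he : 0 < e)
    (hW : ι W = ι v ^ e * (v₁ + ι β)) (hβ : e = 1 → β = 0) (hb : IsUnit b) (hf : f = a * W + b * v)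
    (hfg : IsParamPair f g) :
    ∃ (e₁ q : A₁) (s : ℕ), IsUnit e₁ ∧ ι f = ι v * e₁ ∧ ι g = ι v ^ s * q ∧
      (IsUnit q ∨ ∃ c r, IsUnit c ∧ q = c * v₁ + r * ι v) := by
  have hWf : IsParamPair W f := hf ▸ h.add_mul_right a hb
  obtain ⟨c, d, s, hc, hs, hse, hd, hg⟩ := hWf.exists_eq_add_pow hfg he
  have hdvd : ∀ a ∈ maximalIdeal A, ι v ∣ ι a := by
    intro a ha
    obtain ⟨r, s, rfl⟩ := h.exists_eq_of_mem ha
    rw [map_add, map_mul, map_mul, hW]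
    exact dvd_add (((dvd_pow_self _ he.ne').mul_right _).mul_left _) (dvd_mul_left _ _)
  have hmem : ∀ a, ι a ∈ maximalIdeal A₁ → ι v ∣ ι a := fun a ha => hdvd a fun hu => ha (hu.map ι)
  have h1 : ι v ^ (e - 1) * (v₁ + ι β) ∈ maximalIdeal A₁ := by
    -- For e = 1 the factor v₁ + β stands without a power of v, and it is a nonunit only because β =
    -- 0.
    by_cases h1 : e = 1
    · rw [hβ h1, map_zero, add_zero]
      exact Ideal.mul_mem_left _ _ hv₁
    · exact Ideal.mul_mem_right _ _ (Ideal.pow_mem_of_mem _ hv _ (by omega))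
  have he₁ : IsUnit (ι b + ι a * (ι v ^ (e - 1) * (v₁ + ι β))) :=
    isUnit_add_of_mem (hb.map ι) (Ideal.mul_mem_left _ _ h1)
  set e₁ := ι b + ι a * (ι v ^ (e - 1) * (v₁ + ι β)) with ee₁
  have hfe : ι f = ι v * e₁ := by
    have : ι v ^ e = ι v * ι v ^ (e - 1) := by rw [← pow_succ', Nat.sub_add_cancel he]
    rw [hf, map_add, map_mul, map_mul, hW, ee₁, this]; ring
  clear_value e₁
  have hge : ι g = ι v ^ s * (ι c * ι v ^ (e - s) * (v₁ + ι β) + ι d * e₁ ^ s) := by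
    have : ι v ^ e = ι v ^ s * ι v ^ (e - s) := by rw [← pow_add, Nat.add_sub_cancel' hse]
    rw [hg, map_add, map_mul, map_mul, map_pow, hW, hfe, this]; ring
  refine ⟨e₁, _, s, he₁, hfe, hge, ?_⟩
  by_cases hq : IsUnit (ι c * ι v ^ (e - s) * (v₁ + ι β) + ι d * e₁ ^ s)
  · exact Or.inl hq
  right
  have hse' : s = e := by
    by_contra hne
    apply hq
    rw [add_comm]
    exact isUnit_add_of_mem (((hd (by omega)).map ι).mul (he₁.pow s)) (Ideal.mul_mem_right _ _
      (Ideal.mul_mem_left _ _ (Ideal.pow_mem_of_mem _ hv _ (by omega))))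
  subst hse'
  rw [Nat.sub_self, pow_zero, mul_one] at hq ⊢
  replace hq : ι c * (v₁ + ι β) + ι d * e₁ ^ s ∈ maximalIdeal A₁ := hq
  have hc' := hc.map ι
  by_cases h1 : s = 1
  · subst h1
    rw [hβ rfl, map_zero, add_zero, pow_one] at hq ⊢
    have h2 : ι d * e₁ ∈ maximalIdeal A₁ := by
      have := sub_mem hq (Ideal.mul_mem_left _ (ι c) hv₁)
      rwa [add_sub_cancel_left] at this
    have h3 : ι d ∈ maximalIdeal A₁ := fun h => h2 (h.mul he₁)
    obtain ⟨r, hr⟩ := hmem d h3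
    exact ⟨ι c, r * e₁, hc', by rw [hr]; ring⟩
  · obtain ⟨k, rfl⟩ : ∃ k, s = k + 2 := ⟨s - 2, by omega⟩
    -- For e ≥ 2 the unit e₁ agrees with b modulo v, so the obstruction cβ + d b^e comes from A
    -- itself.
    have h2 : ι v ∣ e₁ ^ (k + 2) - ι b ^ (k + 2) := by
      refine Dvd.dvd.trans ?_ (sub_dvd_pow_sub_pow _ _ _)
      rw [ee₁, add_sub_cancel_left]
      exact ((dvd_pow_self _ (by omega)).mul_right _).mul_left _
    obtain ⟨r, hr⟩ := h2
    have h3 : ι (c * β + d * b ^ (k + 2)) ∈ maximalIdeal A₁ := by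
      have e2 : ι (c * β + d * b ^ (k + 2)) =
          ι c * (v₁ + ι β) + ι d * e₁ ^ (k + 2) - ι c * v₁ - ι d * r * ι v := by
        rw [map_add, map_mul, map_mul, map_pow]
        linear_combination -ι d * hr
      rw [e2]
      exact sub_mem (sub_mem hq (Ideal.mul_mem_left _ _ hv₁)) (Ideal.mul_mem_left _ _ hv)
    obtain ⟨t, ht⟩ := hmem _ h3
    refine ⟨ι c, t + ι d * r, hc', ?_⟩
    rw [map_add, map_mul, map_mul, map_pow] at ht
    linear_combination ht + ι d * hr

end

/-! ### Comparison of the two towers of blowups. -/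

section

open IsLocalRing MvPolynomial

section Casework

variable {κ F : Type*} [Field κ] [Field F] [Algebra κ F] {p : ℕ} {x y u v : F}

theorem IsCoord.locRing_le_div_left (h : IsCoord κ x y) (l : ℕ) : locRing κ x y ≤ locRing κ (x / y ^ l) y := by
  refine locRing_le_locRing (h.div_left l).indep (a := y ^ l) (b := 0) (a' := 0) (b' := 1)
    (pow_mem (right_mem_locRing _ _) _) (zero_mem _) (zero_mem _) (one_mem _) ?_ (by ring)
  rw [mul_zero, add_zero, div_mul_cancel₀ _ (pow_ne_zero _ h.ne_zero_right)]

theorem IsUnitAt.isUnit_of_le {f : F} (hf : IsUnitAt κ x y f) {S : Subring F} (hS : locRing κ x y ≤ S) :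
    IsUnit (⟨f, hS hf.mem⟩ : S) :=
  IsUnit.of_mul_eq_one ⟨f⁻¹, hS hf.inv.mem⟩ (Subtype.ext (mul_inv_cancel₀ hf.ne_zero))

theorem IsBlowupSeq.isUnitAt_add_algebraMap {z : ℕ → F} {c : ℕ → κ} (h : IsBlowupSeq p z c) (i : ℕ) :
    IsUnitAt κ (z (i + 1)) (z (i + 2)) (z (i + 2) + algebraMap κ F (c i)) :=
  isUnitAt_of_eq (h.coord (i + 1)).indep (h.ne_zero i) (zero_mem _) (one_mem _) (by ring)

/-- The stable form inside the ring obtained by dividing `x` by a power of `y`. -/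
theorem IsStableForm.exists_locRing (hxy : IsCoord κ x y) (h : IsStableForm κ p x y u v) (l : ℕ)
    {U V : locRing κ (x / y ^ l) y} (hU : (U : F) = u) (hV : (V : F) = v) :
    ∃ γ τ σ : locRing κ (x / y ^ l) y, IsUnit γ ∧ IsUnit τ ∧ IsUnit σ ∧
      U = γ * (locRing.left κ (x / y ^ l) y * locRing.right κ (x / y ^ l) y ^ l) ^ p ∧
      V = τ * locRing.right κ (x / y ^ l) y ^ p +
        σ * (locRing.left κ (x / y ^ l) y * locRing.right κ (x / y ^ l) y ^ l) ∧
      ∃ γ₀ γ₁ : κ, γ₁ ≠ 0 ∧ ∀ c₀ c₁ : locRing κ (x / y ^ l) y, (c₀ : F) = algebraMap κ F γ₀ →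
        (c₁ : F) = algebraMap κ F γ₁ → γ - (c₀ + c₁ * locRing.right κ (x / y ^ l) y) ∈
          Ideal.span {locRing.left κ (x / y ^ l) y, locRing.right κ (x / y ^ l) y ^ 2} := by
  obtain ⟨γ, τ, σ, hγ, hτ, hσ, hu, hv, γ₀, γ₁, -, hγ₁, r, hr, s, hs, eγ⟩ := h
  have hle := hxy.locRing_le_div_left l
  have hx : x / y ^ l * y ^ l = x := div_mul_cancel₀ _ (pow_ne_zero _ hxy.ne_zero_right)
  refine ⟨⟨γ, hle hγ.mem⟩, ⟨τ, hle hτ.mem⟩, ⟨σ, hle hσ.mem⟩, hγ.isUnit_of_le hle, hτ.isUnit_of_le hle,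
    hσ.isUnit_of_le hle, Subtype.ext ?_, Subtype.ext ?_, γ₀, γ₁, hγ₁, fun c₀ c₁ h₀ h₁ => ?_⟩
  · simp only [Subring.coe_mul, Subring.coe_pow, locRing.left, locRing.right, hx, hU, hu]
  · simp only [Subring.coe_mul, Subring.coe_pow, Subring.coe_add, locRing.left, locRing.right, hx, hV, hv]
  · refine Ideal.mem_span_pair.mpr ⟨⟨y ^ l * r, mul_mem (pow_mem (right_mem_locRing _ _) _) (hle hr)⟩,
      ⟨s, hle hs⟩, Subtype.ext ?_⟩
    simp only [Subring.coe_mul, Subring.coe_pow, Subring.coe_add, AddSubgroupClass.coe_sub, locRing.left, locRing.right, h₀, h₁]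
    rw [eγ]
    linear_combination r * hx

theorem exists_sub_mem_maximalIdeal_locRing (hxy : AlgebraicIndependent κ ![x, y]) [IsLocalRing (locRing κ x y)]
    (f : locRing κ x y) : ∃ c : κ, ∀ c' : locRing κ x y, (c' : F) = algebraMap κ F c →
      f - c' ∈ maximalIdeal (locRing κ x y) := by
  obtain ⟨c, r, hr, s, hs, e⟩ := exists_eq_add_mul_add_mul_of_mem_locRing f.2
  refine ⟨c, fun c' hc' => ?_⟩
  rw [(isParamPair_locRing hxy).maximalIdeal_eq, Ideal.mem_span_pair]
  refine ⟨⟨r, hr⟩, ⟨s, hs⟩, Subtype.ext ?_⟩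
  simp only [Subring.coe_mul, Subring.coe_add, AddSubgroupClass.coe_sub, locRing.left, locRing.right, hc', e]
  ring

variable {K : Type*} [Field K] [Algebra κ K] [Algebra K F]

theorem IsCentered.comap {ν : AddValuation F (WithTop ℚ)} {S : Subring F} (h : IsCentered ν S) :
    IsCentered (ν.comap (algebraMap K F)) (S.comap (algebraMap K F)) := by
  intro f hf
  obtain ⟨h1, h2⟩ := h _ hf
  exact ⟨h1, fun h0 => by simpa [Subring.mem_comap, map_inv₀] using h2 h0⟩

variable {z : ℕ → F} {w : ℕ → K} {c b : ℕ → κ} {ν : AddValuation F (WithTop ℚ)}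

theorem IsBlowupSeq.mem_comap_of_isStableForm (hp : 2 ≤ p) (hz : IsBlowupSeq p z c)
    (hs : ∀ i, IsStableForm κ p (z i) (z (i + 1)) (algebraMap K F (w i)) (algebraMap K F (w (i + 1))))
    {B : Subring F} {i M : ℕ} (hB : locRing κ (z M) (z (M + 1)) ≤ B) (hi : i ≤ M) :
    w i ∈ B.comap (algebraMap K F) ∧ w (i + 1) ∈ B.comap (algebraMap K F) := by
  obtain ⟨γ, τ, σ, hγ, hτ, hσ, hu, hv, -⟩ := hs i
  have hle : locRing κ (z i) (z (i + 1)) ≤ B := by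
    have := hz.locRing_le_add (by omega) i (M - i)
    rw [Nat.add_sub_cancel' hi] at this
    exact this.trans hB
  have hx := left_mem_locRing (κ := κ) (z i) (z (i + 1))
  have hy := right_mem_locRing (κ := κ) (z i) (z (i + 1))
  rw [Subring.mem_comap, Subring.mem_comap, hu, hv]
  exact ⟨hle (mul_mem hγ.mem (pow_mem hx _)),
    hle (add_mem (mul_mem hτ.mem (pow_mem hy _)) (mul_mem hσ.mem hx))⟩

theorem IsBlowupSeq.locRing_div_le (hw : IsBlowupSeq p w b) (hj : j < p) (N : ℕ) :
    locRing κ (w N / w (N + 1) ^ j) (w (N + 1)) ≤ locRing κ (w (N + 1)) (w (N + 2)) := by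
  refine locRing_le_locRing (hw.coord (N + 1)).indep
    (a := w (N + 1) ^ (p - j - 1) * (w (N + 2) + algebraMap κ K (b N))) (b := 0) (a' := 1) (b' := 0)
    (mul_mem (pow_mem (left_mem_locRing _ _) _) (add_mem (right_mem_locRing _ _) (algebraMap_mem_locRing _ _ _)))
    (zero_mem _) (one_mem _) (zero_mem _) ?_ (by ring)
  have h0 := hw.term_ne_zero (N + 1)
  rw [div_eq_iff (pow_ne_zero _ h0), hw.rel N]
  have : w (N + 1) ^ p = w (N + 1) * w (N + 1) ^ (p - j - 1) * w (N + 1) ^ j := by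
    rw [← pow_succ', ← pow_add]; congr 1; omega
  rw [this]; ring

section

variable {A : Subring K} {B : Subring F} [IsLocalRing B] [IsNoetherianRing B]
  {W v : A} {X Y γ τ σ : B} {N j M l : ℕ}

/-- If A contained u/v, then V would divide U in B. But V has a prime factor different from X and Y,
while U is a unit times a monomial in X and Y. -/
theorem not_isMonomialPair_of_mem (φ : A →+* B) (hφ : ∀ a, (φ a : F) = algebraMap K F a)
    (hXY : IsParamPair X Y) (hl : l < p) (hγ : IsUnit γ) (hτ : IsUnit τ) (hσ : IsUnit σ) {U V : B}
    (hu : U = γ * (X * Y ^ l) ^ p) (hv : V = τ * Y ^ p + σ * (X * Y ^ l))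
    {u v t : K} (hU : (U : F) = algebraMap K F u) (hV : (V : F) = algebraMap K F v) (ht : t ∈ A) (e : u = v * t) :
    False := by
  have hdvd : V ∣ U := ⟨φ ⟨t, ht⟩, Subtype.ext (by rw [Subring.coe_mul, hφ, hU, hV, e, map_mul])⟩
  rw [hu, hv] at hdvd
  refine hXY.not_add_dvd hτ hσ (e := p - l) (by omega) hγ p (l * p) (Dvd.dvd.trans ⟨Y ^ l, ?_⟩
    (hdvd.trans (dvd_of_eq ?_)))
  · have : Y ^ p = Y ^ (p - l) * Y ^ l := by rw [← pow_add, Nat.sub_add_cancel hl.le]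
    rw [this]; ring
  · rw [mul_pow, pow_mul]

/-- The map A → B factors through the next full blowup A₁ of the tower `w`. There f is v times a
unit and g is v^s times a unit or times c v₁ + r v, and each possibility contradicts monomiality in
B. -/
theorem not_isMonomialPair_of_lt [IsLocalRing A] [IsNoetherianRing A] (hp : 2 ≤ p) (hw : IsBlowupSeq p w b) (hj : j < p)
    (hA : A ≤ locRing κ (w (N + 1)) (w (N + 2))) (hAκ : ∀ a, algebraMap κ K a ∈ A)
    (hWv : IsParamPair W v) (hW : (W : K) = w N / w (N + 1) ^ j) (hv : (v : K) = w (N + 1)) (hNM : N < M)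
    (hB : ∀ i ≤ M, locRing κ (w i) (w (i + 1)) ≤ B.comap (algebraMap K F))
    (hwB : ∀ i ≤ M, ∀ V : B, (V : F) = algebraMap K F (w (i + 1)) → V ∈ maximalIdeal B)
    (φ : A →+* B) (hφ : ∀ a, (φ a : F) = algebraMap K F a)
    (hXY : IsParamPair X Y) (hl : l < p) (hτ : IsUnit τ) (hσ : IsUnit σ)
    (hu : ∀ U : B, (U : F) = algebraMap K F (w M) → U = γ * (X * Y ^ l) ^ p)
    (hv' : ∀ V : B, (V : F) = algebraMap K F (w (M + 1)) → V = τ * Y ^ p + σ * (X * Y ^ l))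
    {f g : A} (hfg : IsParamPair f g) : ¬ IsMonomialPair (φ f) (φ g) := by
  have := isLocalRing_locRing (hw.coord (N + 1)).indep
  have hP := isParamPair_locRing (hw.coord (N + 1)).indep
  let ι : A →+* locRing κ (w (N + 1)) (w (N + 2)) := Subring.inclusion hA
  have hι : ∀ a, ((ι a : locRing κ (w (N + 1)) (w (N + 2))) : K) = a := fun _ => rfl
  obtain ⟨φ₁, hφ₁⟩ : ∃ φ₁ : locRing κ (w (N + 1)) (w (N + 2)) →+* B, ∀ a, (φ₁ a : F) = algebraMap K F a :=
    ⟨((algebraMap K F).comp (Subring.subtype _)).codRestrict B (fun a => hB (N + 1) hNM a.2), fun _ => rfl⟩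
  have hφι : ∀ a, φ₁ (ι a) = φ a := fun a => Subtype.ext (by rw [hφ₁, hφ, hι])
  obtain ⟨v₁, hv₁, hv₁m⟩ : ∃ v₁ ∈ maximalIdeal (locRing κ (w (N + 1)) (w (N + 2))), (v₁ : K) = w (N + 2) :=
    ⟨_, hP.right_mem, rfl⟩
  have hιv : ι v ∈ maximalIdeal (locRing κ (w (N + 1)) (w (N + 2))) := by
    have : ι v = locRing.left κ (w (N + 1)) (w (N + 2)) := Subtype.ext (by rw [hι, hv]; rfl)
    rw [this]; exact hP.left_mem
  have hιW : ι W = ι v ^ (p - j) * (v₁ + ι ⟨_, hAκ (b N)⟩) := by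
    apply Subtype.ext
    rw [hι, hW, Subring.coe_mul, Subring.coe_pow, Subring.coe_add, hι, hι, hv, hv₁m,
      div_eq_iff (pow_ne_zero _ (hw.term_ne_zero (N + 1))), hw.rel N]
    have : w (N + 1) ^ p = w (N + 1) ^ (p - j) * w (N + 1) ^ j := by
      rw [← pow_add]; congr 1; omega
    rw [this]; ring
  -- When p - j = 1 the parameter W = v (v₁ + b N) is changed to W - (b N) v = v v₁, so that the
  -- constant is zero.
  obtain ⟨W', β, hW'v, hβ, hιW'⟩ : ∃ W' β : A, IsParamPair W' v ∧ (p - j = 1 → β = 0) ∧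
      ι W' = ι v ^ (p - j) * (v₁ + ι β) := by
    by_cases he : p - j = 1
    · refine ⟨-⟨_, hAκ (b N)⟩ * v + 1 * W, 0, (hWv.symm.add_mul_right _ isUnit_one).symm, fun _ => rfl, ?_⟩
      rw [map_add, map_mul, map_mul, hιW, he, map_zero, map_neg, map_one]; ring
    · exact ⟨W, _, hWv, fun h => absurd h he, hιW⟩
  have key : ∀ {f g : A}, IsParamPair f g → (∃ a b, IsUnit b ∧ f = a * W' + b * v) →
      ¬ IsMonomialPair (φ f) (φ g) := by
    rintro f g hfg ⟨a, b', hb', hf⟩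
    obtain ⟨e₁, q, s, he₁, hf', hg', hq⟩ := hW'v.exists_eq_mul_of_blowup ι hιv hv₁ (by omega) hιW' hβ hb' hf hfg
    replace hf' := congrArg φ₁ hf'
    replace hg' := congrArg φ₁ hg'
    rw [hφι, map_mul, hφι] at hf'
    rw [hφι, map_mul, map_pow, hφι] at hg'
    rcases hq with hq | ⟨c, r, hc, rfl⟩
    · exact IsMonomialPair.not_of_isUnit (he₁.map φ₁) (hq.map φ₁) hf' hg'
    rw [map_add, map_mul, map_mul, hφι] at hg'
    -- If B is still further up, v is v₁^p times a unit of B, and f, g are both powers of v₁ up to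
    -- units. If N + 1 = M, then v and v₁ are in stable form over B.
    rcases (show N + 1 ≤ M from hNM).lt_or_eq with hlt | rfl
    · have hu2 := (hw.isUnitAt_add_algebraMap (N + 1)).isUnit_of_le (hB (N + 2) hlt)
      obtain ⟨φ₂, hφ₂⟩ : ∃ φ₂ : B.comap (algebraMap K F) →+* B, ∀ a, (φ₂ a : F) = algebraMap K F a :=
        ⟨((algebraMap K F).comp (Subring.subtype _)).codRestrict B (fun a => a.2), fun _ => rfl⟩
      refine IsMonomialPair.not_of_eq_pow_mul hp (he₁.map φ₁) (hc.map φ₁) (hu2.map φ₂) (v₁ := φ₁ v₁) ?_ ?_ hf' hg'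
      · exact hwB (N + 1) hNM _ (by rw [hφ₁, hv₁m])
      · apply Subtype.ext
        rw [Subring.coe_mul, Subring.coe_pow, hφ, hφ₁, hφ₂, hv, hv₁m, ← map_pow, ← map_mul, hw.rel (N + 1)]
    · exact hXY.not_isMonomialPair_of_blowup hp hτ hσ (hc.map φ₁) hl (hu _ (by rw [hφ, hv]))
        (hv' _ (by rw [hφ₁, hv₁m])) hf' hg'
  rcases hW'v.exists_isUnit_right hfg with h | h
  · exact key hfg h
  · exact fun hm => key hfg.symm h hm.symm

end

variable [IsScalarTower κ K F]

/-- The three cases are N < M, the aligned case M = N with j = 0, and A lying beyond level M. In the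
last case the map φ itself cannot exist. -/
theorem not_isMonomialPair_locRing (hp : p.Prime) [CharP κ p] (hz : IsBlowupSeq p z c) (hw : IsBlowupSeq p w b)
    (hs : ∀ i, IsStableForm κ p (z i) (z (i + 1)) (algebraMap K F (w i)) (algebraMap K F (w (i + 1))))
    (hκ : ∀ a : κ, a ≠ 0 → ν (algebraMap κ F a) = 0) (hνz : ∀ i, ν (z i) = ((1 / p ^ i : ℚ) : WithTop ℚ))
    (hνw : ∀ i, ν (algebraMap K F (w i)) = ((p / p ^ i : ℚ) : WithTop ℚ)) {N j M l : ℕ} (hj : j < p) (hl : l < p)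
    [IsLocalRing (locRing κ (w N / w (N + 1) ^ j) (w (N + 1)))]
    [IsLocalRing (locRing κ (z M / z (M + 1) ^ l) (z (M + 1)))]
    (φ : locRing κ (w N / w (N + 1) ^ j) (w (N + 1)) →+* locRing κ (z M / z (M + 1) ^ l) (z (M + 1)))
    (hφ : ∀ a, (φ a : F) = algebraMap K F a) {f g : locRing κ (w N / w (N + 1) ^ j) (w (N + 1))}
    (hfg : IsParamPair f g) : ¬ IsMonomialPair (φ f) (φ g) := by
  have hp2 := hp.two_le
  have hpQ : (0 : ℚ) < p := by exact_mod_cast hp.pos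
  have hcharF : CharP F p := charP_of_injective_algebraMap (algebraMap κ F).injective p
  have hzM := (hz.coord M).div_left l
  have hwN := (hw.coord N).div_left j
  have := isNoetherianRing_locRing hzM.indep
  have := isNoetherianRing_locRing hwN.indep
  have hXY := isParamPair_locRing hzM.indep
  have hWv := isParamPair_locRing hwN.indep
  have hκK : ∀ a : κ, a ≠ 0 → ν.comap (algebraMap K F) (algebraMap κ K a) = 0 := by
    intro a ha
    change ν (algebraMap K F (algebraMap κ K a)) = 0
    rw [← IsScalarTower.algebraMap_apply]
    exact hκ a ha
  have hwpos : ∀ i, 0 < ν (algebraMap K F (w i)) := by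
    intro i
    rw [hνw]
    exact_mod_cast (by positivity : (0 : ℚ) < p / p ^ i)
  have hcB := hz.isCentered hp2 one_pos hκ hνz M l hl
  have hBM := (hz.coord M).locRing_le_div_left l
  have hAN := (hw.coord N).locRing_le_div_left j
  have hwB := fun i (hi : i ≤ M) => hz.mem_comap_of_isStableForm hp2 hs hBM hi
  obtain ⟨γ, τ, σ, hγ, hτ, hσ, hu, hv, γ₀, γ₁, hγ₁, hγ'⟩ := (hs M).exists_locRing (hz.coord M) l
    (U := ⟨_, (hwB M le_rfl).1⟩) (V := ⟨_, (hwB M le_rfl).2⟩) rfl rfl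
  rcases Nat.lt_or_ge N M with hNM | hMN
  · refine not_isMonomialPair_of_lt hp2 hw hj (hw.locRing_div_le hj N) (fun a => algebraMap_mem_locRing _ _ a) hWv rfl
      rfl hNM (fun i hi => ?_) (fun i hi V hV => ?_) φ hφ hXY hl hτ hσ (fun U hU => (Subtype.ext hU).trans hu)
      (fun V hV => (Subtype.ext hV).trans hv) hfg
    · refine locRing_le_of_isCentered hκK (hwpos i) (hwpos (i + 1)) hcB.comap (fun a => ?_) (hwB i hi).1 (hwB i hi).2
      rw [Subring.mem_comap, ← IsScalarTower.algebraMap_apply]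
      exact algebraMap_mem_locRing _ _ a
    · rw [hcB.mem_maximalIdeal, hV]
      exact hwpos _
  by_cases hcase : M = N ∧ j = 0
  · obtain ⟨rfl, rfl⟩ := hcase
    have hchar : CharP (locRing κ (z M / z (M + 1) ^ l) (z (M + 1))) p :=
      ((locRing κ (z M / z (M + 1) ^ l) (z (M + 1))).subtype.charP_iff Subtype.val_injective p).mpr hcharF
    obtain ⟨ψ, hψ⟩ : ∃ ψ : κ →+* locRing κ (w M / w (M + 1) ^ 0) (w (M + 1)), ∀ a, (ψ a : K) = algebraMap κ K a :=
      ⟨(algebraMap κ K).codRestrict _ (fun a => algebraMap_mem_locRing _ _ a), fun _ => rfl⟩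
    have hφψ : ∀ a, (φ (ψ a) : F) = algebraMap κ F a := fun a => by
      rw [hφ, IsScalarTower.algebraMap_apply κ K F, hψ]
    have hu' := hu.symm.trans (Subtype.ext (by rw [hφ]; simp [locRing.left]) :
      _ = φ (locRing.left κ (w M / w (M + 1) ^ 0) (w (M + 1))))
    have hv' := hv.symm.trans (Subtype.ext (by rw [hφ]; rfl) :
      _ = φ (locRing.right κ (w M / w (M + 1) ^ 0) (w (M + 1))))
    have key : ∀ {f g : locRing κ (w M / w (M + 1) ^ 0) (w (M + 1))}, IsParamPair f g →
        (∃ a b, IsUnit b ∧ f = a * locRing.left κ (w M / w (M + 1) ^ 0) (w (M + 1)) +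
          b * locRing.right κ (w M / w (M + 1) ^ 0) (w (M + 1))) → ¬ IsMonomialPair (φ f) (φ g) := by
      rintro f g hfg ⟨a, b', hb', hf⟩
      refine hXY.not_isMonomialPair_of_stable hp φ ψ (fun a => ?_) (fun a => ?_) hWv hγ hτ hσ hl hu'.symm hv'.symm hγ₁
        (hγ' _ _ (hφψ _) (hφψ _)) hb' hf hfg
      · obtain ⟨c, hc⟩ := exists_sub_mem_maximalIdeal_locRing hwN.indep a
        exact ⟨c, hc _ (hψ c)⟩
      · obtain ⟨c, hc⟩ := exists_sub_mem_maximalIdeal_locRing hzM.indep a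
        exact ⟨c, hc _ (hφψ c)⟩
    rcases hWv.exists_isUnit_right hfg with h | h
    · exact key hfg h
    · exact fun hm => key hfg.symm h hm.symm
  -- Here M < N, or M = N and j > 0, and in both cases w M / w (M + 1) lies in A.
  · obtain ⟨t, ht, e⟩ : ∃ t ∈ locRing κ (w N / w (N + 1) ^ j) (w (N + 1)), w M = w (M + 1) * t := by
      have hw1 := hw.term_ne_zero (M + 1)
      rcases hMN.lt_or_eq with hlt | rfl
      · refine ⟨w (M + 1) ^ (p - 1) * (w (M + 2) + algebraMap κ K (b M)), ?_, ?_⟩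
        · have := hw.locRing_le_add hp.pos (M + 1) (N - (M + 1))
          rw [Nat.add_sub_cancel' (show M + 1 ≤ N from hlt)] at this
          exact hAN (this (mul_mem (pow_mem (left_mem_locRing _ _) _)
            (add_mem (right_mem_locRing _ _) (algebraMap_mem_locRing _ _ _))))
        · rw [← mul_assoc, ← pow_succ', Nat.sub_add_cancel hp.one_le]; exact hw.rel M
      · obtain ⟨k, rfl⟩ := Nat.exists_eq_succ_of_ne_zero fun h => hcase ⟨rfl, h⟩
        refine ⟨w M / w (M + 1) ^ (k + 1) * w (M + 1) ^ k,
          mul_mem (left_mem_locRing _ _) (pow_mem (right_mem_locRing _ _) _), ?_⟩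
        field_simp
        ring
    exact (not_isMonomialPair_of_mem φ hφ hXY hl hγ hτ hσ hu hv rfl rfl ht e).elim

end Casework

end

/-! ### The dimension of the competing rings, and the valuation of the example. -/

section

open IsLocalRing

section Valuation

theorem uniqueFactorizationMonoid_of_isPrincipal_maximalIdeal {R : Type*} [CommRing R] [IsDomain R] [IsLocalRing R]
    [IsNoetherianRing R] (h : (maximalIdeal R).IsPrincipal) : UniqueFactorizationMonoid R := by
  have : IsPrincipalIdealRing R := ((tfae_of_isNoetherianRing_of_isLocalRing_of_isDomain R).out 0 4).mpr h
  infer_instance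

variable {κ K L : Type*} [Field κ] [Field K] [Field L] [Algebra κ K] [Algebra κ L] [Algebra K L]
  [IsScalarTower κ K L] {p : ℕ} {z : ℕ → L} {w : ℕ → K} {c b : ℕ → κ} {ν : AddValuation L (WithTop ℚ)}

theorem IsCoord.trdeg_subring_le {u v : K} (huv : IsCoord κ u v) {A : Subring K} (hA : ∀ a, algebraMap κ K a ∈ A)
    {n : ℕ} (hn : ringKrullDim A = n) : n ≤ 2 := by
  let : Algebra κ A := ((algebraMap κ K).codRestrict A hA).toAlgebra
  let f : A →ₐ[κ] K := ⟨A.subtype, fun _ => rfl⟩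
  have h1 := natCast_le_trdeg_of_le_ringKrullDim (κ := κ) (D := A) (n := n) hn.ge
  have h2 := (h1.trans (trdeg_le_of_injective f Subtype.val_injective)).trans huv.trdeg_eq.le
  exact_mod_cast h2

namespace IsBlowupSeq

theorem exists_eq_locRing_of_isUFD (h : IsBlowupSeq p z c) (hp : 2 ≤ p) {C : ℚ} (hC : 0 < C)
    (hκ : ∀ a : κ, a ≠ 0 → ν (algebraMap κ L a) = 0)
    (hz : ∀ i, ν (z i) = ((C / p ^ i : ℚ) : WithTop ℚ)) {R : Subring L} [IsLocalRing R]
    [IsNoetherianRing R] (hR : IsCentered ν R) (hle : locRing κ (z 0) (z 1) ≤ R)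
    (hm : (∃ x, maximalIdeal R = Ideal.span {x}) ∨ ∃ x y : R, IsParamPair x y) :
    ∃ i l, l < p ∧ R = locRing κ (z i / z (i + 1) ^ l) (z (i + 1)) := by
  have : UniqueFactorizationMonoid R := by
    rcases hm with ⟨x, hx⟩ | ⟨x, y, h⟩
    · exact uniqueFactorizationMonoid_of_isPrincipal_maximalIdeal ⟨x, hx⟩
    · exact uniqueFactorizationMonoid_of_maximalIdeal_eq_span_pair h.maximalIdeal_eq h.prime_left
  exact h.exists_eq_locRing hp hC hκ hz hR hle

/-- The transcendence degree bounds n by two. For n ≤ 1 the maximal ideal would be principal and R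
factorial, so R would be one of the rings of the tower, which have dimension two. -/
theorem ringKrullDim_eq_two (h : IsBlowupSeq p z c) (hp : 2 ≤ p) {C : ℚ} (hC : 0 < C)
    (hκ : ∀ a : κ, a ≠ 0 → ν (algebraMap κ L a) = 0)
    (hz : ∀ i, ν (z i) = ((C / p ^ i : ℚ) : WithTop ℚ)) {R : Subring L} [IsLocalRing R]
    [IsNoetherianRing R] (hR : IsCentered ν R) (hle : locRing κ (z 0) (z 1) ≤ R) {n : ℕ}
    (hn : ringKrullDim R = n) {x : Fin n → R} (hx : Ideal.span (Set.range x) = maximalIdeal R) : n = 2 := by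
  have h2 : n ≤ 2 := h.coord_zero.trdeg_subring_le (fun a => hle (algebraMap_mem_locRing _ _ a)) hn
  by_contra hne
  have hm : ∃ a, maximalIdeal R = Ideal.span {a} := by
    obtain rfl | rfl : n = 0 ∨ n = 1 := by omega
    · exact ⟨0, by rw [← hx]; simp⟩
    · exact ⟨x 0, by rw [← hx, Set.range_unique]; rfl⟩
  obtain ⟨i, l, -, rfl⟩ := h.exists_eq_locRing_of_isUFD hp hC hκ hz hR hle (Or.inl hm)
  have hc := ((h.coord i).div_left l).indep
  have h3 := (isParamPair_locRing hc).ringKrullDim_eq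
  rw [hn] at h3
  exact hne (by exact_mod_cast h3)

end IsBlowupSeq

theorem not_isMonomialPair_of_isCentered (hp : p.Prime) [CharP κ p] (hz : IsBlowupSeq p z c) (hw : IsBlowupSeq p w b)
    (hs : ∀ i, IsStableForm κ p (z i) (z (i + 1)) (algebraMap K L (w i)) (algebraMap K L (w (i + 1))))
    (hκ : ∀ a : κ, a ≠ 0 → ν (algebraMap κ L a) = 0) (hνz : ∀ i, ν (z i) = ((1 / p ^ i : ℚ) : WithTop ℚ))
    (hνw : ∀ i, ν (algebraMap K L (w i)) = ((p / p ^ i : ℚ) : WithTop ℚ))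
    {A : Subring K} {B : Subring L} [IsLocalRing A] [IsLocalRing B] [IsNoetherianRing A] [IsNoetherianRing B]
    (hA : IsCentered (ν.comap (algebraMap K L)) A) (hB : IsCentered ν B) (hAle : locRing κ (w 0) (w 1) ≤ A)
    (hBle : locRing κ (z 0) (z 1) ≤ B) (φ : A →+* B) (hφ : ∀ a, (φ a : L) = algebraMap K L a)
    {f g : A} (hfg : IsParamPair f g) {x y : B} (hxy : IsParamPair x y) : ¬ IsMonomialPair (φ f) (φ g) := by
  have hp0 : (0 : ℚ) < p := by exact_mod_cast hp.pos
  obtain ⟨M, l, hl, rfl⟩ := hz.exists_eq_locRing_of_isUFD hp.two_le one_pos hκ hνz hB hBle (Or.inr ⟨x, y, hxy⟩)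
  obtain ⟨N, j, hj, rfl⟩ := hw.exists_eq_locRing_of_isUFD (ν := ν.comap (algebraMap K L)) hp.two_le hp0 (fun a ha => by
    change ν (algebraMap K L (algebraMap κ K a)) = 0
    rw [← IsScalarTower.algebraMap_apply]
    exact hκ a ha) hνw hA hAle (Or.inr ⟨f, g, hfg⟩)
  exact not_isMonomialPair_locRing hp hz hw hs hκ hνz hνw hj hl φ hφ hfg

theorem isCentered_comap_of_dominates {A : LocalSubring K} {B : LocalSubring L} (hAB : A.map (algebraMap K L) ≤ B)
    (hB : B ≤ valuationLocalRing ν) : IsCentered (ν.comap (algebraMap K L)) A.toSubring := by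
  have h := (isCentered_of_le_valuationLocalRing (hAB.trans hB)).comap (K := K)
  have : (A.toSubring.map (algebraMap K L)).comap (algebraMap K L) = A.toSubring :=
    SetLike.coe_injective (Set.preimage_image_eq _ (algebraMap K L).injective)
  rwa [LocalSubring.map_toSubring, this] at h

end Valuation

/-- The valuation of the example, over the field of constants `κ`. -/
theorem exists_valuation_not_isMonomialExtension.{v} {κ K L : Type v} [Field κ] [Field K] [Field L] [Algebra κ K] [Algebra κ L]
    [Algebra K L] [IsScalarTower κ K L] {p : ℕ} (hp : p.Prime) [CharP κ p] (hκ : 3 ≤ Cardinal.mk κ) {x y : L} {u v : K}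
    (hxy : IsCoord κ x y) (huv : IsCoord κ u v) (hu : algebraMap K L u = x ^ p * (1 + y))
    (hv : algebraMap K L v = y ^ p + x) :
    ∃ ν : AddValuation L (WithTop ℚ), (∀ a : κ, a ≠ 0 → ν (algebraMap κ L a) = 0) ∧ ν x = 1 ∧ 0 < ν y ∧
      0 < ν (algebraMap K L u) ∧ 0 < ν (algebraMap K L v) ∧
      valueSet ν = onePPowInfty p ∧ valueSet (ν.comap (algebraMap K L)) = onePPowInfty p ∧
      ∀ (A : LocalSubring K) (B : LocalSubring L), B ≤ valuationLocalRing ν → Dominates B A →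
        locRing κ u v ≤ A.toSubring → locRing κ x y ≤ B.toSubring → ¬ IsMonomialExtension A B := by
  obtain ⟨z, w, c, b, hz, hw, rfl, rfl, rfl, rfl, hs⟩ := exists_isBlowupSeq_pair hp hκ hxy huv hu hv
  have hp2 := hp.two_le
  have hpQ : (0 : ℚ) < p := by exact_mod_cast hp.pos
  set ν := hz.valuation hp2 with hν
  have hνκ : ∀ a : κ, a ≠ 0 → ν (algebraMap κ L a) = 0 := fun a ha => hz.valuation_algebraMap hp2 ha
  have hνz : ∀ i, ν (z i) = ((1 / p ^ i : ℚ) : WithTop ℚ) := hz.valuation_term hp2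
  -- The stable form gives w i = γ (z i)^p with γ a unit.
  have hνw : ∀ i, ν (algebraMap K L (w i)) = ((p / p ^ i : ℚ) : WithTop ℚ) := by
    intro i
    obtain ⟨γ, -, -, hγ, -, -, e, -⟩ := hs i
    have := hz.valuation_eq hp2 (m := p) hγ
    rw [zpow_natCast, mul_comm, ← e] at this
    rw [hν, this, Int.cast_natCast]
  have hpos : ∀ i, 0 < ν (algebraMap K L (w i)) := fun i => by
    rw [hνw]; exact_mod_cast (by positivity : (0 : ℚ) < p / p ^ i)
  have hsub : ∀ f : L, f ≠ 0 → ∃ q : ℚ, q ∈ onePPowInfty p ∧ ν f = q := by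
    intro f hf
    obtain ⟨j, m, h⟩ := hz.valuation_mem hp2 hf
    exact ⟨_, ⟨m, j, rfl⟩, h⟩
  refine ⟨ν, hνκ, by simpa using hνz 0, ?_, hpos 0, hpos 1, ?_, ?_, ?_⟩
  · rw [hνz]; exact_mod_cast (by positivity : (0 : ℚ) < 1 / p ^ 1)
  · ext q
    constructor
    · rintro ⟨f, hf, hq⟩
      obtain ⟨q', hq', h⟩ := hsub f hf
      rw [hq] at h
      rwa [WithTop.coe_injective h]
    · rintro ⟨a, m, rfl⟩
      refine ⟨z m ^ a, zpow_ne_zero _ (hz.term_ne_zero _), ?_⟩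
      have := hz.valuation_eq hp2 (j := m) (m := a) IsUnitAt.one
      rwa [mul_one] at this
  · ext q
    constructor
    · rintro ⟨f, hf, hq⟩
      obtain ⟨q', hq', h⟩ := hsub (algebraMap K L f) (by simpa using hf)
      change ν (algebraMap K L f) = _ at hq
      rw [hq] at h
      rwa [WithTop.coe_injective h]
    · rintro ⟨a, m, rfl⟩
      -- The index is shifted by one because ν (w (m + 1)) = p / p^(m + 1) = 1 / p^m.
      refine ⟨w (m + 1) ^ a, zpow_ne_zero _ (hw.term_ne_zero _), ?_⟩
      change ν (algebraMap K L (w (m + 1) ^ a)) = _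
      obtain ⟨γ, -, -, hγ, -, -, e, -⟩ := hs (m + 1)
      have := hz.valuation_eq hp2 (j := m + 1) (m := p * a) (hγ.zpow a)
      rw [map_zpow₀, e, mul_zpow, ← zpow_natCast, ← zpow_mul, mul_comm (γ ^ a), this]
      congr 1
      push_cast
      field_simp
      ring
  · rintro ⟨A, hAl⟩ ⟨B, hBl⟩ hBν hAB hAle hBle ⟨hAr, hBr, n, hAn, hBn, xA, yB, δ, a, hxA, hyB, hdet, hmon⟩
    have : IsNoetherianRing A := let _ : IsRegularLocalRing A := hAr; inferInstance
    have : IsNoetherianRing B := let _ : IsRegularLocalRing B := hBr; inferInstance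
    have hcA := isCentered_comap_of_dominates hAB hBν
    have hcB := isCentered_of_le_valuationLocalRing hBν
    obtain rfl := hz.ringKrullDim_eq_two hp2 one_pos hνκ hνz hcB hBle hBn hyB
    have e1 : ∀ {S : Type v} (t : Fin 2 → S), Set.range t = {t 0, t 1} := fun t => by
      ext s; simp [Fin.exists_fin_two, eq_comm]
    have hA2 := IsParamPair.of_ringKrullDim (hxA ▸ congrArg Ideal.span (e1 xA)) hAn
    have hB2 := IsParamPair.of_ringKrullDim (hyB ▸ congrArg Ideal.span (e1 yB)) hBn
    obtain ⟨φ, hφ⟩ : ∃ φ : A →+* B, ∀ a, (φ a : L) = algebraMap K L a :=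
      ⟨((algebraMap K L).comp A.subtype).codRestrict B (fun a => hAB.1 ⟨a, a.2, rfl⟩), fun _ => rfl⟩
    have hmp := IsMonomialPair.of_matrix hB2 δ a hdet (f := fun i => φ (xA i))
      (fun i => Subtype.ext ((hφ _).trans (hmon i)))
    exact not_isMonomialPair_of_isCentered hp hz hw hs hνκ hνz hνw hcA hcB hAle hBle φ hφ hA2 hB2 hmp

end

/-! ### Localizations of k[t, x, y] as algebraic local rings over k. -/

section

open IsLocalRing MvPolynomial

section AlgebraicLocalRing

/-- The local ring `κ[x, y]` at the origin, as a local subring of the field. -/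
def locSubring {κ F : Type*} [Field κ] [Field F] [Algebra κ F] {x y : F}
    (hxy : AlgebraicIndependent κ ![x, y]) : LocalSubring F :=
  @LocalSubring.mk F _ (locRing κ x y) (isLocalRing_locRing hxy)

variable {k κ F : Type*} [Field k] [Field κ] [Field F] [Algebra κ F] [Algebra k F] {ι : Type*} {t : ι → κ} {x y : F}

/-- The algebra `k[t, x, y]` for elements `t` of the coefficient field `κ`. -/
abbrev coordRing (k : Type*) {κ F : Type*} [Field k] [Field κ] [Field F] [Algebra κ F] [Algebra k F]
    {ι : Type*} (t : ι → κ) (x y : F) : Subalgebra k F :=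
  Algebra.adjoin k (Set.range (fun i => algebraMap κ F (t i)) ∪ {x, y})

theorem left_mem_coordRing : x ∈ coordRing k t x y := Algebra.subset_adjoin (by simp)

theorem right_mem_coordRing : y ∈ coordRing k t x y := Algebra.subset_adjoin (by simp)

variable [Algebra k κ] [IsScalarTower k κ F]

theorem algebraMap_aeval_mem_coordRing (P : MvPolynomial ι k) :
    algebraMap κ F (aeval t P) ∈ coordRing k t x y := by
  induction P using MvPolynomial.induction_on with
  | C a =>
    rw [aeval_C, ← IsScalarTower.algebraMap_apply]
    exact Subalgebra.algebraMap_mem _ a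
  | add P Q hP hQ => rw [map_add, map_add]; exact add_mem hP hQ
  | mul_X P i hP =>
    rw [map_mul, map_mul, aeval_X]
    exact mul_mem hP (Algebra.subset_adjoin (Or.inl ⟨i, rfl⟩))

theorem exists_eq_add_of_mem_coordRing {d : F} (hd : d ∈ coordRing k t x y) :
    ∃ c : κ, algebraMap κ F c ∈ coordRing k t x y ∧ ∃ r ∈ coordRing k t x y, ∃ s ∈ coordRing k t x y,
      d = algebraMap κ F c + x * r + y * s := by
  have hx := left_mem_coordRing (k := k) (t := t) (x := x) (y := y)
  have hy := right_mem_coordRing (k := k) (t := t) (x := x) (y := y)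
  induction hd using Algebra.adjoin_induction with
  | mem a ha =>
    rcases ha with ⟨i, rfl⟩ | rfl | rfl
    · exact ⟨t i, Algebra.subset_adjoin (Or.inl ⟨i, rfl⟩), 0, zero_mem _, 0, zero_mem _, by simp⟩
    · exact ⟨0, by simp, 1, one_mem _, 0, zero_mem _, by simp⟩
    · exact ⟨0, by simp, 0, zero_mem _, 1, one_mem _, by simp⟩
  | algebraMap a =>
    have e : algebraMap κ F (algebraMap k κ a) = algebraMap k F a := (IsScalarTower.algebraMap_apply k κ F a).symm
    exact ⟨algebraMap k κ a, e ▸ Subalgebra.algebraMap_mem _ a, 0, zero_mem _, 0, zero_mem _, by rw [e]; ring⟩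
  | add a b _ _ ha hb =>
    obtain ⟨c, hc, r, hr, s, hs, rfl⟩ := ha
    obtain ⟨c', hc', r', hr', s', hs', rfl⟩ := hb
    exact ⟨c + c', by rw [map_add]; exact add_mem hc hc', r + r', add_mem hr hr', s + s', add_mem hs hs',
      by rw [map_add]; ring⟩
  | mul a b _ hb' ha hb =>
    obtain ⟨c, hc, r, hr, s, hs, rfl⟩ := ha
    obtain ⟨c', hc', r', hr', s', hs', e⟩ := hb
    refine ⟨c * c', by rw [map_mul]; exact mul_mem hc hc', r * b + algebraMap κ F c * r',
      add_mem (mul_mem hr hb') (mul_mem hc hr'), s * b + algebraMap κ F c * s',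
      add_mem (mul_mem hs hb') (mul_mem hc hs'), ?_⟩
    rw [map_mul]
    linear_combination algebraMap κ F c * e

theorem coordRing_le_locRing : (coordRing k t x y).toSubring ≤ locRing κ x y := by
  intro d hd
  induction (show d ∈ coordRing k t x y from hd) using Algebra.adjoin_induction with
  | mem a ha =>
    rcases ha with ⟨i, rfl⟩ | rfl | rfl
    · exact algebraMap_mem_locRing _ _ _
    · exact left_mem_locRing _ _
    · exact right_mem_locRing _ _
  | algebraMap a =>
    rw [IsScalarTower.algebraMap_apply k κ F]
    exact algebraMap_mem_locRing _ _ _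
  | add a b ha hb ha' hb' => exact add_mem (ha' ha) (hb' hb)
  | mul a b ha hb ha' hb' => exact mul_mem (ha' ha) (hb' hb)

/-- The coefficients of P lie in k(t), and finitely many denominators from k[t] can be cleared
together. -/
theorem exists_smul_mem_coordRing (ht : IntermediateField.adjoin k (Set.range t) = ⊤) (P : MvPolynomial (Fin 2) κ) :
    ∃ s : κ, s ≠ 0 ∧ algebraMap κ F s ∈ coordRing k t x y ∧
      algebraMap κ F s * evalPair κ x y P ∈ coordRing k t x y := by
  induction P using MvPolynomial.induction_on with
  | C a =>
    obtain ⟨P, Q, e⟩ := (IntermediateField.mem_adjoin_range_iff k t a).mp (ht ▸ IntermediateField.mem_top)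
    by_cases hQ : aeval t Q = 0
    · rw [hQ, div_zero] at e
      exact ⟨1, one_ne_zero, by simp, by simp [e]⟩
    · refine ⟨aeval t Q, hQ, algebraMap_aeval_mem_coordRing Q, ?_⟩
      rw [aeval_C, ← map_mul, e, mul_div_cancel₀ _ hQ]
      exact algebraMap_aeval_mem_coordRing P
  | add P Q hP hQ =>
    obtain ⟨s, hs0, hs, h⟩ := hP
    obtain ⟨s', hs0', hs', h'⟩ := hQ
    refine ⟨s * s', mul_ne_zero hs0 hs0', by rw [map_mul]; exact mul_mem hs hs', ?_⟩
    rw [show algebraMap κ F (s * s') * evalPair κ x y (P + Q) = algebraMap κ F s' * (algebraMap κ F s * evalPair κ x y P)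
      + algebraMap κ F s * (algebraMap κ F s' * evalPair κ x y Q) by rw [map_mul, map_add]; ring]
    exact add_mem (mul_mem hs' h) (mul_mem hs h')
  | mul_X P i hP =>
    obtain ⟨s, hs0, hs, h⟩ := hP
    refine ⟨s, hs0, hs, ?_⟩
    rw [map_mul, ← mul_assoc]
    refine mul_mem h ?_
    fin_cases i
    · rw [Fin.zero_eta, evalPair_X_zero]; exact left_mem_coordRing
    · rw [Fin.mk_one, evalPair_X_one]; exact right_mem_coordRing

theorem exists_mul_mem_coordRing (ht : IntermediateField.adjoin k (Set.range t) = ⊤)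
    {f : F} (hf : f ∈ locRing κ x y) :
    ∃ b ∈ coordRing k t x y, IsUnitAt κ x y b ∧ f * b ∈ coordRing k t x y := by
  obtain ⟨P, Q, hQ, hQ0, rfl⟩ := hf
  obtain ⟨s, hs0, hs, h⟩ := exists_smul_mem_coordRing (F := F) (x := x) (y := y) ht P
  obtain ⟨s', hs0', hs', h'⟩ := exists_smul_mem_coordRing (F := F) (x := x) (y := y) ht Q
  refine ⟨algebraMap κ F s * (algebraMap κ F s' * evalPair κ x y Q), mul_mem hs h', ?_, ?_⟩
  · refine (IsUnitAt.of_algebraMap hs0).mul ((IsUnitAt.of_algebraMap hs0').mul ?_)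
    exact ⟨Q, 1, hQ, by simp, hQ0, by simp, by simp⟩
  · have : evalPair κ x y P / evalPair κ x y Q * (algebraMap κ F s * (algebraMap κ F s' * evalPair κ x y Q)) =
        algebraMap κ F s' * (algebraMap κ F s * evalPair κ x y P) := by field_simp
    rw [this]
    exact mul_mem hs' h

/-- An element of k[t, x, y] is c + x r + y s with all terms in that ring, and c in κ. It is a
nonunit in the localization exactly when c = 0. -/
theorem span_eq_comap_maximalIdeal (hxy : AlgebraicIndependent κ ![x, y]) [IsLocalRing (locRing κ x y)] :
    Ideal.span {c : (coordRing k t x y).toSubring | (c : F) ∈ ({x, y} : Set F)} =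
      (maximalIdeal (locRing κ x y)).comap (Subring.inclusion (coordRing_le_locRing (k := k) (t := t))) := by
  have hP := isParamPair_locRing hxy
  apply le_antisymm
  · rw [Ideal.span_le]
    rintro c (hc | hc)
    · have : Subring.inclusion coordRing_le_locRing c = locRing.left κ x y := Subtype.ext hc
      exact Ideal.mem_comap.mpr (this ▸ hP.left_mem)
    · have : Subring.inclusion coordRing_le_locRing c = locRing.right κ x y := Subtype.ext hc
      exact Ideal.mem_comap.mpr (this ▸ hP.right_mem)
  · rintro ⟨d, hd⟩ hdm
    rw [Ideal.mem_comap] at hdm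
    obtain ⟨c, hc, r, hr, s, hs, e⟩ := exists_eq_add_of_mem_coordRing (show d ∈ coordRing k t x y from hd)
    have hc0 : c = 0 := by
      by_contra hc0
      refine hdm ((locRing_isUnit_iff_isUnitAt hxy _).mpr ?_)
      exact isUnitAt_of_eq hxy hc0 (coordRing_le_locRing hr) (coordRing_le_locRing hs) e
    have e' : (⟨d, hd⟩ : (coordRing k t x y).toSubring) = ⟨r, hr⟩ * ⟨x, left_mem_coordRing⟩ + ⟨s, hs⟩ * ⟨y, right_mem_coordRing⟩ :=
      Subtype.ext (by
        simp only [Subring.coe_add, Subring.coe_mul]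
        rw [e, hc0, map_zero]; ring)
    rw [e']
    exact add_mem (Ideal.mul_mem_left _ _ (Ideal.subset_span (by simp)))
      (Ideal.mul_mem_left _ _ (Ideal.subset_span (by simp)))

end AlgebraicLocalRing

section

universe v

variable {k κ F : Type v} [Field k] [Field κ] [Field F] [Algebra k κ] [Algebra κ F] [Algebra k F]
  [IsScalarTower k κ F] {ι : Type*} {t : ι → κ} {x y : F}

/-- Nonzero elements of k[t] lie outside (x, y), so localizing k[t, x, y] at (x, y) already inverts
them and yields κ[x, y] localized at the origin. -/
theorem isLocalizationOfAdjoin_locSubring (ht : IntermediateField.adjoin k (Set.range t) = ⊤)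
    (hxy : AlgebraicIndependent κ ![x, y]) :
    IsLocalizationOfAdjoin k (Set.range (fun i => algebraMap κ F (t i)) ∪ {x, y}) {x, y} (locSubring hxy) := by
  have := isLocalRing_locRing hxy
  have hspan := span_eq_comap_maximalIdeal (k := k) (t := t) hxy
  have hprime : (Ideal.span {c : (coordRing k t x y).toSubring | (c : F) ∈ ({x, y} : Set F)}).IsPrime := by
    rw [hspan]; infer_instance
  refine ⟨hprime, LocalSubring.toSubring_injective ?_⟩
  have hunit : ∀ b : (coordRing k t x y).toSubring, IsUnitAt κ x y (b : F) ↔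
      b ∉ Ideal.span {c : (coordRing k t x y).toSubring | (c : F) ∈ ({x, y} : Set F)} := by
    intro b
    rw [hspan, Ideal.mem_comap, mem_maximalIdeal, mem_nonunits_iff, not_not, locRing_isUnit_iff_isUnitAt hxy]
    rfl
  generalize Ideal.span {c : (coordRing k t x y).toSubring | (c : F) ∈ ({x, y} : Set F)} = I at *
  ext f
  constructor
  · intro hf
    obtain ⟨b, hb, hbu, hfb⟩ := exists_mul_mem_coordRing (k := k) ht (show f ∈ locRing κ x y from hf)
    have h1 : IsUnit (algebraMap (coordRing k t x y).toSubring
        (LocalSubring.ofPrime (coordRing k t x y).toSubring I).toSubring ⟨b, hb⟩) :=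
      IsLocalization.map_units (M := I.primeCompl) _ ⟨⟨b, hb⟩, (hunit _).mp hbu⟩
    obtain ⟨w, hw⟩ := h1.exists_right_inv
    have hw' : b * (w : F) = 1 := congrArg Subtype.val hw
    have h2 : f = f * b * w := by rw [mul_assoc, hw', mul_one]
    rw [h2]
    exact mul_mem (LocalSubring.le_ofPrime _ I hfb) w.2
  · intro hf
    obtain ⟨a, b, h⟩ := IsLocalization.exists_mk'_eq I.primeCompl
      (⟨f, hf⟩ : (LocalSubring.ofPrime (coordRing k t x y).toSubring I).toSubring)
    have h1 := IsLocalization.mk'_spec (LocalSubring.ofPrime (coordRing k t x y).toSubring I).toSubring a b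
    rw [h] at h1
    have h2 : f * ((b : (coordRing k t x y).toSubring) : F) = a := congrArg Subtype.val h1
    have hb := (hunit b).mpr b.2
    rw [(eq_mul_inv_iff_mul_eq₀ hb.ne_zero).mpr h2]
    exact mul_mem (coordRing_le_locRing a.2) hb.inv.mem

theorem isAlgebraicLocalRing_locSubring [Finite ι] (ht : IntermediateField.adjoin k (Set.range t) = ⊤)
    (hxy : IsCoord κ x y) : IsAlgebraicLocalRing k (locSubring hxy.indep) := by
  refine ⟨hxy.isFractionRing, ⟨{ locRing κ x y with
    algebraMap_mem' := fun a => by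
      rw [IsScalarTower.algebraMap_apply k κ F]; exact algebraMap_mem_locRing _ _ _ }, rfl, ?_⟩⟩
  set S : Subalgebra k F := { locRing κ x y with
    algebraMap_mem' := fun a => by
      rw [IsScalarTower.algebraMap_apply k κ F]; exact algebraMap_mem_locRing _ _ _ } with hS
  have hSle : coordRing k t x y ≤ S := coordRing_le_locRing
  have hfin : (Set.range (fun i => algebraMap κ F (t i)) ∪ {x, y}).Finite :=
    (Set.finite_range _).union (Set.toFinite _)
  have hfin' : (S.val ⁻¹' (Set.range (fun i => algebraMap κ F (t i)) ∪ {x, y})).Finite :=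
    hfin.preimage Subtype.val_injective.injOn
  have hmem : ∀ d (hd : d ∈ coordRing k t x y), (⟨d, hSle hd⟩ : S) ∈ Algebra.adjoin k (hfin'.toFinset : Set S) := by
    intro d hd
    have h1 : d ∈ (Algebra.adjoin k (hfin'.toFinset : Set S)).map S.val := by
      rw [AlgHom.map_adjoin, Set.Finite.coe_toFinset, Set.image_preimage_eq_of_subset]
      · exact hd
      · intro a ha
        exact ⟨⟨a, hSle (Algebra.subset_adjoin ha)⟩, rfl⟩
    obtain ⟨d', hd', rfl⟩ := h1
    exact hd'
  rw [Algebra.essFiniteType_iff]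
  refine ⟨hfin'.toFinset, fun s => ?_⟩
  obtain ⟨b, hb, hbu, hfb⟩ := exists_mul_mem_coordRing ht (show (s : F) ∈ locRing κ x y from s.2)
  refine ⟨⟨b, hSle hb⟩, hmem b hb, ?_, hmem _ hfb⟩
  exact hbu.isUnit_of_le (S := S.toSubring) le_rfl

end

end

section

open IsLocalRing MvPolynomial

/-! ### Passage between the ground field k and the coefficient field κ. -/

section FunctionField

universe v

variable {k κ F : Type v} [Field k] [Field κ] [Field F] [Algebra k κ] [Algebra κ F] [Algebra k F]
  [IsScalarTower k κ F] {ι : Type} {t : ι → κ} {x y : F}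

theorem IsCoord.adjoin_union_eq_top (hxy : IsCoord κ x y) (ht : IntermediateField.adjoin k (Set.range t) = ⊤) :
    IntermediateField.adjoin k (Set.range (fun i => algebraMap κ F (t i)) ∪ {x, y}) = ⊤ := by
  rw [eq_top_iff]
  intro f _
  have hκ : ∀ a : κ, algebraMap κ F a ∈
      IntermediateField.adjoin k (Set.range (fun i => algebraMap κ F (t i)) ∪ {x, y}) := by
    intro a
    have h1 : algebraMap κ F a ∈ (IntermediateField.adjoin k (Set.range t)).map (IsScalarTower.toAlgHom k κ F) :=
      ⟨a, ht ▸ IntermediateField.mem_top, rfl⟩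
    rw [IntermediateField.adjoin_map] at h1
    refine IntermediateField.adjoin.mono _ _ _ ?_ h1
    rintro _ ⟨_, ⟨i, rfl⟩, rfl⟩
    exact Or.inl ⟨i, rfl⟩
  have hf : f ∈ IntermediateField.adjoin κ {x, y} := hxy.gen ▸ IntermediateField.mem_top
  induction hf using IntermediateField.adjoin_induction with
  | mem a ha => exact IntermediateField.subset_adjoin _ _ (Or.inr ha)
  | algebraMap a => exact hκ a
  | add a b _ _ ha hb => exact add_mem (ha trivial) (hb trivial)
  | inv a _ ha => exact inv_mem (ha trivial)
  | mul a b _ _ ha hb => exact mul_mem (ha trivial) (hb trivial)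

theorem IsCoord.isAlgFunctionField {m : ℕ} {t : Fin m → κ} (hxy : IsCoord κ x y) (ht : AlgebraicIndependent k t)
    (ht' : IntermediateField.adjoin k (Set.range t) = ⊤) : IsAlgFunctionField k F (m + 2) := by
  constructor
  · rw [← hxy.adjoin_union_eq_top ht']
    exact IntermediateField.fg_adjoin_of_finite ((Set.finite_range _).union (Set.toFinite _))
  · have := isAlgebraic_adjoin_of_adjoin_eq_top _ ht'
    have h1 := (ht.isTranscendenceBasis_iff_isAlgebraic).mpr this
    have h2 : Algebra.trdeg k κ = m := by simpa using h1.lift_cardinalMk_eq_trdeg.symm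
    rw [← trdeg_add_eq k κ (A := F), h2, hxy.trdeg_eq]
    norm_cast

theorem IsCoord.algebraicIndependent_sumElim (hxy : IsCoord κ x y) (ht : AlgebraicIndependent k t) :
    AlgebraicIndependent k (Sum.elim (fun i => algebraMap κ F (t i)) ![x, y]) := by
  have := (ht.sumElim_comp hxy.indep).comp _ (Equiv.sumComm ι (Fin 2)).injective
  convert this using 1
  ext i
  rcases i with i | i <;> rfl

end FunctionField

/-! ### The extension L / K is finite and separable. -/

section Extension

variable {κ K L : Type*} [Field κ] [Field K] [Field L] [Algebra κ K] [Algebra κ L] [Algebra K L]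
  [IsScalarTower κ K L] {p : ℕ} {x y : L} {u v : K}

open Polynomial in
/-- The second coordinate generates the extension, and is separable. -/
theorem isSeparable_and_adjoin_eq_top (hp : p.Prime) [CharP K p] (hxy : IsCoord κ x y)
    (hu : algebraMap K L u = x ^ p * (1 + y)) (hv : algebraMap K L v = y ^ p + x) :
    IsSeparable K y ∧ IntermediateField.adjoin K {y} = ⊤ := by
  constructor
  -- Eliminating x = v - y^p from u = x^p (1 + y) gives an equation for y over K. In characteristic
  -- p its derivative at y is x^p, which is not zero.
  · set f : K[X] := (Polynomial.C v - Polynomial.X ^ p) ^ p * (1 + Polynomial.X) - Polynomial.C u with hf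
    have hx : algebraMap K L v - y ^ p = x := by rw [hv]; ring
    have hfy : Polynomial.aeval y f = 0 := by
      simp [hf, hx, hu]
    have hfy' : Polynomial.aeval y (derivative f) ≠ 0 := by
      have : derivative f = (Polynomial.C v - Polynomial.X ^ p) ^ p := by
        rw [hf]
        simp [derivative_mul, derivative_pow]
      rw [this]
      simp [hx, hxy.ne_zero_left, hp.ne_zero]
    have hf0 : f ≠ 0 := by rintro h; rw [h] at hfy'; simp at hfy'
    have hint : IsIntegral K y := (isAlgebraic_iff_isIntegral).mp ⟨f, hf0, hfy⟩
    rw [IsSeparable, separable_iff_derivative_ne_zero (minpoly.irreducible hint)]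
    intro h0
    obtain ⟨g, hg⟩ := minpoly.dvd K y hfy
    apply hfy'
    rw [hg, derivative_mul, h0, map_add, map_mul, map_mul, minpoly.aeval]
    simp
  · have hy : y ∈ IntermediateField.adjoin K {y} := IntermediateField.mem_adjoin_simple_self K y
    have hx : x ∈ IntermediateField.adjoin K {y} := by
      have : x = algebraMap K L v - y ^ p := by rw [hv]; ring
      rw [this]
      exact sub_mem (IntermediateField.algebraMap_mem _ _) (pow_mem hy _)
    rw [eq_top_iff]
    intro f _
    have hf : f ∈ IntermediateField.adjoin κ {x, y} := hxy.gen ▸ IntermediateField.mem_top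
    induction hf using IntermediateField.adjoin_induction with
    | mem a ha => rcases ha with rfl | rfl <;> assumption
    | algebraMap a =>
      rw [IsScalarTower.algebraMap_apply κ K L]
      exact IntermediateField.algebraMap_mem _ _
    | add a b _ _ ha hb => exact add_mem (ha trivial) (hb trivial)
    | inv a _ ha => exact inv_mem (ha trivial)
    | mul a b _ _ ha hb => exact mul_mem (ha trivial) (hb trivial)

theorem finiteDimensional_and_isSeparable (hp : p.Prime) [CharP K p] (hxy : IsCoord κ x y)
    (hu : algebraMap K L u = x ^ p * (1 + y)) (hv : algebraMap K L v = y ^ p + x) :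
    FiniteDimensional K L ∧ Algebra.IsSeparable K L := by
  obtain ⟨h1, h2⟩ := isSeparable_and_adjoin_eq_top hp hxy hu hv
  constructor
  · have := IntermediateField.adjoin.finiteDimensional h1.isIntegral
    rw [h2] at this
    exact Module.Finite.equiv (IntermediateField.topEquiv (F := K) (E := L)).toLinearEquiv
  · have := (IntermediateField.isSeparable_adjoin_simple_iff_isSeparable K L).mpr h1
    rw [h2] at this
    exact AlgEquiv.Algebra.isSeparable (IntermediateField.topEquiv (F := K) (E := L))

theorem isCoord_of_isAlgebraic [Algebra.IsAlgebraic K L] (hxy : IsCoord κ x y)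
    (huv : IntermediateField.adjoin κ {u, v} = ⊤) : IsCoord κ u v := by
  refine ⟨?_, huv⟩
  rw [← Matrix.range_pair] at huv
  have := isAlgebraic_adjoin_of_adjoin_eq_top _ huv
  refine (Algebra.IsAlgebraic.isTranscendenceBasis_of_lift_le_trdeg_of_finite κ _ ?_).1
  have h := lift_trdeg_add_eq κ K L
  have h0 : Algebra.trdeg K L = 0 := trdeg_eq_zero
  rw [h0, hxy.trdeg_eq] at h
  simp at h
  simp [h]

end Extension

/-! ### Construction of the fields. -/

section Construction

theorem IsCentered.map {K L : Type*} [Field K] [Field L] [Algebra K L] {ν : AddValuation L (WithTop ℚ)}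
    {S : Subring K} (h : IsCentered (ν.comap (algebraMap K L)) S) : IsCentered ν (S.map (algebraMap K L)) := by
  rintro _ ⟨f, hf, rfl⟩
  obtain ⟨h1, h2⟩ := h f hf
  exact ⟨h1, fun h0 => ⟨f⁻¹, h2 h0, map_inv₀ _ _⟩⟩

theorem FractionRing.mvPolynomial_adjoin_eq_top (k : Type*) [Field k] (ι : Type*) :
    IntermediateField.adjoin k (Set.range fun i : ι => algebraMap (MvPolynomial ι k)
      (FractionRing (MvPolynomial ι k)) (X i)) = ⊤ := by
  rw [eq_top_iff]
  intro f _
  obtain ⟨P, Q, -, rfl⟩ := IsFractionRing.div_surjective (A := MvPolynomial ι k) f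
  have h : ∀ P : MvPolynomial ι k, algebraMap _ (FractionRing (MvPolynomial ι k)) P =
      aeval (fun i => algebraMap (MvPolynomial ι k) (FractionRing (MvPolynomial ι k)) (X i)) P := by
    intro P
    exact congrArg (algebraMap _ (FractionRing (MvPolynomial ι k))) (aeval_X_left_apply P).symm |>.trans
      (MvPolynomial.aeval_algebraMap_apply _ X P).symm
  rw [IntermediateField.mem_adjoin_range_iff]
  exact ⟨P, Q, by rw [h, h]⟩

theorem FractionRing.mvPolynomial_algebraicIndependent (k : Type*) [Field k] (ι : Type*) :
    AlgebraicIndependent k fun i : ι => algebraMap (MvPolynomial ι k) (FractionRing (MvPolynomial ι k)) (X i) :=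
  (MvPolynomial.algebraicIndependent_X ι k).map' (f := IsScalarTower.toAlgHom k _ _)
    (IsFractionRing.injective _ _)

theorem exists_isCoord.{v} (κ : Type v) [Field κ] : ∃ (L : Type v) (_ : Field L) (_ : Algebra κ L) (x y : L), IsCoord κ x y := by
  refine ⟨FractionRing (MvPolynomial (Fin 2) κ), inferInstance, inferInstance, _, _,
    (?_ : IsCoord κ (algebraMap (MvPolynomial (Fin 2) κ) _ (X 0)) (algebraMap (MvPolynomial (Fin 2) κ) _ (X 1)))⟩
  have h1 := FractionRing.mvPolynomial_algebraicIndependent κ (Fin 2)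
  have h2 := FractionRing.mvPolynomial_adjoin_eq_top κ (Fin 2)
  have h3 : (fun i => algebraMap (MvPolynomial (Fin 2) κ) (FractionRing (MvPolynomial (Fin 2) κ)) (X i)) =
    ![algebraMap (MvPolynomial (Fin 2) κ) _ (X 0), algebraMap (MvPolynomial (Fin 2) κ) _ (X 1)] := by
    ext i; fin_cases i <;> rfl
  rw [h3] at h1 h2
  rw [Matrix.range_pair] at h2
  exact ⟨h1, h2⟩

theorem exists_subfield_adjoin_pair.{v} {κ L : Type v} [Field κ] [Field L] [Algebra κ L] (a b : L) :
    ∃ (K : Type v) (_ : Field K) (_ : Algebra κ K) (_ : Algebra K L) (_ : IsScalarTower κ K L) (u v : K),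
      IntermediateField.adjoin κ {u, v} = ⊤ ∧ algebraMap K L u = a ∧ algebraMap K L v = b := by
  refine ⟨IntermediateField.adjoin κ {a, b}, inferInstance, inferInstance, inferInstance, inferInstance,
    ⟨a, IntermediateField.subset_adjoin _ _ (by simp)⟩, ⟨b, IntermediateField.subset_adjoin _ _ (by simp)⟩,
    ?_, rfl, rfl⟩
  apply IntermediateField.lift_injective
  rw [IntermediateField.lift_adjoin, IntermediateField.lift_top, Set.image_pair]

theorem exists_constant_field.{v} (k : Type v) [Field k] (m : ℕ) : ∃ (κ : Type v) (_ : Field κ) (_ : Algebra k κ)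
    (t : Fin m → κ), AlgebraicIndependent k t ∧ IntermediateField.adjoin k (Set.range t) = ⊤ :=
  ⟨FractionRing (MvPolynomial (Fin m) k), inferInstance, inferInstance, _,
    FractionRing.mvPolynomial_algebraicIndependent k (Fin m), FractionRing.mvPolynomial_adjoin_eq_top k (Fin m)⟩

end Construction

end

theorem theorem1p3 (k : Type u) [Field k] (p : ℕ) [CharP k p] (hp : 0 < p)
    (hk : 3 ≤ Cardinal.mk k) (n : ℕ) (hn : 2 ≤ n) :
    ∃ (K L : Type u) (_ : Field K) (_ : Field L) (_ : Algebra k K) (_ : Algebra k L)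
      (_ : Algebra K L) (_ : IsScalarTower k K L),
      -- `L / K` is a finite separable extension of `n`-dimensional function fields over `k`
      IsAlgFunctionField k K n ∧ IsAlgFunctionField k L n ∧
      FiniteDimensional K L ∧ Algebra.IsSeparable K L ∧
      ∃ (t : Fin (n - 2) → K) (u v : K) (x y : L) (νs : AddValuation L (WithTop ℚ))
        (ν : AddValuation K (WithTop ℚ)) (A : LocalSubring K) (B : LocalSubring L),
        -- the explicit form of the fields: `L = k(t, x, y)` is a rational function field and
        -- `K = k(t, u, v)` with `u = x ^ p * (1 + y)` and `v = y ^ p + x`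
        AlgebraicIndependent k (Sum.elim (fun i => algebraMap K L (t i)) ![x, y]) ∧
        IntermediateField.adjoin k (Set.range (fun i => algebraMap K L (t i)) ∪ {x, y}) = ⊤ ∧
        IntermediateField.adjoin k (Set.range t ∪ {u, v}) = ⊤ ∧
        algebraMap K L u = x ^ p * (1 + y) ∧
        algebraMap K L v = y ^ p + x ∧
        -- `νs` is a `k`-valuation with restriction `ν`; the value groups are `(1/p^∞)ℤ`
        (∀ c : k, c ≠ 0 → νs (algebraMap k L c) = 0) ∧
        ν = νs.comap (algebraMap K L) ∧
        νs x = 1 ∧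
        valueSet νs = onePPowInfty p ∧
        valueSet ν = onePPowInfty p ∧
        -- `A = k[t, u, v]_{(u, v)}` and `B = k[t, x, y]_{(x, y)}`
        IsLocalizationOfAdjoin k (Set.range t ∪ {u, v}) {u, v} A ∧
        IsLocalizationOfAdjoin k (Set.range (fun i => algebraMap K L (t i)) ∪ {x, y}) {x, y} B ∧
        -- `A` and `B` are regular algebraic local rings, `B` dominates `A`, `νs` dominates `B`
        IsAlgebraicLocalRing k A ∧ IsRegularLocalRing A.toSubring ∧
        IsAlgebraicLocalRing k B ∧ IsRegularLocalRing B.toSubring ∧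
        Dominates B A ∧ B ≤ valuationLocalRing νs ∧
        -- no regular algebraic local rings above `A` and `B` along `νs` give a monomial extension
        ¬ ∃ (A' : LocalSubring K) (B' : LocalSubring L),
          IsAlgebraicLocalRing k A' ∧ IsRegularLocalRing A'.toSubring ∧
          IsAlgebraicLocalRing k B' ∧ IsRegularLocalRing B'.toSubring ∧
          B' ≤ valuationLocalRing νs ∧ Dominates B' A' ∧ A ≤ A' ∧ B ≤ B' ∧
          IsMonomialExtension A' B' := by
  have hprime : p.Prime := (CharP.char_is_prime_or_zero k p).resolve_right hp.ne'
  obtain ⟨m, rfl⟩ : ∃ m, n = m + 2 := ⟨n - 2, by omega⟩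
  -- The variables t are absorbed into the coefficient field κ = k(t), which reduces the problem to
  -- two variables over κ.
  obtain ⟨κ, _, _, t, ht, ht'⟩ := exists_constant_field k m
  obtain ⟨L, _, _, x, y, hxy⟩ := exists_isCoord κ
  obtain ⟨K, _, _, _, _, u, v, huv', hu, hv⟩ := exists_subfield_adjoin_pair (κ := κ) (x ^ p * (1 + y)) (y ^ p + x)
  let : Algebra k K := ((algebraMap κ K).comp (algebraMap k κ)).toAlgebra
  let : Algebra k L := ((algebraMap κ L).comp (algebraMap k κ)).toAlgebra
  have : IsScalarTower k κ K := .of_algebraMap_eq' rfl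
  have : IsScalarTower k κ L := .of_algebraMap_eq' rfl
  have : IsScalarTower k K L := .of_algebraMap_eq fun a => by
    rw [IsScalarTower.algebraMap_apply k κ L, IsScalarTower.algebraMap_apply k κ K,
      ← IsScalarTower.algebraMap_apply κ K L]
  have : CharP κ p := charP_of_injective_algebraMap (algebraMap k κ).injective p
  have : CharP K p := charP_of_injective_algebraMap (algebraMap κ K).injective p
  have hκ : 3 ≤ Cardinal.mk κ := hk.trans (Cardinal.mk_le_of_injective (algebraMap k κ).injective)
  obtain ⟨hfd, hsep⟩ := finiteDimensional_and_isSeparable hprime hxy hu hv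
  have huv := isCoord_of_isAlgebraic (K := K) (L := L) hxy huv'
  obtain ⟨ν, hνκ, hνx, hνy, hνu, hνv, hvL, hvK, hmon⟩ :=
    exists_valuation_not_isMonomialExtension hprime hκ hxy huv hu hv
  have htL : (fun i => algebraMap K L (algebraMap κ K (t i))) = fun i => algebraMap κ L (t i) :=
    funext fun i => (IsScalarTower.algebraMap_apply κ K L _).symm
  have hcA : IsCentered (ν.comap (algebraMap K L)) (locRing κ u v) := isCentered_locRing (fun a ha => by
    change ν (algebraMap K L (algebraMap κ K a)) = 0
    rw [← IsScalarTower.algebraMap_apply]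
    exact hνκ a ha) hνu hνv huv.indep
  have hcB : IsCentered ν (locRing κ x y) := isCentered_locRing hνκ (by rw [hνx]; exact one_pos) hνy hxy.indep
  have hAB : (locRing κ u v).map (algebraMap K L) ≤ locRing κ x y := by
    rw [Subring.map_le_iff_le_comap]
    refine locRing_le_of_isCentered (κ := κ) (F := K) (ν := ν.comap (algebraMap K L)) (fun a ha => ?_) hνu hνv hcB.comap (fun a => ?_) ?_ ?_
    · change ν (algebraMap K L (algebraMap κ K a)) = 0
      rw [← IsScalarTower.algebraMap_apply]
      exact hνκ a ha
    · rw [Subring.mem_comap, ← IsScalarTower.algebraMap_apply]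
      exact algebraMap_mem_locRing _ _ a
    · rw [Subring.mem_comap, hu]
      exact mul_mem (pow_mem (left_mem_locRing _ _) _) (add_mem (one_mem _) (right_mem_locRing _ _))
    · rw [Subring.mem_comap, hv]
      exact add_mem (pow_mem (right_mem_locRing _ _) _) (left_mem_locRing _ _)
  refine ⟨K, L, inferInstance, inferInstance, inferInstance, inferInstance, inferInstance, inferInstance,
    huv.isAlgFunctionField ht ht', hxy.isAlgFunctionField ht ht', hfd, hsep,
    fun i => algebraMap κ K (t i), u, v, x, y, ν, ν.comap (algebraMap K L), locSubring huv.indep, locSubring hxy.indep,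
    htL ▸ hxy.algebraicIndependent_sumElim ht, htL ▸ hxy.adjoin_union_eq_top ht', huv.adjoin_union_eq_top ht', hu, hv,
    fun c hc => ?_, rfl, hνx, hvL, hvK, isLocalizationOfAdjoin_locSubring ht' huv.indep,
    htL ▸ isLocalizationOfAdjoin_locSubring ht' hxy.indep, isAlgebraicLocalRing_locSubring ht' huv,
    isRegularLocalRing_locRing huv.indep, isAlgebraicLocalRing_locSubring ht' hxy,
    isRegularLocalRing_locRing hxy.indep, ⟨hAB, isLocalHom_inclusion_of_isCentered hcA.map hcB hAB⟩,
    le_valuationLocalRing_of_isCentered hcB, ?_⟩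
  · rw [IsScalarTower.algebraMap_apply k κ L]
    exact hνκ _ (by simpa using hc)
  · rintro ⟨A', B', -, -, -, -, hB', hdom, hA, hB, hext⟩
    exact hmon A' B' hB' hdom hA.1 hB.1 hext
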